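/- Let $H$ be a Hopf algebra over a field $k$, with comultiplication $\Delta(h)=\sum h_{(1)}\otimes h_{(2)}$ and counit $\varepsilon$, and let $A$ be a left $H$-module algebra, i.e. a unital associative $k$-algebra with a left $H$-module structure such that $h1_A=\varepsilon(h)1_A$ and $h(ab)=\sum (h_{(1)}a)(h_{(2)}b)$. Let ${}_H\mathcal M_A$ be the category of Hopf modules: its objects are the $k$-spaces $M$ that are left $H$-modules and right $A$-modules with $h(va)=\sum (h_{(1)}v)(h_{(2)}a)$ for $h\in H$, $v\in M$, $a\in A$; its subobjects are the $A$-submodules stable under $H$. An object $M$ is *locally $A$-finite* if it is a directed union of subobjects that are finitely generated as right $A$-modules. Ideals of noncommutative rings are two-sided, $\operatorname{Max}$ denotes the set of maximal ideals, and an ideal $P\ne A$ of $A$ is prime if $IJ\subseteq P$ implies $I\subseteq P$ or $J\subseteq P$ for all ideals $I,J$ of $A$. **Theorem 6.3.** Suppose that $A$ is module-finite over a central subring $Z$ such that $Z$ is a Jacobson ring, the space $\operatorname{Max} Z$ (with the Zariski topology) is noetherian, and each maximal ideal of $Z$ is contained in exactly one maximal ideal of $A$. Let $P$ be a prime ideal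 of $A$ that contains no nonzero $H$-stable ideals of $A$. Put $\mathfrak p=P\cap Z$, let $A_{\mathfrak p}$ and $M_{\mathfrak p}$ denote the localizations of $A$ and of a right $A$-module $M$ at the multiplicatively closed set $Z\setminus\mathfrak p$, and let $$l=\gcd\{\operatorname{length} A_{\mathfrak p}/Q' \mid Q'\in\operatorname{Max} A_{\mathfrak p}\},$$ where $\operatorname{length}$ is the composition length as a right $A_{\mathfrak p}$-module. These lengths are finite, $l$ is a positive integer, and for every locally $A$-finite object $M$ of ${}_H\mathcal M_A$ the direct sum $M_{\mathfrak p}^{\,l}$ of $l$ copies of $M_{\mathfrak p}$ is a free right $A_{\mathfrak p}$-module. -/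

import Mathlib

open scoped MulOpposite TensorProduct

/-! Conventions. Right `A`-modules are modules over `Aᵐᵒᵖ`, as usual in Mathlib: `v a` is
`MulOpposite.op a • v`. Ideals of a noncommutative ring are two-sided: `TwoSidedIdeal A`.
A central subring of `A` is a commutative ring `Z` with an injective `algebraMap Z A`
(whose image is central by the definition of `Algebra`). -/

namespace HopfMod

section Actions

variable (k H A M : Type*) [Field k] [Ring H] [HopfAlgebra k H]
  [Ring A] [Algebra k A] [Module H A] [IsScalarTower k H A]
  [AddCommGroup M] [Module k M] [Module H M] [IsScalarTower k H M]

/-- The `k`-linear map `H → M`, `h ↦ h v`. -/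
def orbitMap {M : Type*} [AddCommGroup M] [Module k M] [Module H M] [IsScalarTower k H M]
    (v : M) : H →ₗ[k] M where
  toFun h := h • v
  map_add' g h := add_smul g h v
  map_smul' c h := smul_assoc c h v

/-- The `k`-bilinear map `M × A → M`, `(v, a) ↦ v a`, of a right `A`-module. -/
def rightAction [Module Aᵐᵒᵖ M] [IsScalarTower k Aᵐᵒᵖ M] : M →ₗ[k] A →ₗ[k] M :=
  LinearMap.mk₂ k (fun v a => MulOpposite.op a • v)
    (fun v w a => smul_add _ v w)
    (fun c v a => by
      rw [← algebraMap_smul Aᵐᵒᵖ c v, ← algebraMap_smul Aᵐᵒᵖ c (MulOpposite.op a • v),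
        smul_smul, smul_smul, Algebra.commutes])
    (fun v a b => by rw [MulOpposite.op_add, add_smul])
    (fun c v a => by rw [MulOpposite.op_smul, smul_assoc])

/-- `A` is a left `H`-module algebra: `h 1 = ε(h) 1` and `h (a b) = ∑ (h₁ a) (h₂ b)`. -/
structure IsModuleAlgebra : Prop where
  smul_one : ∀ h : H, h • (1 : A) = algebraMap k A (Coalgebra.counit (R := k) h)
  smul_mul : ∀ (h : H) (a b : A), h • (a * b) =
    TensorProduct.lift ((LinearMap.mul k A).compl₁₂ (orbitMap k H a) (orbitMap k H b))
      (Coalgebra.comul (R := k) h)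

/-- `M` (a left `H`-module and a right `A`-module) is an object of the category of Hopf modules
`_H M_A`: `h (v a) = ∑ (h₁ v) (h₂ a)`. -/
def IsHopfModule [Module Aᵐᵒᵖ M] [IsScalarTower k Aᵐᵒᵖ M] : Prop :=
  ∀ (h : H) (v : M) (a : A), h • (MulOpposite.op a • v) =
    TensorProduct.lift ((rightAction k A M).compl₁₂ (orbitMap k H v) (orbitMap k H a))
      (Coalgebra.comul (R := k) h)

end Actions

/-- A two-sided ideal stable under the action of `H`. -/
def IsStableIdeal (H : Type*) {A : Type*} [Ring H] [Ring A] [Module H A]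
    (I : TwoSidedIdeal A) : Prop :=
  ∀ (h : H), ∀ a ∈ I, h • a ∈ I

/-- An `A`-submodule of the right `A`-module `M` that is a subobject in `_H M_A`. -/
def IsSubobject (H : Type*) {A M : Type*} [Ring H] [Ring A] [AddCommGroup M] [Module H M]
    [Module Aᵐᵒᵖ M] (N : Submodule Aᵐᵒᵖ M) : Prop :=
  ∀ (h : H), ∀ v ∈ N, h • v ∈ N

/-- `M` is locally `A`-finite: a directed union of subobjects in `_H M_A` that are finitely
generated as `A`-modules. -/
def IsLocallyFinite (H A M : Type*) [Ring H] [Ring A] [AddCommGroup M] [Module H M]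
    [Module Aᵐᵒᵖ M] : Prop :=
  ∃ F : Set (Submodule Aᵐᵒᵖ M), DirectedOn (· ≤ ·) F ∧
    (∀ N ∈ F, IsSubobject H N ∧ N.FG) ∧ ∀ v : M, ∃ N ∈ F, v ∈ N

/-- The prime spectrum `Spec A` of a (noncommutative) ring: proper two-sided ideals `P` such that
`I J ⊆ P` implies `I ⊆ P` or `J ⊆ P` for two-sided ideals `I`, `J`. -/
structure Spec (A : Type*) [Ring A] where
  /-- the underlying two-sided ideal -/
  ideal : TwoSidedIdeal A
  ne_top : ideal ≠ ⊤
  le_or_le : ∀ I J : TwoSidedIdeal A, (∀ x ∈ I, ∀ y ∈ J, x * y ∈ ideal) → I ≤ ideal ∨ J ≤ ideal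

/-- Multiples of a central element form a two-sided ideal. -/
def centralMultiples {Z A : Type*} [CommRing Z] [Ring A] [Algebra Z A] (z : Z) :
    TwoSidedIdeal A :=
  TwoSidedIdeal.mk' {x | ∃ a : A, x = z • a} ⟨0, (smul_zero z).symm⟩
    (by rintro _ _ ⟨a, rfl⟩ ⟨b, rfl⟩; exact ⟨a + b, (smul_add z a b).symm⟩)
    (by rintro _ ⟨a, rfl⟩; exact ⟨-a, (smul_neg z a).symm⟩)
    (by rintro x _ ⟨a, rfl⟩; exact ⟨x * a, mul_smul_comm z x a⟩)
    (by rintro _ y ⟨a, rfl⟩; exact ⟨a * y, smul_mul_assoc z a y⟩)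

lemma mem_centralMultiples {Z A : Type*} [CommRing Z] [Ring A] [Algebra Z A] (z : Z) (x : A) :
    x ∈ centralMultiples (A := A) z ↔ ∃ a : A, x = z • a := by
  simp [centralMultiples, TwoSidedIdeal.mem_mk']

/-- The contraction `P ∩ Z ∈ Spec Z` of `P ∈ Spec A` to a central subring `Z`. -/
def Spec.contract (Z : Type*) {A : Type*} [CommRing Z] [Ring A] [Algebra Z A] (P : Spec A) :
    PrimeSpectrum Z where
  asIdeal := P.ideal.asIdeal.comap (algebraMap Z A)
  isPrime := by
    refine ⟨fun h => P.ne_top ?_, fun {x y} h => ?_⟩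
    · have h1 : (1 : Z) ∈ P.ideal.asIdeal.comap (algebraMap Z A) := h ▸ Submodule.mem_top
      have h2 : (1 : A) ∈ P.ideal := by
        simpa [Ideal.mem_comap, TwoSidedIdeal.mem_asIdeal] using h1
      refine eq_top_iff.mpr fun a _ => ?_
      simpa using P.ideal.mul_mem_left a 1 h2
    · have hxy : algebraMap Z A (x * y) ∈ P.ideal := h
      have key : ∀ z : Z, centralMultiples (A := A) z ≤ P.ideal → algebraMap Z A z ∈ P.ideal :=
        fun z hz => hz ((mem_centralMultiples z _).mpr ⟨1, Algebra.algebraMap_eq_smul_one z⟩)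
      refine (P.le_or_le (centralMultiples x) (centralMultiples y) ?_).imp (key x) (key y)
      intro u hu v hv
      obtain ⟨a, rfl⟩ := (mem_centralMultiples x u).mp hu
      obtain ⟨b, rfl⟩ := (mem_centralMultiples y v).mp hv
      have : (x • a) * (y • b) = algebraMap Z A (x * y) * (a * b) := by
        rw [smul_mul_smul_comm, Algebra.smul_def]
      rw [this]
      exact P.ideal.mul_mem_right _ _ hxy

section Localization

variable {Z A M : Type*} [CommRing Z] [Ring A] [Algebra Z A] [AddCommGroup M] [Module Z M]
  [Module Aᵐᵒᵖ M] [IsScalarTower Z Aᵐᵒᵖ M] (S : Submonoid Z)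

lemma op_smul_zsmul (z : Z) (a : A) (v : M) :
    MulOpposite.op a • (z • v) = z • (MulOpposite.op a • v) := by
  rw [← algebraMap_smul Aᵐᵒᵖ z v, ← algebraMap_smul Aᵐᵒᵖ z (MulOpposite.op a • v),
    smul_smul, smul_smul, Algebra.commutes]

lemma op_zsmul_smul (z : Z) (a : A) (v : M) :
    MulOpposite.op (z • a) • v = z • (MulOpposite.op a • v) := by
  rw [MulOpposite.op_smul, smul_assoc]

/-- The right action of `S⁻¹A` on `S⁻¹M`: `(v / t) (a / s) = (v a) / (s t)`. -/
noncomputable def locAct (x : LocalizedModule S A) (m : LocalizedModule S M) :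
    LocalizedModule S M :=
  x.liftOn (fun p => m.liftOn
      (fun q => LocalizedModule.mk (MulOpposite.op p.1 • q.1) (p.2 * q.2))
      (by
        rintro ⟨v, t⟩ ⟨v', t'⟩ ⟨u, hu⟩
        refine LocalizedModule.mk_eq.mpr ⟨u, ?_⟩
        simp only [Submonoid.smul_def, mul_smul] at hu ⊢
        have := congrArg (fun w => (p.2 : Z) • MulOpposite.op p.1 • w) hu
        simp only [op_smul_zsmul] at this
        rw [smul_comm (u : Z) (p.2 : Z), smul_comm (u : Z) (p.2 : Z)]
        exact this))
    (by
      rintro ⟨a, s⟩ ⟨a', s'⟩ ⟨u, hu⟩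
      induction m using LocalizedModule.induction_on with | _ v t => _
      simp only [LocalizedModule.liftOn_mk]
      refine LocalizedModule.mk_eq.mpr ⟨u, ?_⟩
      simp only [Submonoid.smul_def, mul_smul] at hu ⊢
      have := congrArg (fun b : A => MulOpposite.op b • ((t : Z) • v)) hu
      simp only [op_zsmul_smul] at this
      simpa only [op_smul_zsmul] using this)

lemma locAct_mk (a : A) (s : S) (v : M) (t : S) :
    locAct S (LocalizedModule.mk a s) (LocalizedModule.mk v t) =
      LocalizedModule.mk (MulOpposite.op a • v) (s * t) := rfl

lemma locAct_add (x : LocalizedModule S A) (m n : LocalizedModule S M) :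
    locAct S x (m + n) = locAct S x m + locAct S x n := by
  induction x using LocalizedModule.induction_on with | _ a s => _
  induction m using LocalizedModule.induction_on with | _ v t => _
  induction n using LocalizedModule.induction_on with | _ w r => _
  simp only [LocalizedModule.mk_add_mk, locAct_mk]
  refine LocalizedModule.mk_eq.mpr ⟨1, ?_⟩
  simp only [Submonoid.smul_def, Submonoid.coe_mul, smul_add, op_smul_zsmul, smul_smul,
    Submonoid.coe_one]
  congr 2 <;> ring

lemma add_locAct (x y : LocalizedModule S A) (m : LocalizedModule S M) :
    locAct S (x + y) m = locAct S x m + locAct S y m := by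
  induction x using LocalizedModule.induction_on with | _ a s => _
  induction y using LocalizedModule.induction_on with | _ b t => _
  induction m using LocalizedModule.induction_on with | _ v r => _
  simp only [LocalizedModule.mk_add_mk, locAct_mk]
  refine LocalizedModule.mk_eq.mpr ⟨1, ?_⟩
  simp only [Submonoid.smul_def, Submonoid.coe_mul, smul_add, op_zsmul_smul, smul_smul,
    Submonoid.coe_one, MulOpposite.op_add, add_smul]
  congr 2 <;> ring

/-- `S⁻¹M` as a right module over the ring `S⁻¹A`. -/
noncomputable instance locRightModule :
    Module (LocalizedModule S A)ᵐᵒᵖ (LocalizedModule S M) where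
  smul c m := locAct S c.unop m
  one_smul m := by
    change locAct S (1 : LocalizedModule S A) m = m
    induction m using LocalizedModule.induction_on with | _ v t => _
    rw [OreLocalization.one_def, locAct_mk, MulOpposite.op_one, one_smul, one_mul]
  mul_smul c d m := by
    change locAct S (d.unop * c.unop) m = locAct S c.unop (locAct S d.unop m)
    generalize c.unop = x
    generalize d.unop = y
    induction x using LocalizedModule.induction_on with | _ a s => _
    induction y using LocalizedModule.induction_on with | _ b t => _
    induction m using LocalizedModule.induction_on with | _ v r => _
    rw [LocalizedModule.mk_mul_mk, locAct_mk, locAct_mk, locAct_mk, MulOpposite.op_mul, mul_smul,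
      mul_left_comm, mul_assoc]
  smul_zero c := by
    have h := locAct_add S c.unop (0 : LocalizedModule S M) 0
    rw [add_zero] at h
    exact left_eq_add.mp h
  smul_add c m n := locAct_add S c.unop m n
  add_smul c d m := add_locAct S c.unop d.unop m
  zero_smul m := by
    have h := add_locAct S (0 : LocalizedModule S A) 0 m
    rw [add_zero] at h
    exact left_eq_add.mp h

lemma op_mk_smul_mk (a : A) (s : S) (v : M) (t : S) :
    MulOpposite.op (LocalizedModule.mk a s) • LocalizedModule.mk v t =
      LocalizedModule.mk (MulOpposite.op a • v) (s * t) := rfl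

end Localization

/-- The length of the right `R`-module `R / Q`. -/
noncomputable def quotLength {R : Type*} [Ring R] (Q : TwoSidedIdeal R) : ℕ∞ :=
  Module.length Rᵐᵒᵖ (Rᵐᵒᵖ ⧸ Q.asIdealOpposite)

/-- The greatest common divisor of the lengths of the right modules `R / Q`, where `Q` runs over
the maximal two-sided ideals of `R`. (Meant for rings where these lengths are finite.) -/
noncomputable def lengthGcd (R : Type*) [Ring R] : ℕ :=
  sSup {d : ℕ | ∀ Q : TwoSidedIdeal R, IsCoatom Q → d ∣ (quotLength Q).toNat}

end HopfMod

namespace HopfMod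

open MulOpposite (op unop)

/-! ### Integrality of uniform degree -/

section CayleyHamilton

/-! For a prime q of Z let D be the quotient of the opposite of A_q by its Jacobson radical, and for
a finitely generated Hopf module N let W be the quotient of N_q by N_q Jac(A_q). Since Z is Jacobson
and exactly one maximal ideal of A lies over each maximal ideal of Z, every D is simple artinian
(`isSimpleRing_residueRing`). Hence, by Nakayama, N_q is generated by a elements as soon as length W
≤ a · length D (`IsResidueMap.exists_locallyGenerated`). The ratio length W / length D is the rank
of N at q. Call q good if no nonzero H-stable ideal becomes nilpotent at q; the prime P ∩ Z is good
(`Spec.le_of_nilpotentAt`).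

The Hopf structure compares ranks at different good primes. Every element of H is a combination of
entries of a finite matrix (h i j) with Δ(h i j) = ∑ h i m ⊗ h m j (`exists_isComultiplicative`). At
a good q, A acts on X = D^n by the matrices of residues of h i j • a, and N pairs with X into W^n by
the residues of h i j • v. The antipode inverts the matrix, so the values of the pairing span W^n,
and I X = X for each nonzero stable ideal I. By Fitting's lemma X splits into pieces supported at
single primes of Z, which are good because I X = X. If N is generated by a elements at all good
primes, the pairing has image of length at most a · length X; in case of equality, relations between
a elements that generate N up to s ∈ Z are killed on X by s^d, with d independent of X
(`length_le_and_map_pow_mul_eq_zero`).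

Ranks are bounded and have a common denominator, so some good q₁ has maximal rank; a suitable power
of M has integral rank a there. Equality then holds at q₁ for all matrices h. For a relation with
coefficients x i between elements generating at P ∩ Z, the whole H-orbit of s^d x i therefore dies
in the residue ring at q₁, and goodness of q₁ forces s^d x i = 0 (`pow_mul_eq_zero_of_length_eq`,
`exists_locallyGenerated_of_finite`). Thus the l-th power of M has a free localization, where l is
the length of D at P ∩ Z. Locally finite modules follow by extending bases along a transfinite chain
of subobjects (`free_of_isLocallyFinite`). Finally, the localization of A at P ∩ Z has only one
maximal ideal, so l is the required gcd (`lengthGcd_eq`). -/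

lemma pow_mul_pow_of_mul_eq {R : Type*} [Ring R] {a b σ : R} (hba : b * a = σ)
    (hb : Commute σ b) (n : ℕ) : b ^ n * a ^ n = σ ^ n := by
  induction n with
  | zero => simp
  | succ n ih =>
    rw [pow_succ, pow_succ', mul_assoc, ← mul_assoc b a, hba, ← mul_assoc,
      ← (hb.pow_right n).eq, mul_assoc, ih, ← pow_succ']

/-- If `a` is integral of degree `n` with coefficients commuting with `b`, and `b a = σ` commutes
with `b`, then `σ ^ n` kills whatever `b` kills. -/
lemma pow_mul_eq_zero_of_integral {R : Type*} [Ring R] {a b x σ : R} (n : ℕ) (c : ℕ → R)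
    (hba : b * a = σ) (hb : Commute σ b) (hc : ∀ i, Commute (c i) b)
    (h : a ^ n + ∑ i ∈ Finset.range n, c i * a ^ i = 0) (hx : b * x = 0) : σ ^ n * x = 0 := by
  have key : ∀ i < n, b ^ n * (c i * a ^ i) * x = 0 := by
    intro i hi
    obtain ⟨j, rfl⟩ := Nat.exists_eq_add_of_lt hi
    have h1 : b ^ (i + j + 1) = b ^ j * b * b ^ i := by
      rw [← pow_succ, ← pow_add]; congr 1; omega
    -- As i < n, one factor `b` is left over: `b ^ i * a ^ i = σ ^ i` moves to the left, and the
    -- spare `b` meets `x`.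
    calc b ^ (i + j + 1) * (c i * a ^ i) * x
        = c i * (b ^ j * b * (b ^ i * a ^ i)) * x := by
          rw [← mul_assoc (b ^ _) (c i), ← ((hc i).pow_right _).eq, h1]; simp only [mul_assoc]
      _ = c i * b ^ j * σ ^ i * (b * x) := by
          rw [pow_mul_pow_of_mul_eq hba hb, mul_assoc (b ^ j), ← (hb.pow_left i).eq]
          simp only [mul_assoc]
      _ = 0 := by rw [hx, mul_zero]
  have h2 : b ^ n * (a ^ n + ∑ i ∈ Finset.range n, c i * a ^ i) * x = 0 := by
    rw [h, mul_zero, zero_mul]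
  rw [mul_add, Finset.mul_sum, add_mul, Finset.sum_mul,
    Finset.sum_eq_zero fun i hi => key i (Finset.mem_range.mp hi), add_zero,
    pow_mul_pow_of_mul_eq hba hb] at h2
  exact h2

/-- In a module-finite algebra all elements are integral of one and the same degree. -/
lemma exists_uniform_integral (Z R : Type*) [CommRing Z] [Ring R] [Algebra Z R]
    [Module.Finite Z R] : ∃ n : ℕ, ∀ x : R, ∃ c : ℕ → Z,
      x ^ n + ∑ i ∈ Finset.range n, algebraMap Z R (c i) * x ^ i = 0 := by
  -- Cayley–Hamilton for left multiplication by `x` on `R`, evaluated at 1; the degree is the number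
  -- of generators of `R`.
  refine ⟨(⊤ : Submodule Z R).spanFinrank, fun x => ?_⟩
  obtain ⟨p, hp, hn, h0⟩ :=
    LinearMap.exists_monic_and_natDegree_eq_and_aeval_eq_zero Z (Algebra.lmul Z R x)
  rw [Polynomial.aeval_algHom_apply] at h0
  have h1 : Polynomial.aeval x p = 0 := by
    simpa using LinearMap.congr_fun h0 1
  refine ⟨p.coeff, ?_⟩
  rw [Polynomial.aeval_eq_sum_range, Finset.sum_range_succ, hn] at h1
  have h3 : p.coeff (⊤ : Submodule Z R).spanFinrank = 1 := by rw [← hn]; exact hp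
  rw [h3, one_smul, add_comm] at h1
  simpa only [Algebra.smul_def] using h1

end CayleyHamilton

/-! ### Pairings with a bimodule supported at a single prime -/

section Local

/-- The localization of the right `A`-module `N` at the prime `q` of `Z` is generated by the
finite family `w`. -/
def LocallyGenerated (A : Type*) {Z N : Type*} [CommRing Z] [Ring A] [AddCommGroup N] [Module Z N]
    [Module Aᵐᵒᵖ N] (q : Ideal Z) {a : ℕ} (w : Fin a → N) : Prop :=
  ∀ v : N, ∃ t ∉ q, ∃ c : Fin a → A, t • v = ∑ i, op (c i) • w i

/-- The set `I` becomes nilpotent in the fibre of `A` at `q`. -/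
def NilpotentAt {Z A : Type*} [CommRing Z] [Ring A] [Algebra Z A] (I : Set A) (q : Ideal Z) :
    Prop :=
  ∃ k : ℕ, ∀ l : List A, l.length = k → (∀ a ∈ l, a ∈ I) →
    ∃ t ∉ q, t • l.prod ∈ q • (⊤ : Submodule Z A)

lemma exists_common_denominator {Z ι : Type*} [CommRing Z] [Finite ι] {q : Ideal Z} [q.IsPrime]
    (p : ι → Z → Prop) (hp : ∀ i t u, p i t → p i (u * t)) (h : ∀ i, ∃ t ∉ q, p i t) :
    ∃ t ∉ q, ∀ i, p i t := by
  classical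
  have := Fintype.ofFinite ι
  choose t ht hpt using h
  refine ⟨∏ i, t i, ?_, fun i => ?_⟩
  · exact (q.primeCompl.prod_mem fun i _ => ht i : ∏ i, t i ∈ q.primeCompl)
  · rw [← Finset.prod_erase_mul _ _ (Finset.mem_univ i)]
    exact hp i _ _ (hpt i)

variable {Z A D N X Y : Type*} [CommRing Z] [Ring A] [Algebra Z A] [Ring D]
  [AddCommGroup N] [Module Z N] [Module Aᵐᵒᵖ N] [IsScalarTower Z Aᵐᵒᵖ N]
  [AddCommGroup X] [Module D X] [AddCommGroup Y] [Module D Y]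
  {T : A →+* Module.End D X} {β : N →+ (X →ₗ[D] Y)}

lemma map_zsmul_apply (hβ : ∀ v a, β (op a • v) = β v ∘ₗ T a) (z : Z) (v : N) :
    β (z • v) = β v ∘ₗ T (algebraMap Z A z) := by
  rw [← hβ, ← algebraMap_smul Aᵐᵒᵖ z v]; rfl

lemma op_sum {ι A : Type*} [Ring A] (s : Finset ι) (f : ι → A) :
    op (∑ i ∈ s, f i) = ∑ i ∈ s, op (f i) :=
  map_sum (MulOpposite.opAddEquiv (α := A)) f s

/-- Some `t` outside `q` makes `t • v` a combination of the `w i`, and since `t` acts bijectively on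
`X` it can be absorbed into the argument from `X`. -/
lemma iSup_range_eq_of_locallyGenerated (hβ : ∀ v a, β (op a • v) = β v ∘ₗ T a) {q : Ideal Z}
    (hq : ∀ t ∉ q, Function.Bijective (T (algebraMap Z A t))) {a : ℕ} {w : Fin a → N}
    (hw : LocallyGenerated A q w) :
    ⨆ v, LinearMap.range (β v) = LinearMap.range (∑ i, β (w i) ∘ₗ LinearMap.proj i) := by
  classical
  apply le_antisymm
  · refine iSup_le fun v => ?_
    rintro _ ⟨x, rfl⟩
    obtain ⟨t, ht, c, hc⟩ := hw v
    obtain ⟨y, rfl⟩ := (hq t ht).2 x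
    refine ⟨fun i => T (c i) y, ?_⟩
    have h1 := LinearMap.congr_fun (congrArg β hc) y
    rw [map_zsmul_apply hβ, map_sum] at h1
    simp only [LinearMap.comp_apply, hβ, LinearMap.sum_apply, LinearMap.proj_apply] at h1 ⊢
    exact h1.symm
  · rintro _ ⟨x, rfl⟩
    simp only [LinearMap.sum_apply, LinearMap.comp_apply, LinearMap.proj_apply]
    exact Submodule.sum_mem _ fun i _ =>
      Submodule.mem_iSup_of_mem (w i) (LinearMap.mem_range_self _ _)

lemma length_iSup_range_le (hβ : ∀ v a, β (op a • v) = β v ∘ₗ T a) {q : Ideal Z}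
    (hq : ∀ t ∉ q, Function.Bijective (T (algebraMap Z A t))) {a : ℕ} {w : Fin a → N}
    (hw : LocallyGenerated A q w) :
    Module.length D ↥(⨆ v, LinearMap.range (β v)) ≤ a * Module.length D X := by
  rw [iSup_range_eq_of_locallyGenerated hβ hq hw]
  refine (Module.length_le_of_surjective _ (LinearMap.surjective_rangeRestrict _)).trans ?_
  rw [Module.length_pi]
  simp

/-- The map is surjective onto a module of the same finite length as its source, so its kernel has
length 0. -/
lemma injective_of_length_eq (hβ : ∀ v a, β (op a • v) = β v ∘ₗ T a) {q : Ideal Z}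
    (hq : ∀ t ∉ q, Function.Bijective (T (algebraMap Z A t))) {a : ℕ} {w : Fin a → N}
    (hw : LocallyGenerated A q w) [IsArtinian D X] [IsNoetherian D X]
    (hl : Module.length D ↥(⨆ v, LinearMap.range (β v)) = a * Module.length D X) :
    Function.Injective (∑ i, β (w i) ∘ₗ LinearMap.proj i : (Fin a → X) →ₗ[D] Y) := by
  rw [iSup_range_eq_of_locallyGenerated hβ hq hw] at hl
  set f : (Fin a → X) →ₗ[D] Y := ∑ i, β (w i) ∘ₗ LinearMap.proj i
  have h1 := Module.length_eq_add_of_exact (LinearMap.ker f).subtype f.rangeRestrict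
    (Submodule.injective_subtype _) f.surjective_rangeRestrict
    (by rw [LinearMap.exact_iff, LinearMap.ker_rangeRestrict, Submodule.range_subtype])
  have h2 : Module.length D (Fin a → X) = a * Module.length D X := by simp
  have h3 : Module.length D (Fin a → X) ≠ ⊤ := Module.length_ne_top
  rw [hl, ← h2] at h1
  have h4 : Module.length D (LinearMap.ker f) = 0 := by
    by_contra h0
    exact (ENat.add_one_le_iff h3).mp ((add_comm _ _).trans_le
      ((add_le_add_left (Order.one_le_iff_ne_zero.mpr h0) _).trans h1.ge)) |>.ne rfl
  rw [Module.length_eq_zero_iff, Submodule.subsingleton_iff_eq_bot] at h4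
  exact LinearMap.ker_eq_bot.mp h4

/-- On a bimodule supported at a single prime, the relations between elements which generate `N`
up to `s` are killed by a power of `s` of bounded exponent. -/
lemma map_pow_mul_eq_zero_of_bijective (hβ : ∀ v a, β (op a • v) = β v ∘ₗ T a) {q : Ideal Z}
    [q.IsPrime] (hq : ∀ t ∉ q, Function.Bijective (T (algebraMap Z A t))) {a : ℕ} {w : Fin a → N}
    (hw : LocallyGenerated A q w) [IsArtinian D X] [IsNoetherian D X]
    (hl : Module.length D ↥(⨆ v, LinearMap.range (β v)) = a * Module.length D X)
    {n : ℕ} (hn : ∀ m : Matrix (Fin a) (Fin a) A, ∃ c : ℕ → Z,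
      m ^ n + ∑ i ∈ Finset.range n, algebraMap Z _ (c i) * m ^ i = 0)
    {v : Fin a → N} {s : Z} (hs : ∀ y : N, ∃ c : Fin a → A, s • y = ∑ i, op (c i) • v i)
    {x : Fin a → A} (hx : ∑ i, op (x i) • v i = 0) (i : Fin a) :
    T (algebraMap Z A (s ^ n) * x i) = 0 := by
  classical
  have hinj := injective_of_length_eq hβ hq hw hl
  have hinj' : ∀ c : Fin a → A, (∀ y, β (∑ i, op (c i) • w i) y = 0) → ∀ i, T (c i) = 0 := by
    intro c hc i
    ext y
    have h1 : (fun i => T (c i) y) = 0 := by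
      apply hinj
      rw [map_zero, ← hc y, map_sum]
      simp [LinearMap.sum_apply, hβ]
    exact congrFun h1 i
  obtain ⟨t, ht, htv⟩ := exists_common_denominator (q := q)
    (fun i t => ∃ c : Fin a → A, t • v i = ∑ j, op (c j) • w j) (by
      rintro i t u ⟨c, hc⟩
      refine ⟨fun j => algebraMap Z A u * c j, ?_⟩
      rw [mul_smul, hc, Finset.smul_sum]
      refine Finset.sum_congr rfl fun j _ => ?_
      simp only [← Algebra.smul_def, MulOpposite.op_smul, smul_assoc]) fun i => hw (v i)
  choose b hb using htv
  choose e he using fun j => hs (w j)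
  -- `B` expresses `t • v` through `w`, and `E` expresses `s • w` through `v`. By injectivity of the
  -- pairing on `w`, the identities `B E = t s` and `B x = 0` hold after passing to `X`.
  let B : Matrix (Fin a) (Fin a) A := Matrix.of fun j i => b i j
  let E : Matrix (Fin a) (Fin a) A := Matrix.of fun i j => e j i
  let x' : Matrix (Fin a) (Fin a) A := Matrix.of fun i _ => x i
  let F : Matrix (Fin a) (Fin a) A →+* Matrix (Fin a) (Fin a) (Module.End D X) := T.mapMatrix
  have hcomb : ∀ c : Fin a → A, t • ∑ i, op (c i) • v i =
      ∑ j, op (∑ i, b i j * c i) • w j := by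
    intro c
    rw [Finset.smul_sum]
    simp_rw [op_sum, Finset.sum_smul, MulOpposite.op_mul, mul_smul]
    rw [Finset.sum_comm]
    refine Finset.sum_congr rfl fun i _ => ?_
    rw [← Finset.smul_sum, ← hb, op_smul_zsmul]
  have hBx : F B * F x' = 0 := by
    rw [← map_mul]
    ext1 j i
    refine hinj' (fun j => ∑ i, b i j * x i) (fun y => ?_) j
    rw [← hcomb, hx, smul_zero, map_zero, LinearMap.zero_apply]
  have hBE : F B * F E = F (algebraMap Z _ (t * s)) := by
    rw [← map_mul, ← sub_eq_zero, ← map_sub]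
    ext1 k j
    have h1 : ∑ k, op ((B * E) k j - algebraMap Z (Matrix _ _ A) (t * s) k j) • w k = 0 := by
      have h2 : ∑ k, op (algebraMap Z (Matrix (Fin a) (Fin a) A) (t * s) k j) • w k
          = (t * s) • w j := by
        rw [Finset.sum_eq_single j]
        · rw [Matrix.algebraMap_matrix_apply, if_pos rfl, ← algebraMap_smul Aᵐᵒᵖ (t * s)]; rfl
        · intro k _ hk
          rw [Matrix.algebraMap_matrix_apply, if_neg hk, MulOpposite.op_zero, zero_smul]
        · simp
      simp_rw [MulOpposite.op_sub, sub_smul, Finset.sum_sub_distrib]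
      rw [h2, mul_smul, he j, hcomb, sub_eq_zero]
      rfl
    refine hinj' (fun k => (B * E - algebraMap Z _ (t * s)) k j) (fun y => ?_) k
    simp only [Matrix.sub_apply]
    rw [h1, map_zero, LinearMap.zero_apply]
  -- Integrality of `E` turns `B x = 0` into `(t s) ^ n x = 0` on `X`; then `t`, which acts
  -- injectively, is cancelled.
  obtain ⟨c, hc⟩ := hn E
  have hcomm : ∀ (z : Z) (m : Matrix (Fin a) (Fin a) A),
      Commute (F (algebraMap Z _ z)) (F m) := fun z m => by
    rw [commute_iff_eq, ← map_mul, Algebra.commutes, map_mul]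
  have hfin := pow_mul_eq_zero_of_integral n (fun i => F (algebraMap Z _ (c i))) hBE
    (hcomm _ _) (fun i => hcomm _ _)
    (by simpa only [map_add, map_sum, map_mul, map_pow, map_zero] using congrArg F hc) hBx
  rw [← map_pow, ← map_mul, ← map_pow] at hfin
  have h5 : T (algebraMap Z A ((t * s) ^ n) * x i) = 0 := by
    have := congrFun (congrFun hfin i) i
    simpa [F, Matrix.algebraMap_eq_diagonal, x'] using this
  rw [mul_pow, map_mul (algebraMap Z A), map_mul T, map_mul T, mul_assoc, ← map_mul T,
    map_pow (algebraMap Z A) t, map_pow T] at h5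
  have h6 : Function.Injective ⇑(T (algebraMap Z A t) ^ n) := by
    rw [Module.End.coe_pow]
    exact (hq t ht).1.iterate n
  ext y
  apply h6
  rw [LinearMap.zero_apply, map_zero]
  exact LinearMap.congr_fun h5 y

end Local

/-! ### Supports of bimodules over Z -/

section Support

variable {Z A D X : Type*} [CommRing Z] [Ring A] [Algebra Z A] [Ring D]
  [AddCommGroup X] [Module D X] {T : A →+* Module.End D X}

/-- Iterating `I X = X` gives `I ^ k X = X`, which will contradict nilpotency of `I` at the
supporting prime. -/
lemma iSup_range_list_prod {I : Set A} (hI : ⨆ i ∈ I, LinearMap.range (T i) = ⊤) (k : ℕ) :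
    ⨆ l ∈ {l : List A | l.length = k ∧ ∀ a ∈ l, a ∈ I}, LinearMap.range (T l.prod) = ⊤ := by
  induction k with
  | zero =>
    refine eq_top_iff.mpr ?_
    refine le_iSup₂_of_le [] (by simp) ?_
    rw [List.prod_nil, map_one, Module.End.one_eq_id, LinearMap.range_id]
  | succ k ih =>
    rw [eq_top_iff, ← hI]
    refine iSup₂_le fun i hi => ?_
    rw [LinearMap.range_eq_map, ← ih, Submodule.map_iSup]
    refine iSup_le fun l => ?_
    rw [Submodule.map_iSup]
    refine iSup_le fun hl => ?_
    refine le_iSup₂_of_le (i :: l) ⟨by simp [hl.1], ?_⟩ ?_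
    · simpa [hi] using hl.2
    · rw [List.prod_cons, map_mul, Module.End.mul_eq_comp, LinearMap.range_comp]

/-- `q` is not assumed finitely generated, so single elements are tested against a maximal proper
`Z`-stable submodule `V`. If `z ∈ q` did not map `X` into `V`, then `V + z X = X`, hence `V + z ^ k
X = X` for all k, contrary to nilpotency of `z`. So `q X ⊆ V`. -/
lemma iSup_range_lt_top_of_isNilpotent [IsNoetherian D X] [Nontrivial X] {q : Ideal Z}
    (hq : ∀ z ∈ q, IsNilpotent (T (algebraMap Z A z))) :
    ⨆ z ∈ q, LinearMap.range (T (algebraMap Z A z)) ≠ ⊤ := by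
  obtain ⟨V, ⟨hV, hVs⟩, hmax⟩ := WellFounded.has_min
    (r := fun V W : Submodule D X => V > W) IsWellFounded.wf
    {V : Submodule D X | V ≠ ⊤ ∧ ∀ z : Z, ∀ x ∈ V, T (algebraMap Z A z) x ∈ V}
    ⟨⊥, bot_ne_top, by simp⟩
  refine fun h => hV (top_le_iff.mp (h ▸ iSup₂_le fun z hz => ?_))
  by_contra hle
  set f := T (algebraMap Z A z) with hf
  have hlt : V < V ⊔ LinearMap.range f := left_lt_sup.mpr hle
  have htop : V ⊔ LinearMap.range f = ⊤ := by
    by_contra hne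
    refine hmax _ ⟨hne, fun y x hx => ?_⟩ hlt
    obtain ⟨u, hu, _, ⟨w, rfl⟩, rfl⟩ := Submodule.mem_sup.mp hx
    rw [map_add]
    refine Submodule.add_mem_sup (hVs y u hu) ⟨T (algebraMap Z A y) w, ?_⟩
    rw [hf, ← Module.End.mul_apply, ← Module.End.mul_apply, ← map_mul, ← map_mul T,
      Algebra.commutes]
  have hpow : ∀ k : ℕ, V ⊔ LinearMap.range (f ^ k) = ⊤ := by
    intro k
    induction k with
    | zero => rw [pow_zero, Module.End.one_eq_id, LinearMap.range_id, sup_top_eq]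
    | succ k ih =>
      rw [eq_top_iff, ← htop]
      refine sup_le le_sup_left ?_
      rw [LinearMap.range_eq_map, ← ih, Submodule.map_sup, pow_succ', Module.End.mul_eq_comp,
        LinearMap.range_comp]
      refine sup_le_sup_right ?_ _
      rintro _ ⟨x, hx, rfl⟩
      exact hVs z x hx
  obtain ⟨k, hk⟩ := hq z hz
  have := hpow k
  rw [hk, LinearMap.range_zero, sup_bot_eq] at this
  exact hV this

/-- Nilpotency would put `I ^ k X = X` inside `q X ≠ X`, the denominators `t` being invertible on
`X`. -/
lemma not_nilpotentAt_of_iSup_range_eq_top [IsNoetherian D X] [Nontrivial X] {q : Ideal Z}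
    (hq : ∀ z ∈ q, IsNilpotent (T (algebraMap Z A z)))
    (hq' : ∀ t ∉ q, Function.Bijective (T (algebraMap Z A t)))
    {I : Set A} (hI : ⨆ i ∈ I, LinearMap.range (T i) = ⊤) : ¬ NilpotentAt I q := by
  rintro ⟨k, hk⟩
  refine iSup_range_lt_top_of_isNilpotent hq (eq_top_iff.mpr ?_)
  rw [← iSup_range_list_prod hI k]
  refine iSup₂_le fun l hl => ?_
  obtain ⟨t, ht, hmem⟩ := hk l hl.1 hl.2
  rintro _ ⟨x, rfl⟩
  obtain ⟨y, rfl⟩ := (hq' t ht).2 x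
  have h1 : T l.prod (T (algebraMap Z A t) y) = T (t • l.prod) y := by
    rw [Algebra.smul_def, Algebra.commutes, map_mul, Module.End.mul_apply]
  rw [h1]
  refine Submodule.smul_induction_on (p := fun a => T a y ∈ _) hmem (fun z hz a _ => ?_)
    fun a b ha hb => ?_
  · rw [Algebra.smul_def, map_mul]
    exact Submodule.mem_iSup_of_mem z (Submodule.mem_iSup_of_mem hz ⟨T a y, rfl⟩)
  · rw [map_add, LinearMap.add_apply]
    exact Submodule.add_mem _ ha hb

/-- If every element of `Z` acts on `X` either nilpotently or bijectively, then `X` is supported at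
a single prime. -/
lemma exists_prime_of_nilpotent_or_bijective [Nontrivial X]
    (h : ∀ z : Z, IsNilpotent (T (algebraMap Z A z)) ∨
      Function.Bijective (T (algebraMap Z A z))) :
    ∃ q : Ideal Z, q.IsPrime ∧ (∀ z ∈ q, IsNilpotent (T (algebraMap Z A z))) ∧
      ∀ t ∉ q, Function.Bijective (T (algebraMap Z A t)) := by
  have hcomm : ∀ y z : Z, Commute (T (algebraMap Z A y)) (T (algebraMap Z A z)) := by
    intro y z
    rw [commute_iff_eq, ← map_mul, Algebra.commutes, map_mul]
  have hnb : ∀ f : Module.End D X, Function.Bijective f → ¬ IsNilpotent f := by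
    rintro f hf ⟨k, hk⟩
    have h1 : Function.Injective ⇑(f ^ k) := by
      rw [Module.End.coe_pow]; exact hf.1.iterate k
    obtain ⟨x, hx⟩ := exists_ne (0 : X)
    exact hx (h1 (by rw [hk]; simp))
  let q : Ideal Z :=
    { carrier := {z | IsNilpotent (T (algebraMap Z A z))}
      add_mem' := fun {y z} hy hz => by
        simp only [Set.mem_ofPred_eq, map_add] at *
        exact (hcomm y z).isNilpotent_add hy hz
      zero_mem' := by simp
      smul_mem' := fun y z hz => by
        simp only [Set.mem_ofPred_eq, smul_eq_mul, map_mul] at *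
        exact (hcomm y z).isNilpotent_mul_left hz }
  refine ⟨q, ⟨fun htop => ?_, fun {y z} hyz => ?_⟩, fun z hz => hz,
    fun t ht => (h t).resolve_left ht⟩
  · have h1 : (1 : Z) ∈ q := htop ▸ Submodule.mem_top
    refine hnb 1 Function.bijective_id ?_
    simpa [q] using h1
  · by_contra! hc
    refine hnb _ ?_ hyz
    rw [map_mul, map_mul, Module.End.mul_eq_comp, LinearMap.coe_comp]
    exact ((h y).resolve_left hc.1).comp ((h z).resolve_left hc.2)

end Support

/-! ### Fitting decomposition and the length inequality -/

section Splitting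

lemma length_sup_le {D Y : Type*} [Ring D] [AddCommGroup Y] [Module D Y] (P Q : Submodule D Y) :
    Module.length D ↥(P ⊔ Q) ≤ Module.length D P + Module.length D Q := by
  rw [← Module.length_prod]
  have h : P ⊔ Q = LinearMap.range (P.subtype.coprod Q.subtype) := by
    rw [LinearMap.range_coprod, Submodule.range_subtype, Submodule.range_subtype]
  rw [h]
  exact Module.length_le_of_surjective _ (LinearMap.surjective_rangeRestrict _)

variable {A D X : Type*} [Ring A] [Ring D] [AddCommGroup X] [Module D X]

/-- The restriction of an action of `A` on `X` to a stable submodule. -/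
def restrictAction (T : A →+* Module.End D X) (V : Submodule D X)
    (hV : ∀ a, ∀ x ∈ V, T a x ∈ V) : A →+* Module.End D V where
  toFun a := (T a).restrict (hV a)
  map_one' := by ext; simp [LinearMap.restrict_apply]
  map_mul' a b := by ext; simp [LinearMap.restrict_apply]
  map_zero' := by ext; simp [LinearMap.restrict_apply]
  map_add' a b := by ext; simp [LinearMap.restrict_apply]

@[simp] lemma restrictAction_coe (T : A →+* Module.End D X) (V : Submodule D X)
    (hV : ∀ a, ∀ x ∈ V, T a x ∈ V) (a : A) (x : V) : (restrictAction T V hV a x : X) = T a x :=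
  rfl

/-- The projection onto `V` along the stable complement `W` commutes with the action, so it carries
ranges on `X` into ranges on `V`. -/
lemma iSup_range_restrictAction {T : A →+* Module.End D X} {V W : Submodule D X}
    (hV : ∀ a, ∀ x ∈ V, T a x ∈ V) (hW : ∀ a, ∀ x ∈ W, T a x ∈ W) (h : IsCompl V W)
    {I : Set A} (hI : ⨆ i ∈ I, LinearMap.range (T i) = ⊤) :
    ⨆ i ∈ I, LinearMap.range (restrictAction T V hV i) = ⊤ := by
  have h1 := congrArg (Submodule.map (V.projectionOnto W h)) hI
  rw [Submodule.map_top, Submodule.range_projectionOnto, Submodule.map_iSup] at h1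
  rw [eq_top_iff, ← h1]
  refine iSup_mono fun i => ?_
  rw [Submodule.map_iSup]
  refine iSup_mono fun hi => ?_
  rintro _ ⟨_, ⟨x, rfl⟩, rfl⟩
  refine ⟨V.projectionOnto W h x, ?_⟩
  obtain ⟨⟨v, w⟩, rfl⟩ := (Submodule.prodEquivOfIsCompl V W h).surjective x
  simp only [Submodule.coe_prodEquivOfIsCompl', map_add,
    Submodule.projectionOnto_apply_left, Submodule.projectionOnto_apply_right, map_zero]
  have h2 : T i v = (⟨T i v, hV i v v.2⟩ : V) := rfl
  have h3 : T i w = (⟨T i w, hW i w w.2⟩ : W) := rfl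
  rw [h2, h3, Submodule.projectionOnto_apply_left, Submodule.projectionOnto_apply_right]
  simp [restrictAction, LinearMap.restrict_apply]

end Splitting

lemma enat_eq_and_eq_of_add_le {x y x' y' : ℕ∞} (hx : x ≤ x') (hy : y ≤ y') (hx' : x' ≠ ⊤)
    (hy' : y' ≠ ⊤) (h : x' + y' ≤ x + y) : x = x' ∧ y = y' := by
  lift x' to ℕ using hx'
  lift y' to ℕ using hy'
  lift x to ℕ using ne_top_of_le_ne_top (ENat.natCast_ne_top _) hx
  lift y to ℕ using ne_top_of_le_ne_top (ENat.natCast_ne_top _) hy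
  norm_cast at *
  omega

/-- Let `X` be an `A`-`D`-bimodule of finite length such that `I X = X` for all `I ∈ 𝓘`, and
suppose that `N` is generated by `a` elements at all primes `q` such that no `I ∈ 𝓘` is nilpotent
at `q`. Then any pairing of `N` with `X` has image of length at most `a * length X`; if equality
holds, the relations between `a` elements generating `N` up to `s ∈ Z` are killed on `X` by a power
of `s` whose exponent does not depend on `X`. -/
theorem length_le_and_map_pow_mul_eq_zero {Z A D N Y : Type*} [CommRing Z] [Ring A] [Algebra Z A]
    [Ring D] [AddCommGroup N] [Module Z N] [Module Aᵐᵒᵖ N] [IsScalarTower Z Aᵐᵒᵖ N]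
    [AddCommGroup Y] [Module D Y] {a n : ℕ}
    (hn : ∀ m : Matrix (Fin a) (Fin a) A, ∃ c : ℕ → Z,
      m ^ n + ∑ i ∈ Finset.range n, algebraMap Z _ (c i) * m ^ i = 0)
    {v : Fin a → N} {s : Z} (hs : ∀ y : N, ∃ c : Fin a → A, s • y = ∑ i, op (c i) • v i)
    {x : Fin a → A} (hx : ∑ i, op (x i) • v i = 0)
    {𝓘 : Set (Set A)} (hgen : ∀ q : Ideal Z, q.IsPrime → (∀ I ∈ 𝓘, ¬ NilpotentAt I q) →
      ∃ w : Fin a → N, LocallyGenerated A q w)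
    (X : Type*) [AddCommGroup X] [Module D X] [IsArtinian D X] [IsNoetherian D X]
    (T : A →+* Module.End D X) (β : N →+ (X →ₗ[D] Y))
    (hβ : ∀ v a, β (op a • v) = β v ∘ₗ T a)
    (h𝓘 : ∀ I ∈ 𝓘, ⨆ i ∈ I, LinearMap.range (T i) = ⊤) :
    Module.length D ↥(⨆ v, LinearMap.range (β v)) ≤ a * Module.length D X ∧
      (Module.length D ↥(⨆ v, LinearMap.range (β v)) = a * Module.length D X →
        ∀ i, T (algebraMap Z A (s ^ n) * x i) = 0) := by
  obtain ⟨m, hm⟩ : ∃ m : ℕ, Module.length D X = m :=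
    (ENat.ne_top_iff_exists.mp Module.length_ne_top).imp fun _ h => h.symm
  induction m using Nat.strong_induction_on generalizing X with
  | _ m ih =>
  rcases subsingleton_or_nontrivial X with hX | hX
  · refine ⟨?_, fun _ i => by ext y; exact Subsingleton.elim _ _⟩
    have h0 : ⨆ v, LinearMap.range (β v) = ⊥ := by
      refine iSup_eq_bot.mpr fun v => LinearMap.range_eq_bot.mpr ?_
      ext y
      rw [Subsingleton.elim y 0, map_zero, map_zero]
    rw [h0, Module.length_bot]
    exact zero_le
  -- In the first case `X` is supported at one prime. Otherwise some `z` splits `X` by Fitting's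
  -- lemma into two proper stable summands, and induction on the length applies.
  by_cases hz : ∀ z : Z, IsNilpotent (T (algebraMap Z A z)) ∨
      Function.Bijective (T (algebraMap Z A z))
  · obtain ⟨q, hq, hnil, hbij⟩ := exists_prime_of_nilpotent_or_bijective hz
    obtain ⟨w, hw⟩ := hgen q hq fun I hI => not_nilpotentAt_of_iSup_range_eq_top hnil hbij (h𝓘 I hI)
    exact ⟨length_iSup_range_le hβ hbij hw,
      fun hl => map_pow_mul_eq_zero_of_bijective hβ hbij hw hl hn hs hx⟩
  push Not at hz
  obtain ⟨z, hz1, hz2⟩ := hz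
  set f := T (algebraMap Z A z) with hf
  -- `r > 0` is needed to deduce bijectivity of `f` from that of `f ^ r`.
  obtain ⟨r, hr, hr0⟩ := ((LinearMap.eventually_isCompl_ker_pow_range_pow f).and
    (Filter.eventually_gt_atTop 0)).exists
  have hcomm : ∀ (b : A) (y : X), T b ((f ^ r) y) = (f ^ r) (T b y) := by
    intro b y
    rw [hf, ← map_pow, ← map_pow, ← Module.End.mul_apply, ← Module.End.mul_apply, ← map_mul,
      ← map_mul T, Algebra.commutes]
  set V := LinearMap.ker (f ^ r) with hVdef
  set W := LinearMap.range (f ^ r) with hWdef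
  have hV : ∀ b, ∀ y ∈ V, T b y ∈ V := by
    intro b y hy
    rw [hVdef, LinearMap.mem_ker] at hy ⊢
    rw [← hcomm, hy, map_zero]
  have hW : ∀ b, ∀ y ∈ W, T b y ∈ W := by
    rintro b _ ⟨y, rfl⟩
    exact ⟨T b y, (hcomm b y).symm⟩
  have hVtop : V ≠ ⊤ := fun h => hz1 ⟨r, LinearMap.ker_eq_top.mp h⟩
  have hWtop : W ≠ ⊤ := by
    intro h
    refine hz2 ?_
    have hV0 : V = ⊥ := by
      have := hr.inf_eq_bot
      rwa [h, inf_top_eq] at this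
    have hbij : Function.Bijective ⇑(f ^ r) :=
      ⟨LinearMap.ker_eq_bot.mp hV0, LinearMap.range_eq_top.mp h⟩
    obtain ⟨r, rfl⟩ := Nat.exists_eq_succ_of_ne_zero hr0.ne'
    rw [Module.End.coe_pow] at hbij
    refine ⟨Function.Injective.of_comp (f := f^[r]) ?_,
      Function.Surjective.of_comp (g := f^[r]) ?_⟩
    · rw [← Function.iterate_succ]; exact hbij.1
    · rw [← Function.iterate_succ']; exact hbij.2
  have hlen : Module.length D X = Module.length D V + Module.length D W := by
    rw [← Module.length_prod]
    exact (Submodule.prodEquivOfIsCompl V W hr).length_eq.symm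
  obtain ⟨mV, hmV⟩ : ∃ m : ℕ, Module.length D V = m :=
    (ENat.ne_top_iff_exists.mp Module.length_ne_top).imp fun _ h => h.symm
  obtain ⟨mW, hmW⟩ : ∃ m : ℕ, Module.length D W = m :=
    (ENat.ne_top_iff_exists.mp Module.length_ne_top).imp fun _ h => h.symm
  have hmV' : mV < m := by
    have := Submodule.length_lt hVtop
    rw [hmV, hm] at this
    exact_mod_cast this
  have hmW' : mW < m := by
    have := Submodule.length_lt hWtop
    rw [hmW, hm] at this
    exact_mod_cast this
  let βV : N →+ (V →ₗ[D] Y) :=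
    { toFun := fun u => β u ∘ₗ V.subtype
      map_zero' := by rw [map_zero, LinearMap.zero_comp]
      map_add' := fun _ _ => by rw [map_add, LinearMap.add_comp] }
  let βW : N →+ (W →ₗ[D] Y) :=
    { toFun := fun u => β u ∘ₗ W.subtype
      map_zero' := by rw [map_zero, LinearMap.zero_comp]
      map_add' := fun _ _ => by rw [map_add, LinearMap.add_comp] }
  obtain ⟨hV1, hV2⟩ := ih mV hmV' V (restrictAction T V hV) βV
    (fun u b => by ext y; exact LinearMap.congr_fun (hβ u b) y)
    (fun I hI => iSup_range_restrictAction hV hW hr (h𝓘 I hI)) hmV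
  obtain ⟨hW1, hW2⟩ := ih mW hmW' W (restrictAction T W hW) βW
    (fun u b => by ext y; exact LinearMap.congr_fun (hβ u b) y)
    (fun I hI => iSup_range_restrictAction hW hV hr.symm (h𝓘 I hI)) hmW
  have hsup : ⨆ u, LinearMap.range (β u) ≤
      (⨆ u, LinearMap.range (βV u)) ⊔ ⨆ u, LinearMap.range (βW u) := by
    refine iSup_le fun u => ?_
    rintro _ ⟨y, rfl⟩
    obtain ⟨⟨y1, y2⟩, rfl⟩ := (Submodule.prodEquivOfIsCompl V W hr).surjective y
    rw [Submodule.coe_prodEquivOfIsCompl', map_add]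
    exact Submodule.add_mem_sup (Submodule.mem_iSup_of_mem u ⟨y1, rfl⟩)
      (Submodule.mem_iSup_of_mem u ⟨y2, rfl⟩)
  have hle : Module.length D ↥(⨆ u, LinearMap.range (β u)) ≤
      Module.length D ↥(⨆ u, LinearMap.range (βV u)) +
        Module.length D ↥(⨆ u, LinearMap.range (βW u)) :=
    (Module.length_le_of_injective _ (Submodule.inclusion_injective hsup)).trans (length_sup_le _ _)
  refine ⟨hle.trans ((add_le_add hV1 hW1).trans (by rw [hlen, mul_add])), fun heq i => ?_⟩
  rw [heq, hlen, mul_add] at hle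
  have hfin : ∀ U : Submodule D X, (a : ℕ∞) * Module.length D U ≠ ⊤ := fun U =>
    WithTop.mul_ne_top (ENat.natCast_ne_top a) Module.length_ne_top
  -- The inequalities on the two summands add up to an equality of finite quantities, so both are
  -- equalities.
  obtain ⟨e1, e2⟩ := enat_eq_and_eq_of_add_le hV1 hW1 (hfin V) (hfin W) hle
  ext y
  obtain ⟨⟨y1, y2⟩, rfl⟩ := (Submodule.prodEquivOfIsCompl V W hr).surjective y
  rw [Submodule.coe_prodEquivOfIsCompl', map_add, LinearMap.zero_apply]
  have g1 := congrArg Subtype.val (LinearMap.congr_fun (hV2 e1 i) y1)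
  have g2 := congrArg Subtype.val (LinearMap.congr_fun (hW2 e2 i) y2)
  rw [restrictAction_coe] at g1 g2
  rw [g1, g2]
  simp

/-! ### Comultiplicative matrices -/

section Comultiplicative

open Coalgebra

variable {k H : Type*} [Field k]

section

variable [AddCommGroup H] [Module k H] [Coalgebra k H]

/-- A square matrix with entries in a coalgebra is comultiplicative if
`Δ(h i j) = ∑ m, h i m ⊗ h m j` and `ε(h i j) = δ i j`. -/
structure IsComultiplicative (k : Type*) {H : Type*} [Field k] [AddCommGroup H] [Module k H]
    [Coalgebra k H] {n : ℕ} (h : Fin n → Fin n → H) : Prop where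
  comul_apply : ∀ i j, comul (R := k) (h i j) = ∑ m, h i m ⊗ₜ[k] h m j
  counit_apply : ∀ i j, counit (R := k) (h i j) = if i = j then 1 else 0

/-- The endomorphism `h ↦ ∑ φ(h₁) h₂` of a coalgebra. -/
noncomputable def leftContract (φ : Module.Dual k H) : H →ₗ[k] H :=
  TensorProduct.lid k H ∘ₗ φ.rTensor H ∘ₗ comul

/-- The endomorphism `h ↦ ∑ ψ(h₂) h₁` of a coalgebra. -/
noncomputable def rightContract (ψ : Module.Dual k H) : H →ₗ[k] H :=
  TensorProduct.rid k H ∘ₗ ψ.lTensor H ∘ₗ comul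

/-- By coassociativity, contractions compose to contraction by a convolution product; so the set of
all contractions of `x` is closed under contraction. -/
lemma leftContract_leftContract (φ ψ : Module.Dual k H) (x : H) :
    leftContract ψ (leftContract φ x) =
      leftContract ((TensorProduct.lid k k : k ⊗[k] k →ₗ[k] k) ∘ₗ TensorProduct.map φ ψ ∘ₗ comul) x := by
  have h1 : ∀ y : H ⊗[k] H, comul (R := k) (TensorProduct.lid k H (φ.rTensor H y)) =
      TensorProduct.lid k (H ⊗[k] H) (φ.rTensor (H ⊗[k] H) (comul.lTensor H y)) := by
    intro y
    induction y with
    | zero => simp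
    | add x y hx hy => simp only [map_add, hx, hy]
    | tmul a b => simp
  have h2 : ∀ y : (H ⊗[k] H) ⊗[k] H, TensorProduct.lid k H (ψ.rTensor H
      (TensorProduct.lid k (H ⊗[k] H) (φ.rTensor (H ⊗[k] H) (TensorProduct.assoc k H H H y)))) =
      TensorProduct.lid k H
        ((((TensorProduct.lid k k : k ⊗[k] k →ₗ[k] k) ∘ₗ TensorProduct.map φ ψ)).rTensor H y) := by
    intro y
    induction y with
    | zero => simp
    | add x y hx hy => simp only [map_add, hx, hy]
    | tmul a b =>
      induction a with
      | zero => simp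
      | add x y hx hy => simp only [TensorProduct.add_tmul, map_add, hx, hy]
      | tmul a c => simp [mul_smul]
  simp only [leftContract, LinearMap.comp_apply, LinearEquiv.coe_coe]
  rw [h1, ← coassoc_apply, h2]
  simp only [LinearMap.rTensor_comp_apply]

/-- Take all `∑ φ(x₁) x₂`. They lie in the span of the right tensor factors of `Δ x`, include `x` by
the counit axiom, and are closed under left contraction, which forces `Δ U ⊆ H ⊗ U`. -/
lemma exists_finite_leftCoideal (x : H) : ∃ U : Submodule k H, Module.Finite k U ∧ x ∈ U ∧
    ∀ u ∈ U, comul (R := k) u ∈ LinearMap.range (U.subtype.lTensor H) := by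
  let F : Module.Dual k H →ₗ[k] H :=
    { toFun := fun φ => leftContract φ x
      map_add' := fun φ ψ => by simp [leftContract, LinearMap.rTensor_add]
      map_smul' := fun c φ => by simp [leftContract, LinearMap.rTensor_smul] }
  refine ⟨LinearMap.range F, ?_, ⟨counit, by simp [F, leftContract]⟩, ?_⟩
  · classical
    obtain ⟨s, hs⟩ := TensorProduct.exists_finset (comul (R := k) x)
    refine Submodule.finiteDimensional_of_le
      (S₂ := Submodule.span k (s.image Prod.snd : Set H)) ?_
    rintro _ ⟨φ, rfl⟩
    change leftContract φ x ∈ _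
    rw [leftContract, LinearMap.comp_apply, LinearMap.comp_apply, hs]
    simp only [map_sum, LinearMap.rTensor_tmul, LinearEquiv.coe_coe, TensorProduct.lid_tmul]
    refine Submodule.sum_mem _ fun i hi => Submodule.smul_mem _ _ (Submodule.subset_span ?_)
    exact Finset.mem_coe.mpr (Finset.mem_image_of_mem _ hi)
  · rintro _ ⟨φ, rfl⟩
    let b := Module.Basis.ofVectorSpace k H
    have h1 : ∀ y : H ⊗[k] H, (∀ i, TensorProduct.lid k H ((b.coord i).rTensor H y) ∈
        LinearMap.range F) → y ∈ LinearMap.range ((LinearMap.range F).subtype.lTensor H) := by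
      intro y hy
      obtain ⟨c, rfl⟩ := TensorProduct.eq_repr_basis_left b y
      refine Submodule.sum_mem _ fun i _ => ⟨b i ⊗ₜ ⟨c i, ?_⟩, by simp⟩
      have h2 : TensorProduct.lid k H ((b.coord i).rTensor H (c.sum fun i m => b i ⊗ₜ[k] m)) =
          c i := by
        classical
        simp +contextual [Finsupp.sum, Finsupp.single_apply]
      rw [← h2]
      exact hy i
    exact h1 _ fun i => ⟨_, (leftContract_leftContract φ (b.coord i) x).symm⟩

/-- Every element of a coalgebra is a linear combination of the entries of a finite
comultiplicative matrix. -/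
lemma exists_isComultiplicative (x : H) : ∃ (n : ℕ) (h : Fin n → Fin n → H),
    IsComultiplicative k h ∧ ∃ c : Fin n → Fin n → k, x = ∑ i, ∑ j, c i j • h i j := by
  classical
  obtain ⟨U, hfin, hxU, hU⟩ := exists_finite_leftCoideal (k := k) x
  let b := Module.finBasis k U
  choose e he using fun j => LinearMap.exists_extend (b.coord j)
  have he' : ∀ j (u : U), e j u = b.coord j u := fun j u => LinearMap.congr_fun (he j) u
  have hsum : ∀ u : U, comul (R := k) (u : H) =
      ∑ j, rightContract (e j) (u : H) ⊗ₜ[k] (b j : H) := by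
    intro u
    obtain ⟨y, hy⟩ := hU u u.2
    simp only [rightContract, LinearMap.comp_apply, ← hy]
    clear hy
    induction y with
    | zero => simp
    | add y z hy hz =>
      simp only [map_add, TensorProduct.add_tmul, Finset.sum_add_distrib]
      exact congrArg₂ (· + ·) hy hz
    | tmul a v =>
      simp only [LinearMap.lTensor_tmul, Submodule.subtype_apply, LinearEquiv.coe_coe,
        TensorProduct.rid_tmul, he']
      rw [Finset.sum_congr rfl fun j _ => TensorProduct.smul_tmul _ _ _, ← TensorProduct.tmul_sum]
      congr 1
      have := congrArg U.subtype (b.sum_repr v)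
      rw [map_sum] at this
      exact this.symm
  -- The entries are the coefficients in `Δ(b i) = ∑ h i j ⊗ b j`. Applying the counit to the second
  -- factor recovers `b i`, whence the coefficients that express `x`.
  refine ⟨_, fun i j => rightContract (e j) (b i : H), ⟨fun i j => ?_, fun i j => ?_⟩,
    fun i j => b.repr ⟨x, hxU⟩ i * counit (R := k) (b j : H), ?_⟩
  · have h1 : ∀ y : H ⊗[k] H,
        comul (R := k) (TensorProduct.rid k H ((e j).lTensor H y)) =
        TensorProduct.rid k (H ⊗[k] H) ((e j).lTensor (H ⊗[k] H) (comul.rTensor H y)) := by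
      intro y
      induction y with
      | zero => simp
      | add x y hx hy => simp only [map_add, hx, hy]
      | tmul a b => simp
    have h2 : ∀ y : H ⊗[k] (H ⊗[k] H), TensorProduct.rid k (H ⊗[k] H)
        ((e j).lTensor (H ⊗[k] H) ((TensorProduct.assoc k H H H).symm y)) =
        ((TensorProduct.rid k H : H ⊗[k] k →ₗ[k] H) ∘ₗ (e j).lTensor H).lTensor H y := by
      intro y
      induction y with
      | zero => simp
      | add x y hx hy => simp only [map_add, hx, hy]
      | tmul a b =>
        induction b with
        | zero => simp
        | add x y hx hy => simp only [TensorProduct.tmul_add, map_add, hx, hy]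
        | tmul b c => simp
    conv_lhs => rw [rightContract, LinearMap.comp_apply, LinearMap.comp_apply,
      LinearEquiv.coe_coe, h1, ← coassoc_symm_apply, h2, hsum (b i)]
    simp [rightContract]
  · have h1 : ∀ y : H ⊗[k] H, counit (R := k) (TensorProduct.rid k H ((e j).lTensor H y)) =
        e j (TensorProduct.lid k H (counit.rTensor H y)) := by
      intro y
      induction y with
      | zero => simp
      | add x y hx hy => simp only [map_add, hx, hy]
      | tmul a b => simp [mul_comm]
    rw [rightContract, LinearMap.comp_apply, LinearMap.comp_apply, LinearEquiv.coe_coe, h1,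
      rTensor_counit_comul, TensorProduct.lid_tmul, one_smul, he']
    simp [Finsupp.single_apply]
  · have h1 : ∀ u : U, (u : H) =
        ∑ j, counit (R := k) (b j : H) • rightContract (e j) (u : H) := by
      intro u
      have := congrArg (TensorProduct.rid k H) (lTensor_counit_comul (R := k) (u : H))
      rw [hsum u] at this
      simpa using this.symm
    simp_rw [mul_smul, ← Finset.smul_sum, ← h1]
    have := congrArg U.subtype (b.sum_repr ⟨x, hxU⟩)
    rw [map_sum] at this
    exact this.symm

end

section Hopf

variable [Ring H] [HopfAlgebra k H] {n : ℕ} {h : Fin n → Fin n → H}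

/-- The antipode provides a right inverse of the matrix `h`; this is what makes the twisted pairings
surjective. -/
lemma IsComultiplicative.sum_mul_antipode (hh : IsComultiplicative k h) (i j : Fin n) :
    ∑ m, h i m * HopfAlgebra.antipode k (h m j) = if i = j then 1 else 0 := by
  have := HopfAlgebra.mul_antipode_lTensor_comul_apply (R := k) (h i j)
  rw [hh.comul_apply, hh.counit_apply] at this
  simpa [apply_ite (algebraMap k H)] using this

variable {A M : Type*} [Ring A] [Algebra k A] [Module H A] [IsScalarTower k H A]
  [AddCommGroup M] [Module k M] [Module H M] [IsScalarTower k H M]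

lemma IsComultiplicative.smul_one (hh : IsComultiplicative k h) (hA : IsModuleAlgebra k H A)
    (i j : Fin n) : h i j • (1 : A) = if i = j then 1 else 0 := by
  rw [hA.smul_one, hh.counit_apply, apply_ite (algebraMap k A), map_one, map_zero]

lemma IsComultiplicative.smul_mul (hh : IsComultiplicative k h) (hA : IsModuleAlgebra k H A)
    (i j : Fin n) (a b : A) : h i j • (a * b) = ∑ m, (h i m • a) * (h m j • b) := by
  rw [hA.smul_mul, hh.comul_apply]
  simp [orbitMap]

lemma IsComultiplicative.smul_op_smul [Module Aᵐᵒᵖ M] [IsScalarTower k Aᵐᵒᵖ M]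
    (hh : IsComultiplicative k h) (hM : IsHopfModule k H A M)
    (i j : Fin n) (v : M) (a : A) :
    h i j • (op a • v) = ∑ m, op (h m j • a) • (h i m • v) := by
  rw [hM, hh.comul_apply]
  simp [orbitMap, rightAction]

end Hopf

end Comultiplicative

/-! ### Finite algebras over a local ring -/

section LocalFinite

variable {L : Type*} [CommRing L] [IsLocalRing L]

/-- A vector space over the residue field has length at most the number of its generators. -/
lemma length_le_of_maximalIdeal_smul_eq_zero {W : Type*} [AddCommGroup W] [Module L W]
    (hm : ∀ z ∈ IsLocalRing.maximalIdeal L, ∀ w : W, z • w = 0) {g : ℕ} {s : Fin g → W}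
    (hs : Submodule.span L (Set.range s) = ⊤) : Module.length L W ≤ g := by
  have : IsSimpleModule L (L ⧸ IsLocalRing.maximalIdeal L) :=
    isSimpleModule_iff_isCoatom.mpr (IsLocalRing.maximalIdeal.isMaximal L).out
  let f : (Fin g → L ⧸ IsLocalRing.maximalIdeal L) →ₗ[L] W :=
    ∑ i, (Submodule.liftQ (IsLocalRing.maximalIdeal L) (LinearMap.toSpanSingleton L W (s i))
      fun z hz => hm z hz _) ∘ₗ LinearMap.proj i
  have hf : Function.Surjective f := by
    classical
    rw [← LinearMap.range_eq_top, eq_top_iff, ← hs, Submodule.span_le]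
    rintro _ ⟨i, rfl⟩
    refine ⟨Pi.single i (Submodule.Quotient.mk 1), ?_⟩
    simp only [f, LinearMap.sum_apply, LinearMap.comp_apply, LinearMap.proj_apply]
    rw [Finset.sum_eq_single i]
    · rw [Pi.single_eq_same]
      exact one_smul L (s i)
    · intro j _ hj
      rw [Pi.single_eq_of_ne hj, map_zero]
    · simp
  refine (Module.length_le_of_surjective f hf).trans ?_
  simp [Module.length_eq_one]

variable {E : Type*} [Ring E] [Algebra L E]

lemma length_quotient_le {I : Ideal E} [I.IsTwoSided]
    (hI : ∀ z ∈ IsLocalRing.maximalIdeal L, algebraMap L E z ∈ I) {g : ℕ} {s : Fin g → E}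
    (hs : Submodule.span L (Set.range s) = ⊤) : Module.length L (E ⧸ I) ≤ g := by
  let p : E →ₗ[L] E ⧸ I := (Submodule.mkQ I).restrictScalars L
  refine length_le_of_maximalIdeal_smul_eq_zero (L := L) (s := p ∘ s) ?_ ?_
  · intro z hz w
    obtain ⟨e, rfl⟩ := Submodule.mkQ_surjective I w
    rw [← LinearMap.map_smul_of_tower, Algebra.smul_def, Algebra.commutes]
    exact (Submodule.Quotient.mk_eq_zero I).mpr (I.mul_mem_left _ (hI z hz))
  · rw [Set.range_comp, Submodule.span_image, hs, Submodule.map_top, LinearMap.range_eq_top]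
    exact Submodule.mkQ_surjective I

lemma length_self_quotient_le {I : Ideal E} [I.IsTwoSided]
    (hI : ∀ z ∈ IsLocalRing.maximalIdeal L, algebraMap L E z ∈ I) {g : ℕ} {s : Fin g → E}
    (hs : Submodule.span L (Set.range s) = ⊤) : Module.length (E ⧸ I) (E ⧸ I) ≤ g := by
  have h1 := Submodule.length_le_length_restrictScalars L (⊤ : Submodule (E ⧸ I) (E ⧸ I))
  rw [Module.length_top, Submodule.restrictScalars_top, Module.length_top] at h1
  exact h1.trans (length_quotient_le hI hs)

variable [Module.Finite L E]

/-- If a maximal left ideal `I` missed `z`, then `E` would be `I` plus the maximal ideal of `L`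
times `E`, and Nakayama over `L` would give `I = E`. -/
lemma algebraMap_mem_jacobson {z : L} (hz : z ∈ IsLocalRing.maximalIdeal L) :
    algebraMap L E z ∈ Ring.jacobson E := by
  rw [Ring.jacobson_eq_sInf_isMaximal, Submodule.mem_sInf]
  intro I hI
  by_contra hzI
  have h1 : (I ⊔ Ideal.span {algebraMap L E z} : Ideal E) = ⊤ :=
    (show Ideal.IsMaximal I from hI).out.2 _ (left_lt_sup.mpr fun h => hzI (h (Ideal.mem_span_singleton_self _)))
  have h2 : (⊤ : Submodule L E) ≤ I.restrictScalars L ⊔ IsLocalRing.maximalIdeal L • ⊤ := by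
    intro x _
    have hx : x ∈ (I ⊔ Ideal.span {algebraMap L E z} : Ideal E) := h1 ▸ Submodule.mem_top
    obtain ⟨y, hy, w, hw, rfl⟩ := Submodule.mem_sup.mp hx
    obtain ⟨e, rfl⟩ := Ideal.mem_span_singleton'.mp hw
    refine Submodule.add_mem_sup (show y ∈ I.restrictScalars L from hy) ?_
    rw [← Algebra.commutes, ← Algebra.smul_def]
    exact Submodule.smul_mem_smul hz trivial
  have h3 := Submodule.le_of_le_smul_of_le_jacobson_bot Module.Finite.fg_top
    (IsLocalRing.maximalIdeal_le_jacobson _) h2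
  exact (show Ideal.IsMaximal I from hI).ne_top (eq_top_iff.mpr fun x hx => h3 (x := x) trivial)

lemma isArtinianRing_quotient {I : Ideal E} [I.IsTwoSided]
    (hI : ∀ z ∈ IsLocalRing.maximalIdeal L, algebraMap L E z ∈ I) : IsArtinianRing (E ⧸ I) := by
  obtain ⟨g, s, hs⟩ := Module.Finite.exists_fin (R := L) (M := E)
  have h1 : Module.length (E ⧸ I) (E ⧸ I) ≠ ⊤ :=
    ne_top_of_le_ne_top (ENat.natCast_ne_top g) (length_self_quotient_le hI hs)
  exact (isFiniteLength_iff_isNoetherian_isArtinian.mp (Module.length_ne_top_iff.mp h1)).2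

lemma list_prod_mem_pow {R : Type*} [Ring R] (I : Ideal R) [I.IsTwoSided] (l : List R) (hl : ∀ a ∈ l, a ∈ I) :
    l.prod ∈ I ^ l.length := by
  induction l with
  | nil => rw [List.prod_nil, List.length_nil, Submodule.pow_zero, Ideal.one_eq_top]; trivial
  | cons a l ih =>
    rw [List.prod_cons, List.length_cons, Ideal.IsTwoSided.pow_succ]
    exact Ideal.mul_mem_mul (hl a (by simp)) (ih fun b hb => hl b (by simp [hb]))

/-- The Jacobson radical of a finite algebra over a local ring is nilpotent modulo the maximal
ideal. -/
lemma exists_prod_mem_maximalIdeal_smul : ∃ k : ℕ, ∀ l : List E, l.length = k →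
    (∀ a ∈ l, a ∈ Ring.jacobson E) →
      l.prod ∈ IsLocalRing.maximalIdeal L • (⊤ : Submodule L E) := by
  -- The maximal ideal times `E` is a two-sided ideal with artinian quotient, and the radical of an
  -- artinian ring is nilpotent.
  let I : Ideal E :=
    { (IsLocalRing.maximalIdeal L • (⊤ : Submodule L E)).toAddSubmonoid with
      smul_mem' := fun c x hx => by
        refine Submodule.smul_induction_on (p := fun x => c • x ∈ _) hx (fun z hz a _ => ?_)
          fun x y hx hy => ?_
        · rw [smul_comm]
          exact Submodule.smul_mem_smul hz trivial
        · rw [smul_add]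
          exact Submodule.add_mem _ hx hy }
  have hImem : ∀ x, x ∈ I ↔ x ∈ IsLocalRing.maximalIdeal L • (⊤ : Submodule L E) := fun _ => Iff.rfl
  have : I.IsTwoSided := ⟨fun {x} c hx => by
    rw [hImem] at hx ⊢
    refine Submodule.smul_induction_on (p := fun x => x * c ∈ _) hx (fun z hz a _ => ?_)
      fun x y hx hy => ?_
    · rw [smul_mul_assoc]
      exact Submodule.smul_mem_smul hz trivial
    · rw [add_mul]
      exact Submodule.add_mem _ hx hy⟩
  have : IsArtinianRing (E ⧸ I) := isArtinianRing_quotient (L := L) fun z hz => by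
    rw [hImem, Algebra.algebraMap_eq_smul_one]
    exact Submodule.smul_mem_smul hz trivial
  obtain ⟨k, hk⟩ := IsSemiprimaryRing.isNilpotent (R := E ⧸ I)
  refine ⟨k, fun l hl hlJ => ?_⟩
  rw [← hImem, ← Ideal.Quotient.eq_zero_iff_mem, map_list_prod]
  have h1 := list_prod_mem_pow (Ring.jacobson (E ⧸ I)) (l.map (Ideal.Quotient.mk I)) (by
    intro b hb
    obtain ⟨a, ha, rfl⟩ := List.mem_map.mp hb
    exact Ring.le_comap_jacobson (Ideal.Quotient.mk I) (hlJ a ha))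
  rw [List.length_map, hl, hk] at h1
  exact h1

end LocalFinite

/-! ### Simple artinian rings -/

section Simple

/-- A nontrivial semisimple ring without comaximal proper two-sided ideals is simple. -/
lemma isSimpleRing_of_not_comaximal {D : Type*} [Ring D] [Nontrivial D] [IsSemisimpleRing D]
    (h : ∀ I J : Ideal D, I.IsTwoSided → J.IsTwoSided → I ⊔ J = ⊤ → I = ⊤ ∨ J = ⊤) :
    IsSimpleRing D := by
  refine isSimpleRing_iff_isTwoSided_imp.mpr ⟨inferInstance, fun I hI => ?_⟩
  obtain ⟨C, hC⟩ := exists_isCompl I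
  have hIC : ∀ x ∈ I, ∀ y ∈ C, x * y = 0 := by
    intro x hx y hy
    have : x * y ∈ I ⊓ C := ⟨I.mul_mem_right y hx, C.mul_mem_left x hy⟩
    rwa [hC.inf_eq_bot] at this
  -- `J` is the right annihilator of `I`. It contains the complement `C`, since `I C ⊆ I ∩ C = 0`;
  -- hence `I + J = D`.
  let J : Ideal D :=
    { carrier := {y | ∀ x ∈ I, x * y = 0}
      add_mem' := fun ha hb x hx => by rw [mul_add, ha x hx, hb x hx, add_zero]
      zero_mem' := fun x _ => mul_zero x
      smul_mem' := fun c y hy x hx => by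
        rw [smul_eq_mul, ← mul_assoc]; exact hy _ (I.mul_mem_right c hx) }
  have hJ : J.IsTwoSided := ⟨fun c hy x hx => by rw [← mul_assoc, hy x hx, zero_mul]⟩
  have hsup : I ⊔ J = ⊤ := by
    rw [eq_top_iff, ← hC.sup_eq_top]
    exact sup_le_sup_left (fun y hy x hx => hIC x hx y hy) _
  rcases h I J hI hJ hsup with h1 | h1
  · exact Or.inr h1
  · refine Or.inl (eq_bot_iff.mpr fun x hx => ?_)
    have h2 : (1 : D) ∈ J := h1 ▸ Submodule.mem_top
    simpa using h2 x hx

/-- Over a simple artinian ring the number of generators is determined by the length. -/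
lemma exists_span_eq_top_of_length_le {D W : Type*} [Ring D] [IsSimpleRing D] [IsArtinianRing D]
    [AddCommGroup W] [Module D W] [Module.Finite D W] {n : ℕ}
    (h : Module.length D W ≤ n * Module.length D D) :
    ∃ w : Fin n → W, Submodule.span D (Set.range w) = ⊤ := by
  obtain ⟨l, _, S, hS, ⟨eD⟩⟩ := (IsSimpleRing.isIsotypic D D).linearEquiv_fun
  -- Isotypicity of `W × S`, which contains copies of `V` and of `S`, shows that they are
  -- isomorphic.
  have hW : IsIsotypicOfType D W S := by
    intro V hV
    have := IsSimpleRing.isIsotypic D (W × S)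
    obtain ⟨e1⟩ : Nonempty ((V.map (LinearMap.inl D W S)) ≃ₗ[D] V) :=
      ⟨(Submodule.equivMapOfInjective _ LinearMap.inl_injective V).symm⟩
    obtain ⟨e2⟩ : Nonempty ((LinearMap.range (LinearMap.inr D W S)) ≃ₗ[D] S) :=
      ⟨(LinearEquiv.ofInjective _ LinearMap.inr_injective).symm⟩
    have s1 : IsSimpleModule D (V.map (LinearMap.inl D W S)) := IsSimpleModule.congr e1
    have s2 : IsSimpleModule D (LinearMap.range (LinearMap.inr D W S)) := IsSimpleModule.congr e2
    obtain ⟨e⟩ := this (LinearMap.range (LinearMap.inr D W S)) (V.map (LinearMap.inl D W S))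
    exact ⟨e1.symm.trans (e.trans e2)⟩
  obtain ⟨m, ⟨eW⟩⟩ := hW.linearEquiv_fun
  have hmn : m ≤ n * l := by
    rw [eW.length_eq, eD.length_eq] at h
    simp only [Module.length_pi, Module.length_eq_one, ENat.card_eq_coe_fintype_card,
      Fintype.card_fin, mul_one] at h
    exact_mod_cast h
  -- With `D ≅ S^l` and `W ≅ S^m`, the surjection keeps `m ≤ n * l` of the coordinates of `D^n ≅
  -- S^(n * l)`.
  let f : (Fin n → D) →ₗ[D] W :=
    eW.symm.toLinearMap ∘ₗ LinearMap.funLeft D S (fun i => finProdFinEquiv.symm (Fin.castLE hmn i))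
      ∘ₗ (LinearEquiv.curry D S (Fin n) (Fin l)).symm.toLinearMap
      ∘ₗ (LinearEquiv.piCongrRight fun _ => eD).toLinearMap
  have hf : Function.Surjective f := by
    have h1 := LinearMap.funLeft_surjective_of_injective D S
      (fun i => finProdFinEquiv.symm (Fin.castLE hmn i)) ?_
    · exact eW.symm.surjective.comp (h1.comp ((LinearEquiv.curry D S (Fin n) (Fin l)).symm.surjective.comp
        (LinearEquiv.piCongrRight fun _ => eD).surjective))
    exact finProdFinEquiv.symm.injective.comp (Fin.castLE_injective hmn)
  refine ⟨fun i => f (Pi.basisFun D (Fin n) i), ?_⟩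
  rw [Set.range_comp' f, Submodule.span_image, (Pi.basisFun D (Fin n)).span_eq, Submodule.map_top,
    LinearMap.range_eq_top.mpr hf]

end Simple

/-! ### Localizations of A -/

section LocalizedAlgebra

variable {Z A : Type*} [CommRing Z] [Ring A] [Algebra Z A] (S : Submonoid Z)

/-- `S⁻¹A` as an algebra over `S⁻¹Z`. -/
noncomputable instance localizedAlgebra : Algebra (Localization S) (LocalizedModule S A) :=
  Algebra.ofModule
    (fun r x y => by
      induction r using Localization.induction_on with | _ r => _
      induction x using LocalizedModule.induction_on with | _ a s => _
      induction y using LocalizedModule.induction_on with | _ b t => _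
      rw [LocalizedModule.mk_smul_mk, LocalizedModule.mk_mul_mk, LocalizedModule.mk_mul_mk,
        LocalizedModule.mk_smul_mk, smul_mul_assoc, mul_assoc])
    (fun r x y => by
      induction r using Localization.induction_on with | _ r => _
      induction x using LocalizedModule.induction_on with | _ a s => _
      induction y using LocalizedModule.induction_on with | _ b t => _
      rw [LocalizedModule.mk_smul_mk, LocalizedModule.mk_mul_mk, LocalizedModule.mk_mul_mk,
        LocalizedModule.mk_smul_mk, mul_smul_comm, mul_left_comm])

/-- The localization map `A → S⁻¹A`, on opposite rings. -/
noncomputable def toLocOp : Aᵐᵒᵖ →+* (LocalizedModule S A)ᵐᵒᵖ where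
  toFun c := op (LocalizedModule.mk (unop c) 1)
  map_one' := by rw [MulOpposite.unop_one, ← MulOpposite.op_one, OreLocalization.one_def]
  map_mul' a b := by
    rw [← MulOpposite.op_mul, LocalizedModule.mk_mul_mk, one_mul, MulOpposite.unop_mul]
  map_zero' := by rw [MulOpposite.unop_zero, LocalizedModule.zero_mk, MulOpposite.op_zero]
  map_add' a b := by
    rw [← MulOpposite.op_add, LocalizedModule.mk_add_mk, one_smul, one_smul, one_mul,
      MulOpposite.unop_add]

lemma toLocOp_op (a : A) : toLocOp S (op a) = op (LocalizedModule.mk a 1) := rfl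

lemma op_mk_eq_smul (a : A) (t : S) :
    op (LocalizedModule.mk a t) = (Localization.mk 1 t : Localization S) • toLocOp S (op a) := by
  rw [toLocOp_op, ← MulOpposite.op_smul, LocalizedModule.mk_smul_mk, one_smul, mul_one]

lemma algebraMap_localization_mk_mul (t : S) :
    algebraMap (Localization S) (LocalizedModule S A)ᵐᵒᵖ (Localization.mk 1 t) *
      toLocOp S (op (algebraMap Z A t)) = 1 := by
  rw [← Algebra.smul_def, ← op_mk_eq_smul, ← MulOpposite.op_one, OreLocalization.one_def]
  congr 1
  exact LocalizedModule.mk_eq.mpr ⟨1, by simp [Submonoid.smul_def, Algebra.algebraMap_eq_smul_one]⟩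

lemma isUnit_toLocOp (t : S) : IsUnit (toLocOp S (op (algebraMap Z A t))) :=
  ⟨⟨_, _, by rw [← Algebra.commutes]; exact algebraMap_localization_mk_mul S t,
    algebraMap_localization_mk_mul S t⟩, rfl⟩

lemma exists_toLocOp_mul_eq (e : (LocalizedModule S A)ᵐᵒᵖ) :
    ∃ (a : A) (t : S), toLocOp S (op (algebraMap Z A t)) * e = toLocOp S (op a) := by
  induction e using MulOpposite.rec' with | _ x => _
  induction x using LocalizedModule.induction_on with | _ a t => _
  refine ⟨a, t, ?_⟩
  rw [op_mk_eq_smul, Algebra.smul_def, ← mul_assoc, ← Algebra.commutes,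
    algebraMap_localization_mk_mul, one_mul]

lemma span_toLocOp_eq_top {ι : Type*} {s : ι → A} (hs : Submodule.span Z (Set.range s) = ⊤) :
    Submodule.span (Localization S) (Set.range fun i => toLocOp S (op (s i))) = ⊤ := by
  have h1 : ∀ a : A, toLocOp S (op a) ∈
      Submodule.span (Localization S) (Set.range fun i => toLocOp S (op (s i))) := by
    intro a
    have ha : a ∈ Submodule.span Z (Set.range s) := hs ▸ Submodule.mem_top
    induction ha using Submodule.span_induction with
    | mem x hx => obtain ⟨i, rfl⟩ := hx; exact Submodule.subset_span ⟨i, rfl⟩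
    | zero => rw [MulOpposite.op_zero, map_zero]; exact Submodule.zero_mem _
    | add x y _ _ hx hy => rw [MulOpposite.op_add, map_add]; exact Submodule.add_mem _ hx hy
    | smul z x _ hx =>
      have : toLocOp S (op (z • x)) = (Localization.mk z 1 : Localization S) • toLocOp S (op x) := by
        rw [toLocOp_op, toLocOp_op, ← MulOpposite.op_smul, LocalizedModule.mk_smul_mk, one_mul]
      rw [this]
      exact Submodule.smul_mem _ _ hx
  rw [eq_top_iff]
  intro e _
  induction e using MulOpposite.rec' with | _ x => _
  induction x using LocalizedModule.induction_on with | _ a t => _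
  rw [op_mk_eq_smul]
  exact Submodule.smul_mem _ _ (h1 a)

instance [Module.Finite Z A] : Module.Finite (Localization S) (LocalizedModule S A)ᵐᵒᵖ := by
  obtain ⟨g, s, hs⟩ := Module.Finite.exists_fin (R := Z) (M := A)
  exact ⟨Submodule.fg_def.mpr ⟨_, Set.finite_range _, span_toLocOp_eq_top S hs⟩⟩

lemma nontrivial_localizedModule_op (hinj : Function.Injective (algebraMap Z A))
    (hS : (0 : Z) ∉ S) : Nontrivial (LocalizedModule S A)ᵐᵒᵖ := by
  refine ⟨⟨1, 0, fun h => ?_⟩⟩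
  have h1 : (LocalizedModule.mk 1 1 : LocalizedModule S A) = LocalizedModule.mk 0 1 :=
    (OreLocalization.one_def (R := Z) (S := S) (X := A)).symm.trans ((MulOpposite.op_injective h).trans (LocalizedModule.zero_mk 1).symm)
  obtain ⟨u, hu⟩ := LocalizedModule.mk_eq.mp h1
  have h2 : algebraMap Z A u = 0 := by
    simpa [Submonoid.smul_def, Algebra.algebraMap_eq_smul_one] using hu
  exact hS (hinj (h2.trans (map_zero _).symm) ▸ u.2)

end LocalizedAlgebra

/-! ### Residue rings at primes of Z -/

section ResidueRing

variable {Z : Type*} (A : Type*) [CommRing Z] [Ring A] [Algebra Z A] (q : Ideal Z) [q.IsPrime]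

/-- The opposite of the quotient of the localization `A_q` by its Jacobson radical. -/
abbrev ResidueRing : Type _ :=
  (LocalizedModule q.primeCompl A)ᵐᵒᵖ ⧸ Ring.jacobson (LocalizedModule q.primeCompl A)ᵐᵒᵖ

/-- The canonical map from `A` to its residue ring at `q`, on opposite rings. -/
noncomputable def toResidue : Aᵐᵒᵖ →+* ResidueRing A q :=
  (Ideal.Quotient.mk _).comp (toLocOp q.primeCompl)

variable {A}

lemma isUnit_toResidue {t : Z} (ht : t ∉ q) : IsUnit (toResidue A q (op (algebraMap Z A t))) :=
  (isUnit_toLocOp (A := A) q.primeCompl ⟨t, ht⟩).map (Ideal.Quotient.mk _)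

lemma exists_toResidue_mul_eq (d : ResidueRing A q) :
    ∃ a : A, ∃ t ∉ q, toResidue A q (op (algebraMap Z A t)) * d = toResidue A q (op a) := by
  obtain ⟨e, rfl⟩ := Ideal.Quotient.mk_surjective d
  obtain ⟨a, t, h⟩ := exists_toLocOp_mul_eq q.primeCompl e
  exact ⟨a, t, t.2, by rw [toResidue, RingHom.comp_apply, RingHom.comp_apply, ← map_mul, h]⟩

lemma toResidue_eq_zero_iff {c : Aᵐᵒᵖ} : toResidue A q c = 0 ↔
    toLocOp q.primeCompl c ∈ Ring.jacobson (LocalizedModule q.primeCompl A)ᵐᵒᵖ :=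
  Ideal.Quotient.eq_zero_iff_mem

lemma commute_toResidue_algebraMap (z : Z) (d : ResidueRing A q) :
    Commute (toResidue A q (op (algebraMap Z A z))) d := by
  obtain ⟨a, t, ht, h⟩ := exists_toResidue_mul_eq q d
  have h1 : ∀ a : A, toResidue A q (op (algebraMap Z A z)) * toResidue A q (op a) =
      toResidue A q (op a) * toResidue A q (op (algebraMap Z A z)) := by
    intro a
    rw [← map_mul, ← map_mul, ← MulOpposite.op_mul, ← MulOpposite.op_mul, Algebra.commutes]
  refine (isUnit_toResidue q ht).mul_right_injective ?_
  change _ * _ = _ * _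
  rw [← mul_assoc, ← mul_assoc, h, ← h1 a, ← h, ← mul_assoc, h1]

lemma toResidue_op_mul (a b : A) :
    toResidue A q (op (a * b)) = toResidue A q (op b) * toResidue A q (op a) := by
  rw [MulOpposite.op_mul, map_mul]

lemma toResidue_algebraMap_mul (t u : Z) : toResidue A q (op (algebraMap Z A (t * u))) =
    toResidue A q (op (algebraMap Z A t)) * toResidue A q (op (algebraMap Z A u)) := by
  rw [mul_comm t u, map_mul, toResidue_op_mul]

/-- The kernel of the map from `A` to its residue ring at `q`. -/
noncomputable def residueKer : TwoSidedIdeal A :=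
  (TwoSidedIdeal.ker (toResidue A q)).unop

lemma mem_residueKer {a : A} : a ∈ residueKer (A := A) q ↔ toResidue A q (op a) = 0 := by
  rw [residueKer, TwoSidedIdeal.mem_unop_iff, TwoSidedIdeal.mem_ker]

variable [Module.Finite Z A]

instance : IsArtinianRing (ResidueRing A q) :=
  isArtinianRing_quotient (L := Localization q.primeCompl) fun _ hz => algebraMap_mem_jacobson hz

lemma length_residueRing_le {g : ℕ} {s : Fin g → A} (hs : Submodule.span Z (Set.range s) = ⊤) :
    Module.length (ResidueRing A q) (ResidueRing A q) ≤ g :=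
  length_self_quotient_le (L := Localization q.primeCompl) (fun _ hz => algebraMap_mem_jacobson hz)
    (span_toLocOp_eq_top q.primeCompl hs)

/-- The radical of the localization is nilpotent modulo the maximal ideal of the localized `Z`;
denominators are then cleared. Consequently a stable ideal that dies in the residue ring is
nilpotent at `q`. -/
lemma nilpotentAt_residueKer : NilpotentAt (residueKer (A := A) q : Set A) q := by
  obtain ⟨k, hk⟩ := exists_prod_mem_maximalIdeal_smul (L := Localization q.primeCompl)
    (E := (LocalizedModule q.primeCompl A)ᵐᵒᵖ)
  refine ⟨k, fun l hl hmem => ?_⟩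
  -- The list is reversed because `op` reverses products.
  have h1 := hk ((l.map fun a => toLocOp q.primeCompl (op a)).reverse) (by simp [hl]) (by
    intro e he
    rw [List.mem_reverse] at he
    obtain ⟨a, ha, rfl⟩ := List.mem_map.mp he
    exact (toResidue_eq_zero_iff q).mp ((mem_residueKer q).mp (hmem a ha)))
  have h2 : ((l.map fun a => toLocOp q.primeCompl (op a)).reverse).prod =
      toLocOp q.primeCompl (op l.prod) := by
    rw [MulOpposite.op_list_prod, map_list_prod, ← List.map_reverse, List.map_reverse,
      List.map_reverse, List.map_map]
    rfl
  rw [h2] at h1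
  have h3 : ∀ e ∈ IsLocalRing.maximalIdeal (Localization q.primeCompl) •
      (⊤ : Submodule (Localization q.primeCompl) (LocalizedModule q.primeCompl A)ᵐᵒᵖ),
      ∃ b ∈ q • (⊤ : Submodule Z A), ∃ t : q.primeCompl, e = op (LocalizedModule.mk b t) := by
    intro e he
    refine Submodule.smul_induction_on he (fun z hz x _ => ?_) ?_
    · induction z using Localization.induction_on with | _ y => _
      induction x using MulOpposite.rec' with | _ x => _
      induction x using LocalizedModule.induction_on with | _ a s => _
      obtain ⟨y, t⟩ := y
      have hy : y ∈ q := by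
        rw [Localization.mk_eq_mk'] at hz
        exact (IsLocalization.AtPrime.mk'_mem_maximal_iff _ q y t).mp hz
      refine ⟨y • a, Submodule.smul_mem_smul hy trivial, t * s, ?_⟩
      rw [← MulOpposite.op_smul, LocalizedModule.mk_smul_mk]
    · rintro _ _ ⟨b, hb, t, rfl⟩ ⟨c, hc, u, rfl⟩
      refine ⟨u • b + t • c, Submodule.add_mem _ (Submodule.smul_mem _ _ hb)
        (Submodule.smul_mem _ _ hc), t * u, ?_⟩
      rw [← MulOpposite.op_add, LocalizedModule.mk_add_mk]
  obtain ⟨b, hb, t, h4⟩ := h3 _ h1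
  obtain ⟨u, hu⟩ := LocalizedModule.mk_eq.mp (MulOpposite.op_injective h4)
  refine ⟨u * t, q.primeCompl.mul_mem u.2 t.2, ?_⟩
  rw [one_smul, MulOpposite.unop_op] at hu
  rw [mul_smul]
  change u • t • l.prod ∈ _
  rw [hu]
  exact Submodule.smul_mem _ _ hb

end ResidueRing

/-! ### Simplicity of the residue rings -/

section UniqueMaximal

lemma eq_top_of_one_mem {A : Type*} [Ring A] {I : TwoSidedIdeal A} (h : (1 : A) ∈ I) : I = ⊤ :=
  eq_top_iff.mpr fun a _ => by simpa using I.mul_mem_left a 1 h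

lemma exists_isCoatom_ge {A : Type*} [Ring A] {I : TwoSidedIdeal A} (hI : (1 : A) ∉ I) :
    ∃ Q : TwoSidedIdeal A, IsCoatom Q ∧ I ≤ Q := by
  obtain ⟨Q, hIQ, hQ⟩ := zorn_le_nonempty₀ {J : TwoSidedIdeal A | (1 : A) ∉ J} (by
    intro c hc hchain J₀ hJ₀
    have hdir : ∀ x y : A, (∃ J ∈ c, x ∈ J) → (∃ J ∈ c, y ∈ J) → ∃ J ∈ c, x ∈ J ∧ y ∈ J := by
      rintro x y ⟨J, hJ, hx⟩ ⟨J', hJ', hy⟩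
      rcases hchain.total hJ hJ' with h | h
      · exact ⟨J', hJ', h hx, hy⟩
      · exact ⟨J, hJ, hx, h hy⟩
    refine ⟨TwoSidedIdeal.mk' {x | ∃ J ∈ c, x ∈ J} ⟨J₀, hJ₀, J₀.zero_mem⟩
      (fun {x y} hx hy => ?_) (fun {x} ⟨J, hJ, hx⟩ => ⟨J, hJ, J.neg_mem hx⟩)
      (fun {x y} ⟨J, hJ, hy⟩ => ⟨J, hJ, J.mul_mem_left x y hy⟩)
      (fun {x y} ⟨J, hJ, hx⟩ => ⟨J, hJ, J.mul_mem_right x y hx⟩), ?_, ?_⟩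
    · obtain ⟨J, hJ, h1, h2⟩ := hdir x y hx hy
      exact ⟨J, hJ, J.add_mem h1 h2⟩
    · change (1 : A) ∉ _
      rw [TwoSidedIdeal.mem_mk']
      rintro ⟨J, hJ, h1⟩
      exact hc hJ h1
    · intro J hJ x hx
      rw [TwoSidedIdeal.mem_mk']
      exact ⟨J, hJ, hx⟩) I hI
  refine ⟨Q, ⟨fun h => hQ.prop (by rw [h]; trivial), fun J hJ => ?_⟩, hIQ⟩
  by_contra hne
  exact hJ.not_ge (hQ.le_of_ge (fun h1 => hne (eq_top_of_one_mem h1)) hJ.le)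

variable {Z A : Type*} [CommRing Z] [Ring A] [Algebra Z A] [Module.Finite Z A]

/-- A proper ideal of the residue ring at `q` is dominated by a maximal ideal of `A` over each
maximal ideal of `Z` containing `q`. -/
lemma exists_isCoatom_of_residueRing {q : Ideal Z} [q.IsPrime] {I : Ideal (ResidueRing A q)}
    [I.IsTwoSided] (hI : I ≠ ⊤) {m : Ideal Z} (hm : m.IsMaximal) (hqm : q ≤ m) :
    ∃ Q : TwoSidedIdeal A, IsCoatom Q ∧ (∀ z ∈ m, algebraMap Z A z ∈ Q) ∧
      ∀ a, toResidue A q (op a) ∈ I → a ∈ Q := by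
  have hφs : ∀ (z : Z) (a : A), toResidue A q (op (z • a)) =
      toResidue A q (op (algebraMap Z A z)) * toResidue A q (op a) := fun z a => by
    rw [Algebra.smul_def, Algebra.commutes, MulOpposite.op_mul, map_mul]
  let I' : Submodule Z A :=
    { carrier := {a | toResidue A q (op a) ∈ I}
      add_mem' := fun ha hb => by
        simp only [Set.mem_ofPred_eq, MulOpposite.op_add, map_add] at *
        exact I.add_mem ha hb
      zero_mem' := by simp
      smul_mem' := fun z a ha => by
        simp only [Set.mem_ofPred_eq] at *
        rw [hφs]; exact I.mul_mem_left _ ha }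
  have hI' : ∀ a, a ∈ I' ↔ toResidue A q (op a) ∈ I := fun _ => Iff.rfl
  -- `K` is the preimage of `I` plus `m A`.
  let K : TwoSidedIdeal A := TwoSidedIdeal.mk' (I' ⊔ m • ⊤ : Submodule Z A)
    (Submodule.zero_mem _) (Submodule.add_mem _) (Submodule.neg_mem _)
    (by
      intro x y hy
      have h1 : I' ⊔ m • ⊤ ≤ (I' ⊔ m • ⊤).comap (LinearMap.mulLeft Z x) := by
        refine sup_le (fun a ha => Submodule.mem_sup_left ?_) ?_
        · rw [LinearMap.mulLeft_apply, hI', MulOpposite.op_mul, map_mul]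
          exact I.mul_mem_right _ ha
        · rw [← Submodule.map_le_iff_le_comap, Submodule.map_smul'']
          exact le_sup_of_le_right (Submodule.smul_mono le_rfl le_top)
      exact h1 hy)
    (by
      intro x y hx
      have h1 : I' ⊔ m • ⊤ ≤ (I' ⊔ m • ⊤).comap (LinearMap.mulRight Z y) := by
        refine sup_le (fun a ha => Submodule.mem_sup_left ?_) ?_
        · rw [LinearMap.mulRight_apply, hI', MulOpposite.op_mul, map_mul]
          exact I.mul_mem_left _ ha
        · rw [← Submodule.map_le_iff_le_comap, Submodule.map_smul'']
          exact le_sup_of_le_right (Submodule.smul_mono le_rfl le_top)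
      exact h1 hx)
  have hK : ∀ a, a ∈ K ↔ a ∈ I' ⊔ m • ⊤ := fun a => TwoSidedIdeal.mem_mk' _ _ _ _ _ _ a
  have h1K : (1 : A) ∉ K := by
    intro h1
    have htop : (⊤ : Submodule Z A) ≤ I' ⊔ m • ⊤ := by
      intro a _
      rw [← hK, eq_top_of_one_mem h1]
      trivial
    have hquot : (⊤ : Submodule Z (A ⧸ I')) ≤ m • ⊤ := by
      have := Submodule.map_mono (f := I'.mkQ) htop
      rw [Submodule.map_sup, Submodule.map_smul'', Submodule.map_top, Submodule.range_mkQ,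
        Submodule.mkQ_map_self, bot_sup_eq] at this
      exact this
    -- Were `K` everything, Nakayama would give `r ≡ 1` modulo `m` with `r • 1` in the preimage of
    -- `I`. As `q ≤ m`, this `r` avoids `q`, so `I` would contain a unit.
    obtain ⟨r, hr1, hr⟩ := Submodule.exists_sub_one_mem_and_smul_eq_zero_of_fg_of_le_smul m
      (⊤ : Submodule Z (A ⧸ I')) Module.Finite.fg_top hquot
    have hr2 : r • (1 : A) ∈ I' := by
      have := hr (I'.mkQ 1) trivial
      rwa [← map_smul, Submodule.mkQ_apply, Submodule.Quotient.mk_eq_zero] at this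
    have hrq : r ∉ q := fun h => hm.ne_top ((Ideal.eq_top_iff_one m).mpr (by
      have := m.sub_mem (hqm h) hr1
      rwa [sub_sub_cancel] at this))
    rw [hI', ← Algebra.algebraMap_eq_smul_one] at hr2
    exact hI (Ideal.eq_top_of_isUnit_mem _ hr2 (isUnit_toResidue q hrq))
  obtain ⟨Q, hQ, hKQ⟩ := exists_isCoatom_ge h1K
  refine ⟨Q, hQ, fun z hz => hKQ ((hK _).mpr (Submodule.mem_sup_right ?_)),
    fun a ha => hKQ ((hK _).mpr (Submodule.mem_sup_left ha))⟩
  rw [Algebra.algebraMap_eq_smul_one]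
  exact Submodule.smul_mem_smul hz trivial

/-- The residue rings are simple if each maximal ideal of the Jacobson ring `Z` lies under exactly
one maximal ideal of `A`. -/
theorem isSimpleRing_residueRing [IsJacobsonRing Z] (hinj : Function.Injective (algebraMap Z A))
    (hmax : ∀ m : Ideal Z, m.IsMaximal →
      ∃! Q : TwoSidedIdeal A, IsCoatom Q ∧ ∀ z ∈ m, algebraMap Z A z ∈ Q)
    (q : Ideal Z) [q.IsPrime] : IsSimpleRing (ResidueRing A q) := by
  have := nontrivial_localizedModule_op (A := A) q.primeCompl hinj fun h => h q.zero_mem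
  have : Nontrivial (ResidueRing A q) :=
    Ideal.Quotient.nontrivial_iff.mpr (Ring.jacobson_lt_top _).ne
  have : IsSemisimpleRing (ResidueRing A q) :=
    IsArtinianRing.isSemisimpleRing_iff_jacobson.mpr (Ring.jacobson_quotient_jacobson _)
  refine isSimpleRing_of_not_comaximal fun I J hI hJ hIJ => ?_
  by_contra! hne
  obtain ⟨i, hi, j, hj, hij⟩ := Submodule.mem_sup.mp (hIJ ▸ Submodule.mem_top : (1 : _) ∈ I ⊔ J)
  -- Denominators are cleared in `1 = i + j`: the element `a` maps into `I` and `t - a` into `J`.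
  obtain ⟨a, t, ht, ha⟩ := exists_toResidue_mul_eq q i
  have haI : toResidue A q (op a) ∈ I := ha ▸ I.mul_mem_left _ hi
  have htJ : toResidue A q (op (algebraMap Z A t - a)) ∈ J := by
    rw [MulOpposite.op_sub, map_sub, ← ha, ← mul_one (toResidue A q (op (algebraMap Z A t))),
      ← hij, mul_assoc, ← mul_sub]
    refine J.mul_mem_left _ ?_
    rw [hij, one_mul, ← hij, add_sub_cancel_left]
    exact hj
  -- `q` is an intersection of maximal ideals because `Z` is Jacobson. The one maximal ideal of `A`
  -- over `m` dominates both `I` and `J`, so it contains `t` as well as `m`, hence 1.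
  obtain ⟨m, hm, hqm, htm⟩ : ∃ m : Ideal Z, m.IsMaximal ∧ q ≤ m ∧ t ∉ m := by
    have hq := IsJacobsonRing.out ‹IsJacobsonRing Z› (Ideal.IsPrime.isRadical ‹q.IsPrime›)
    rw [← hq, Ideal.jacobson, Ideal.mem_sInf] at ht
    push Not at ht
    obtain ⟨m, ⟨hqm, hm⟩, htm⟩ := ht
    exact ⟨m, hm, hqm, htm⟩
  obtain ⟨Q, hQ, hQm, hQI⟩ := exists_isCoatom_of_residueRing hne.1 hm hqm
  obtain ⟨Q', hQ', hQm', hQJ⟩ := exists_isCoatom_of_residueRing hne.2 hm hqm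
  obtain rfl := (hmax m hm).unique ⟨hQ, hQm⟩ ⟨hQ', hQm'⟩
  have htQ : algebraMap Z A t ∈ Q := by
    have := Q.add_mem (hQJ _ htJ) (hQI _ haI)
    rwa [sub_add_cancel] at this
  obtain ⟨y, z, hz, hyz⟩ := hm.exists_inv htm
  refine hQ.1 (eq_top_of_one_mem ?_)
  have := Q.add_mem (Q.mul_mem_left (algebraMap Z A y) _ htQ) (hQm z hz)
  rwa [← map_mul, ← map_add, hyz, map_one] at this

end UniqueMaximal

/-! ### Ideals nilpotent at the contraction of P -/

section Contraction

variable {Z A : Type*} [CommRing Z] [Ring A] [Algebra Z A]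

/-- With `J` the ideal of all `u` such that `t • u ∈ P`, the product of `tA` and `J` lies in `P`,
while `tA` does not. -/
lemma Spec.mem_of_smul_mem {P : Spec A} {t : Z} (ht : t ∉ (P.contract Z).asIdeal) {x : A}
    (hx : t • x ∈ P.ideal) : x ∈ P.ideal := by
  let J : TwoSidedIdeal A := TwoSidedIdeal.mk' {u | t • u ∈ P.ideal}
    (by simp [P.ideal.zero_mem])
    (fun {a b} ha hb => by
      simp only [Set.mem_ofPred_eq, smul_add] at *; exact P.ideal.add_mem ha hb)
    (fun {a} ha => by simp only [Set.mem_ofPred_eq, smul_neg] at *; exact P.ideal.neg_mem ha)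
    (fun {a b} hb => by
      simp only [Set.mem_ofPred_eq, ← mul_smul_comm] at *; exact P.ideal.mul_mem_left _ _ hb)
    (fun {a b} ha => by
      simp only [Set.mem_ofPred_eq, ← smul_mul_assoc] at *; exact P.ideal.mul_mem_right _ _ ha)
  have hJ : ∀ u, u ∈ J ↔ t • u ∈ P.ideal := fun u => TwoSidedIdeal.mem_mk' _ _ _ _ _ _ u
  rcases P.le_or_le (centralMultiples t) J (by
    intro a ha b hb
    obtain ⟨c, rfl⟩ := (mem_centralMultiples t a).mp ha
    rw [smul_mul_assoc, ← mul_smul_comm]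
    exact P.ideal.mul_mem_left _ _ ((hJ b).mp hb)) with h | h
  · refine absurd ?_ ht
    change algebraMap Z A t ∈ P.ideal.asIdeal
    rw [TwoSidedIdeal.mem_asIdeal]
    exact h ((mem_centralMultiples t _).mpr ⟨1, Algebra.algebraMap_eq_smul_one t⟩)
  · exact h ((hJ x).mpr hx)

/-- Products of `k` elements of `K` lie in `P` up to a denominator, hence in `P`. Primeness lowers
`k` unless `K ≤ P`, and `k = 0` would put 1 into `P`. -/
lemma Spec.le_of_nilpotentAt {P : Spec A} {K : TwoSidedIdeal A}
    (hK : NilpotentAt (K : Set A) (P.contract Z).asIdeal) : K ≤ P.ideal := by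
  obtain ⟨k, hk⟩ := hK
  have h1 : ∀ l : List A, l.length = k → (∀ a ∈ l, a ∈ K) → l.prod ∈ P.ideal := by
    intro l hl hlK
    obtain ⟨t, ht, hmem⟩ := hk l hl hlK
    refine Spec.mem_of_smul_mem ht ?_
    refine Submodule.smul_induction_on hmem (fun z hz a _ => ?_) fun a b => P.ideal.add_mem
    rw [Algebra.smul_def]
    exact P.ideal.mul_mem_right _ _ (TwoSidedIdeal.mem_asIdeal.mp hz)
  clear hk
  induction k with
  | zero => exact absurd (eq_top_of_one_mem (h1 [] rfl (by simp))) P.ne_top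
  | succ k ih =>
    let J : TwoSidedIdeal A := TwoSidedIdeal.mk' {u | ∀ x ∈ K, x * u ∈ P.ideal}
      (fun x _ => by simp [P.ideal.zero_mem])
      (fun {a b} ha hb x hx => by rw [mul_add]; exact P.ideal.add_mem (ha x hx) (hb x hx))
      (fun {a} ha x hx => by rw [mul_neg]; exact P.ideal.neg_mem (ha x hx))
      (fun {a b} hb x hx => by
        rw [← mul_assoc]; exact hb _ (K.mul_mem_right _ _ hx))
      (fun {a b} ha x hx => by
        rw [← mul_assoc]; exact P.ideal.mul_mem_right _ _ (ha x hx))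
    have hJ : ∀ u, u ∈ J ↔ ∀ x ∈ K, x * u ∈ P.ideal :=
      fun u => TwoSidedIdeal.mem_mk' _ _ _ _ _ _ u
    rcases P.le_or_le K J fun x hx y hy => (hJ y).mp hy x hx with h | h
    · exact h
    · refine ih fun l hl hlK => h ((hJ _).mpr fun x hx => ?_)
      rw [← List.prod_cons]
      refine h1 (x :: l) (by simp [hl]) ?_
      simpa [hx] using hlK

end Contraction

/-! ### Localized right modules -/

section LocalizedMap

variable {Z A N N' : Type*} [CommRing Z] [Ring A] [Algebra Z A]
  [AddCommGroup N] [Module Z N] [Module Aᵐᵒᵖ N] [IsScalarTower Z Aᵐᵒᵖ N]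
  [AddCommGroup N'] [Module Z N'] [Module Aᵐᵒᵖ N'] [IsScalarTower Z Aᵐᵒᵖ N']
  (S : Submonoid Z)

/-- The `S⁻¹A`-linear map induced by a homomorphism of right `A`-modules. -/
noncomputable def locMap (f : N →ₗ[Aᵐᵒᵖ] N') :
    LocalizedModule S N →ₗ[(LocalizedModule S A)ᵐᵒᵖ] LocalizedModule S N' where
  toFun := LocalizedModule.map S (f.restrictScalars Z)
  map_add' := map_add _
  map_smul' c m := by
    induction c using MulOpposite.rec' with | _ x => _
    induction x using LocalizedModule.induction_on with | _ a s => _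
    induction m using LocalizedModule.induction_on with | _ v t => _
    rw [op_mk_smul_mk, LocalizedModule.map_mk, LocalizedModule.map_mk, RingHom.id_apply,
      op_mk_smul_mk]
    simp

lemma locMap_mk (f : N →ₗ[Aᵐᵒᵖ] N') (v : N) (t : S) :
    locMap S f (LocalizedModule.mk v t) = LocalizedModule.mk (f v) t :=
  LocalizedModule.map_mk _ _ _ _

lemma toLocOp_smul_mk_one (c : Aᵐᵒᵖ) (v : N) :
    toLocOp S c • (LocalizedModule.mk v 1 : LocalizedModule S N) = LocalizedModule.mk (c • v) 1 := by
  induction c using MulOpposite.rec' with | _ a => _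
  rw [toLocOp_op, op_mk_smul_mk, one_mul]

lemma op_algebraMap_smul (z : Z) (v : N) : op (algebraMap Z A z) • v = z • v := by
  rw [← algebraMap_smul Aᵐᵒᵖ z v]; rfl

lemma toLocOp_algebraMap_smul_mk (t : S) (v : N) :
    toLocOp S (op (algebraMap Z A t)) • (LocalizedModule.mk v t : LocalizedModule S N) =
      LocalizedModule.mk v 1 := by
  rw [toLocOp_op, op_mk_smul_mk, op_algebraMap_smul, one_mul]
  exact LocalizedModule.mk_cancel t v

lemma mk_mem_of_mk_one_mem {U : Submodule (LocalizedModule S A)ᵐᵒᵖ (LocalizedModule S N)} {v : N}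
    (h : LocalizedModule.mk v 1 ∈ U) (t : S) : LocalizedModule.mk v t ∈ U := by
  rw [← toLocOp_algebraMap_smul_mk (A := A) S t v] at h
  obtain ⟨u, hu⟩ := isUnit_toLocOp (A := A) S t
  rw [← hu] at h
  have := U.smul_mem (↑u⁻¹ : (LocalizedModule S A)ᵐᵒᵖ) h
  rwa [smul_smul, Units.inv_mul, one_smul] at this

lemma mk_one_sum {ι : Type*} (s : Finset ι) (f : ι → N) :
    (LocalizedModule.mk (∑ i ∈ s, f i) 1 : LocalizedModule S N) =
      ∑ i ∈ s, LocalizedModule.mk (f i) 1 :=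
  map_sum (LocalizedModule.mkLinearMap S N) f s

lemma span_mk_one_eq_top {v : Set N} (hv : Submodule.span Aᵐᵒᵖ v = ⊤) :
    Submodule.span (LocalizedModule S A)ᵐᵒᵖ
      ((fun y => (LocalizedModule.mk y 1 : LocalizedModule S N)) '' v) = ⊤ := by
  refine eq_top_iff.mpr fun m hm => ?_
  clear hm
  induction m using LocalizedModule.induction_on with | _ y t => _
  refine mk_mem_of_mk_one_mem S ?_ t
  have hy : y ∈ Submodule.span Aᵐᵒᵖ v := hv ▸ Submodule.mem_top
  induction hy using Submodule.span_induction with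
  | mem x hx => exact Submodule.subset_span ⟨x, hx, rfl⟩
  | zero => rw [LocalizedModule.zero_mk]; exact Submodule.zero_mem _
  | add x y _ _ hx hy =>
    have := Submodule.add_mem _ hx hy
    rwa [LocalizedModule.mk_add_mk, one_smul, one_smul, one_mul] at this
  | smul c x _ hx => rw [← toLocOp_smul_mk_one]; exact Submodule.smul_mem _ _ hx

instance [Module.Finite Aᵐᵒᵖ N] :
    Module.Finite (LocalizedModule S A)ᵐᵒᵖ (LocalizedModule S N) := by
  obtain ⟨g, s, hs⟩ := Module.Finite.exists_fin (R := Aᵐᵒᵖ) (M := N)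
  exact ⟨Submodule.fg_def.mpr ⟨_, (Set.finite_range s).image _, span_mk_one_eq_top S hs⟩⟩

end LocalizedMap

/-! ### Residue modules and local generators -/

section ResidueMap

variable {Z A N W : Type*} [CommRing Z] [Ring A] [Algebra Z A]
  [AddCommGroup N] [Module Z N] [Module Aᵐᵒᵖ N] [IsScalarTower Z Aᵐᵒᵖ N]
  (q : Ideal Z) [q.IsPrime] [AddCommGroup W] [Module (ResidueRing A q) W]

/-- The map `π` exhibits `W` as the quotient of the localization of the right module `N` at `q` by
its product with the Jacobson radical of `A_q`. -/
structure IsResidueMap (π : N →+ W) : Prop where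
  map_smul : ∀ (c : Aᵐᵒᵖ) (v : N), π (c • v) = toResidue A q c • π v
  span_range : Submodule.span (ResidueRing A q) (Set.range π) = ⊤
  mk_mem : ∀ v, π v = 0 → (LocalizedModule.mk v 1 : LocalizedModule q.primeCompl N) ∈
    Ring.jacobson (LocalizedModule q.primeCompl A)ᵐᵒᵖ •
      (⊤ : Submodule (LocalizedModule q.primeCompl A)ᵐᵒᵖ (LocalizedModule q.primeCompl N))

variable (A N) in
/-- The residue module of the right module `N` at `q`. -/
abbrev ResidueModule : Type _ :=
  LocalizedModule q.primeCompl N ⧸ (Ring.jacobson (LocalizedModule q.primeCompl A)ᵐᵒᵖ •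
    (⊤ : Submodule (LocalizedModule q.primeCompl A)ᵐᵒᵖ (LocalizedModule q.primeCompl N)))

variable (A N) in
/-- The canonical map from a right module to its residue module at `q`. -/
noncomputable def toResidueModule : N →+ ResidueModule A N q :=
  (Submodule.mkQ _).toAddMonoidHom.comp (LocalizedModule.mkLinearMap q.primeCompl N).toAddMonoidHom

lemma toResidueModule_apply (v : N) : toResidueModule A N q v =
    Submodule.Quotient.mk (LocalizedModule.mk v 1 : LocalizedModule q.primeCompl N) := rfl

lemma isResidueMap_toResidueModule : IsResidueMap (A := A) q (toResidueModule A N q) where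
  map_smul c v := by
    rw [toResidueModule_apply, toResidueModule_apply, ← toLocOp_smul_mk_one (A := A)]
    rfl
  span_range := by
    rw [eq_top_iff]
    intro y _
    obtain ⟨m, rfl⟩ := Submodule.Quotient.mk_surjective _ y
    induction m using LocalizedModule.induction_on with | _ v t => _
    obtain ⟨u, hu⟩ := isUnit_toResidue (A := A) q t.2
    have h1 : toResidueModule A N q v = (u : ResidueRing A q) •
        Submodule.Quotient.mk (LocalizedModule.mk v t : LocalizedModule q.primeCompl N) := by
      rw [hu, toResidueModule_apply, ← toLocOp_algebraMap_smul_mk (A := A) q.primeCompl t v]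
      rfl
    have h2 : toResidueModule A N q v ∈
        Submodule.span (ResidueRing A q) (Set.range (toResidueModule A N q)) :=
      Submodule.subset_span ⟨v, rfl⟩
    rw [h1] at h2
    have := Submodule.smul_mem _ (↑u⁻¹ : ResidueRing A q) h2
    rwa [smul_smul, Units.inv_mul, one_smul] at this
  mk_mem v hv := (Submodule.Quotient.mk_eq_zero _).mp hv

variable {q}

namespace IsResidueMap

variable {π : N →+ W}

lemma map_zsmul (hπ : IsResidueMap (A := A) q π) (z : Z) (v : N) : π (z • v) = toResidue A q (op (algebraMap Z A z)) • π v := by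
  rw [← hπ.map_smul, op_algebraMap_smul]

lemma exists_smul_eq (hπ : IsResidueMap (A := A) q π) (y : W) :
    ∃ t ∉ q, ∃ v, toResidue A q (op (algebraMap Z A t)) • y = π v := by
  have hy : y ∈ Submodule.span (ResidueRing A q) (Set.range π) :=
    hπ.span_range ▸ Submodule.mem_top
  induction hy using Submodule.span_induction with
  | mem x hx =>
    obtain ⟨v, rfl⟩ := hx
    exact ⟨1, q.primeCompl.one_mem, v, by simp⟩
  | zero => exact ⟨1, q.primeCompl.one_mem, 0, by simp⟩
  | add x y _ _ hx hy =>
    obtain ⟨t, ht, v, hv⟩ := hx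
    obtain ⟨u, hu, w, hw⟩ := hy
    refine ⟨t * u, q.primeCompl.mul_mem ht hu, u • v + t • w, ?_⟩
    rw [map_add, hπ.map_zsmul, hπ.map_zsmul, ← hv, ← hw, smul_add, smul_smul, smul_smul,
      ← toResidue_algebraMap_mul, ← toResidue_algebraMap_mul, mul_comm u t]
  | smul d x _ hx =>
    obtain ⟨t, ht, v, hv⟩ := hx
    obtain ⟨a, u, hu, ha⟩ := exists_toResidue_mul_eq q d
    refine ⟨u * t, q.primeCompl.mul_mem hu ht, op a • v, ?_⟩
    rw [hπ.map_smul, ← ha, ← hv, toResidue_algebraMap_mul, smul_smul, smul_smul, mul_assoc,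
      mul_assoc, (commute_toResidue_algebraMap q t d).eq]

lemma finite (hπ : IsResidueMap (A := A) q π) [Module.Finite Aᵐᵒᵖ N] : Module.Finite (ResidueRing A q) W := by
  obtain ⟨g, s, hs⟩ := Module.Finite.exists_fin (R := Aᵐᵒᵖ) (M := N)
  refine ⟨Submodule.fg_def.mpr ⟨Set.range (π ∘ s), Set.finite_range _, ?_⟩⟩
  rw [eq_top_iff, ← hπ.span_range, Submodule.span_le]
  rintro _ ⟨v, rfl⟩
  have hv : v ∈ Submodule.span Aᵐᵒᵖ (Set.range s) := hs ▸ Submodule.mem_top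
  induction hv using Submodule.span_induction with
  | mem x hx => obtain ⟨i, rfl⟩ := hx; exact Submodule.subset_span ⟨i, rfl⟩
  | zero => rw [map_zero]; exact Submodule.zero_mem _
  | add x y _ _ hx hy => rw [map_add]; exact Submodule.add_mem _ hx hy
  | smul c x _ hx => rw [hπ.map_smul]; exact Submodule.smul_mem _ _ hx

/-- Nakayama's lemma. -/
lemma locallyGenerated (hπ : IsResidueMap (A := A) q π) [Module.Finite Aᵐᵒᵖ N] {a : ℕ}
    {w : Fin a → N}
    (hw : Submodule.span (ResidueRing A q) (Set.range (π ∘ w)) = ⊤) : LocallyGenerated A q w := by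
  let S := q.primeCompl
  let U : Submodule (LocalizedModule S A)ᵐᵒᵖ (LocalizedModule S N) :=
    Submodule.span _ (Set.range fun i => LocalizedModule.mk (w i) 1)
  -- In `W` a multiple `t • v` agrees with a combination of the `w i`; the difference dies in `W`,
  -- so it lies in the radical part.
  have h1 : ∀ v : N, (LocalizedModule.mk v 1 : LocalizedModule S N) ∈
      U ⊔ Ring.jacobson (LocalizedModule S A)ᵐᵒᵖ • ⊤ := by
    intro v
    obtain ⟨d, hd⟩ := (Submodule.mem_span_range_iff_exists_fun _).mp
      (hw ▸ Submodule.mem_top : π v ∈ _)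
    obtain ⟨t, ht, h2⟩ := exists_common_denominator (q := q)
      (fun i t => ∃ b : A, toResidue A q (op (algebraMap Z A t)) * d i = toResidue A q (op b))
      (fun i t u ⟨b, hb⟩ => ⟨b * algebraMap Z A u, by
        rw [toResidue_algebraMap_mul, mul_assoc, hb, ← toResidue_op_mul]⟩)
      fun i => by
        obtain ⟨b, t, ht, h⟩ := exists_toResidue_mul_eq q (d i)
        exact ⟨t, ht, b, h⟩
    choose b hb using h2
    have h3 : π (t • v - ∑ i, op (b i) • w i) = 0 := by
      rw [map_sub, hπ.map_zsmul, ← hd, map_sum, sub_eq_zero, Finset.smul_sum]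
      refine Finset.sum_congr rfl fun i _ => ?_
      rw [hπ.map_smul, ← hb, smul_smul]
      rfl
    have h4 := mk_mem_of_mk_one_mem (A := A) S (hπ.mk_mem _ h3) (⟨t, ht⟩ : S)
    have h5 : (LocalizedModule.mk (∑ i, op (b i) • w i) 1 : LocalizedModule S N) ∈ U := by
      rw [mk_one_sum]
      refine Submodule.sum_mem _ fun i _ => ?_
      rw [← toLocOp_smul_mk_one]
      exact Submodule.smul_mem _ _ (Submodule.subset_span ⟨i, rfl⟩)
    have h6 : (LocalizedModule.mk v 1 : LocalizedModule S N) =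
        LocalizedModule.mk (∑ i, op (b i) • w i) (⟨t, ht⟩ : S) +
          LocalizedModule.mk (t • v - ∑ i, op (b i) • w i) (⟨t, ht⟩ : S) := by
      rw [LocalizedModule.mk_add_mk, ← smul_add, add_sub_cancel,
        LocalizedModule.mk_cancel_common_left]
      exact (LocalizedModule.mk_cancel (⟨t, ht⟩ : S) v).symm
    rw [h6]
    exact Submodule.add_mem_sup (mk_mem_of_mk_one_mem (A := A) S h5 _) h4
  have hU : U = ⊤ := by
    have h2 : (⊤ : Submodule (LocalizedModule S A)ᵐᵒᵖ (LocalizedModule S N ⧸ U)) ≤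
        Ring.jacobson (LocalizedModule S A)ᵐᵒᵖ • ⊤ := by
      have h3 : (⊤ : Submodule (LocalizedModule S A)ᵐᵒᵖ (LocalizedModule S N)) ≤
          U ⊔ Ring.jacobson (LocalizedModule S A)ᵐᵒᵖ • ⊤ := by
        intro m _
        induction m using LocalizedModule.induction_on with | _ v t => _
        exact mk_mem_of_mk_one_mem S (h1 v) t
      have := Submodule.map_mono (f := U.mkQ) h3
      rw [Submodule.map_sup, Submodule.map_smul'', Submodule.map_top, Submodule.range_mkQ,
        Submodule.mkQ_map_self, bot_sup_eq] at this
      exact this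
    have h4 := Submodule.FG.eq_bot_of_le_jacobson_smul Module.Finite.fg_top h2
    rw [← Submodule.ker_mkQ U, LinearMap.ker_eq_top]
    ext m
    exact (Submodule.mem_bot _).mp (h4 ▸ Submodule.mem_top)
  intro v
  obtain ⟨e, he⟩ := (Submodule.mem_span_range_iff_exists_fun _).mp
    (hU ▸ Submodule.mem_top : (LocalizedModule.mk v 1 : LocalizedModule S N) ∈ U)
  obtain ⟨t, ht, h2⟩ := exists_common_denominator (q := q)
    (fun i t => ∃ b : A, toLocOp S (op (algebraMap Z A t)) * e i = toLocOp S (op b))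
    (fun i t u ⟨b, hb⟩ => ⟨b * algebraMap Z A u, by
      rw [mul_comm, map_mul, MulOpposite.op_mul, map_mul, mul_assoc, hb, ← map_mul,
        ← MulOpposite.op_mul]⟩)
    fun i => by
      obtain ⟨b, t, h⟩ := exists_toLocOp_mul_eq S (e i)
      exact ⟨t, t.2, b, h⟩
  choose b hb using h2
  have h3 : (LocalizedModule.mk (t • v) 1 : LocalizedModule S N) =
      LocalizedModule.mk (∑ i, op (b i) • w i) 1 := by
    rw [← op_algebraMap_smul (A := A), ← toLocOp_smul_mk_one, ← he, mk_one_sum, Finset.smul_sum]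
    refine Finset.sum_congr rfl fun i _ => ?_
    rw [smul_smul, hb, toLocOp_smul_mk_one]
  obtain ⟨u, hu⟩ := LocalizedModule.mk_eq.mp h3
  rw [one_smul, one_smul] at hu
  refine ⟨u * t, q.primeCompl.mul_mem u.2 ht, fun i => algebraMap Z A u * b i, ?_⟩
  rw [mul_smul]
  refine hu.trans ?_
  rw [Finset.smul_sum]
  refine Finset.sum_congr rfl fun i _ => ?_
  simp only [← Algebra.smul_def, MulOpposite.op_smul, smul_assoc]
  rfl

/-- Simplicity of the residue ring yields `n` generators of `W`. Denominators are units, so the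
generators may be taken in the image of `N`, and Nakayama applies. -/
lemma exists_locallyGenerated (hπ : IsResidueMap (A := A) q π) [Module.Finite Z A]
    [IsSimpleRing (ResidueRing A q)] [Module.Finite Aᵐᵒᵖ N] {n : ℕ}
    (h : Module.length (ResidueRing A q) W ≤ n * Module.length (ResidueRing A q) (ResidueRing A q)) :
    ∃ w : Fin n → N, LocallyGenerated A q w := by
  have := hπ.finite
  obtain ⟨y, hy⟩ := exists_span_eq_top_of_length_le h
  choose t ht w hw using fun i => hπ.exists_smul_eq (y i)
  refine ⟨w, hπ.locallyGenerated ?_⟩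
  rw [eq_top_iff, ← hy, Submodule.span_le]
  rintro _ ⟨i, rfl⟩
  obtain ⟨u, hu⟩ := isUnit_toResidue (A := A) q (ht i)
  have h2 : π (w i) ∈ Submodule.span (ResidueRing A q) (Set.range (π ∘ w)) :=
    Submodule.subset_span ⟨i, rfl⟩
  rw [← hw, ← hu] at h2
  have := Submodule.smul_mem _ (↑u⁻¹ : ResidueRing A q) h2
  rwa [smul_smul, Units.inv_mul, one_smul] at this

/-- Describing residue modules by a property lets a power of `W` serve for the same power of `N`,
without identifying the localization of a power with a power of the localization. -/
lemma pi (hπ : IsResidueMap (A := A) q π) {ι : Type*} [Finite ι] :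
    IsResidueMap (A := A) q (N := ι → N) (W := ι → W)
      (AddMonoidHom.pi fun i => π.comp (Pi.evalAddMonoidHom _ i)) := by
  classical
  have := Fintype.ofFinite ι
  refine ⟨fun c v => ?_, ?_, fun v hv => ?_⟩
  · ext i
    exact hπ.map_smul c (v i)
  · rw [eq_top_iff]
    intro y _
    rw [← Finset.univ_sum_single y]
    refine Submodule.sum_mem _ fun i _ => ?_
    have h1 : y i ∈ Submodule.span (ResidueRing A q) (Set.range π) :=
      hπ.span_range ▸ Submodule.mem_top
    have h2 := Submodule.mem_map_of_mem (f := LinearMap.single (ResidueRing A q) (fun _ => W) i) h1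
    rw [Submodule.map_span] at h2
    refine Submodule.span_mono ?_ h2
    rintro _ ⟨_, ⟨v, rfl⟩, rfl⟩
    refine ⟨Pi.single i v, ?_⟩
    ext j
    rcases eq_or_ne j i with rfl | hj
    · change π (Pi.single (M := fun _ => N) j v j) = _
      rw [Pi.single_eq_same]
      exact (Pi.single_eq_same (M := fun _ => W) j (π v)).symm
    · change π (Pi.single (M := fun _ => N) i v j) = _
      rw [Pi.single_eq_of_ne hj, map_zero]
      exact (Pi.single_eq_of_ne (M := fun _ => W) hj (π v)).symm
  · rw [← Finset.univ_sum_single v, mk_one_sum]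
    refine Submodule.sum_mem _ fun i _ => ?_
    have h1 := hπ.mk_mem (v i) (congrFun hv i)
    have h2 := Submodule.mem_map_of_mem
      (f := locMap q.primeCompl (LinearMap.single Aᵐᵒᵖ (fun _ : ι => N) i)) h1
    rw [Submodule.map_smul'', locMap_mk] at h2
    exact Submodule.smul_mono le_rfl le_top h2

end IsResidueMap

end ResidueMap

/-! ### Twisted actions and pairings -/

section Twist

variable {k H D N W : Type*} [Field k] [Ring H] [HopfAlgebra k H] [Ring D]
  [AddCommGroup N] [Module H N] [AddCommGroup W] [Module D W] {n : ℕ}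

/-- The linear maps `Dⁿ → Wⁿ` whose matrices have the entries `π (h i j • v)`. -/
noncomputable def twist (h : Fin n → Fin n → H) (π : N →+ W) :
    N →+ ((Fin n → D) →ₗ[D] (Fin n → W)) where
  toFun v := LinearMap.pi fun m => ∑ j, LinearMap.toSpanSingleton D W (π (h m j • v)) ∘ₗ
    LinearMap.proj j
  map_zero' := by ext; simp
  map_add' v w := by ext; simp [smul_add, Finset.sum_add_distrib]

lemma twist_apply (h : Fin n → Fin n → H) (π : N →+ W) (v : N) (x : Fin n → D) (m : Fin n) :
    twist h π v x m = ∑ j, x j • π (h m j • v) := by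
  simp [twist]

lemma twist_single (h : Fin n → Fin n → H) (π : N →+ W) (v : N) (j m : Fin n) :
    twist (D := D) h π v (Pi.single j 1) m = π (h m j • v) := by
  rw [twist_apply, Finset.sum_eq_single j]
  · simp
  · intro i _ hi
    simp [hi]
  · simp

/-- The r-th unit vector is paired with the antipode of `h r l` applied to `v`; summing over r, the
matrix product collapses to the identity matrix. -/
lemma IsComultiplicative.single_mem_iSup_range_twist {h : Fin n → Fin n → H}
    (hh : IsComultiplicative k h) (π : N →+ W) {U : Set N} (hU : ∀ (g : H), ∀ v ∈ U, g • v ∈ U)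
    {v : N} (hv : v ∈ U) (l : Fin n) :
    Pi.single l (π v) ∈ ⨆ u ∈ U, LinearMap.range (twist (D := D) h π u) := by
  have h1 : Pi.single l (π v) = ∑ r, twist (D := D) h π (HopfAlgebra.antipode k (h r l) • v)
      (Pi.single r 1) := by
    ext m
    rw [Finset.sum_apply]
    simp_rw [twist_single, smul_smul]
    rw [← map_sum, ← Finset.sum_smul, hh.sum_mul_antipode]
    rcases eq_or_ne m l with rfl | hm
    · simp
    · simp [hm]
  rw [h1]
  exact Submodule.sum_mem _ fun r _ =>
    Submodule.mem_iSup_of_mem _ (Submodule.mem_iSup_of_mem (hU _ _ hv) ⟨_, rfl⟩)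

/-- Used twice: for the whole module, where the pairing fills `W^n`, and for a stable ideal `I` of
`A`, where it says `I X = X`. -/
lemma IsComultiplicative.iSup_range_twist {h : Fin n → Fin n → H}
    (hh : IsComultiplicative k h) (π : N →+ W) {U : Set N} (hU : ∀ (g : H), ∀ v ∈ U, g • v ∈ U)
    (hspan : Submodule.span D (π '' U) = ⊤) :
    ⨆ u ∈ U, LinearMap.range (twist (D := D) h π u) = ⊤ := by
  refine eq_top_iff.mpr fun y hy => ?_
  clear hy
  rw [← Finset.univ_sum_single y]
  refine Submodule.sum_mem _ fun l _ => ?_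
  have h1 : Submodule.span D (π '' U) ≤ (⨆ u ∈ U, LinearMap.range (twist (D := D) h π u)).comap
      (LinearMap.single D (fun _ => W) l) := by
    rw [Submodule.span_le]
    rintro _ ⟨v, hv, rfl⟩
    exact hh.single_mem_iSup_range_twist π hU hv l
  rw [hspan] at h1
  exact h1 (Submodule.mem_top : y l ∈ _)

end Twist

section TwistedAction

variable {k H A Z N W : Type*} [Field k] [Ring H] [HopfAlgebra k H]
  [Ring A] [Algebra k A] [Module H A] [IsScalarTower k H A]
  [CommRing Z] [Algebra Z A] (q : Ideal Z) [q.IsPrime] {n : ℕ} {h : Fin n → Fin n → H}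

variable (A) in
/-- The map from `A` to its residue ring at `q`, as an additive map. -/
noncomputable def residueAddHom : A →+ ResidueRing A q :=
  (toResidue A q).toAddMonoidHom.comp MulOpposite.opAddEquiv.toAddMonoidHom

lemma residueAddHom_apply (a : A) : residueAddHom A q a = toResidue A q (op a) := rfl

/-- The action of `A` on `Dⁿ` obtained by twisting with a comultiplicative matrix. -/
noncomputable def twistedAction (hh : IsComultiplicative k h) (hA : IsModuleAlgebra k H A) :
    A →+* Module.End (ResidueRing A q) (Fin n → ResidueRing A q) where
  __ := twist (D := ResidueRing A q) h (residueAddHom A q)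
  map_one' := by
    refine LinearMap.ext fun x => funext fun m => ?_
    change twist (D := ResidueRing A q) h (residueAddHom A q) 1 x m = x m
    rw [twist_apply, Finset.sum_eq_single m]
    · simp [hh.smul_one hA, residueAddHom_apply]
    · intro j _ hj
      simp [hh.smul_one hA, hj.symm]
    · simp
  map_mul' a b := by
    refine LinearMap.ext fun x => funext fun m => ?_
    change twist (D := ResidueRing A q) h (residueAddHom A q) (a * b) x m =
      twist (D := ResidueRing A q) h (residueAddHom A q) a
        (twist (D := ResidueRing A q) h (residueAddHom A q) b x) m
    simp only [twist_apply, hh.smul_mul hA, map_sum, residueAddHom_apply,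
      toResidue_op_mul, smul_eq_mul, Finset.mul_sum, Finset.sum_mul]
    rw [Finset.sum_comm]
    simp only [mul_assoc]

lemma twistedAction_apply (hh : IsComultiplicative k h) (hA : IsModuleAlgebra k H A) (a : A) :
    twistedAction q hh hA a = twist h (residueAddHom A q) a := rfl

variable {q}

lemma twist_op_smul [AddCommGroup N] [Module k N] [Module H N] [IsScalarTower k H N]
    [Module Aᵐᵒᵖ N] [IsScalarTower k Aᵐᵒᵖ N] [Module Z N] [IsScalarTower Z Aᵐᵒᵖ N]
    [AddCommGroup W] [Module (ResidueRing A q) W] {π : N →+ W} (hπ : IsResidueMap (A := A) q π)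
    (hh : IsComultiplicative k h) (hA : IsModuleAlgebra k H A) (hN : IsHopfModule k H A N)
    (v : N) (a : A) :
    twist (D := ResidueRing A q) h π (op a • v) = twist h π v ∘ₗ twistedAction q hh hA a := by
  refine LinearMap.ext fun x => funext fun m => ?_
  rw [LinearMap.comp_apply, twistedAction_apply]
  simp only [twist_apply, hh.smul_op_smul hN, map_sum, Finset.smul_sum, Finset.sum_smul,
    residueAddHom_apply, smul_eq_mul, hπ.map_smul]
  rw [Finset.sum_comm]
  simp only [mul_smul]

/-- Denominators are central units, so the left ideal spanned by the image of `I` is two-sided, and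
simplicity leaves only zero or everything. -/
lemma span_residue_eq_top [IsSimpleRing (ResidueRing A q)] {I : TwoSidedIdeal A}
    (hI : ¬ I ≤ residueKer q) :
    Submodule.span (ResidueRing A q) (residueAddHom A q '' I) = ⊤ := by
  set J : Ideal (ResidueRing A q) := Submodule.span (ResidueRing A q) (residueAddHom A q '' I)
  have hJ : J.IsTwoSided := ⟨by
    intro x d hx
    induction hx using Submodule.span_induction with
    | mem x hx =>
      obtain ⟨a, ha, rfl⟩ := hx
      obtain ⟨b, t, ht, hb⟩ := exists_toResidue_mul_eq q d
      obtain ⟨u, hu⟩ := isUnit_toResidue (A := A) q ht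
      have h1 : (u : ResidueRing A q) * (residueAddHom A q a * d) ∈ J := by
        refine Submodule.subset_span ⟨b * a, I.mul_mem_left _ _ ha, ?_⟩
        rw [residueAddHom_apply, toResidue_op_mul, ← hb, residueAddHom_apply, hu, ← mul_assoc,
          ← mul_assoc, (commute_toResidue_algebraMap q t _).eq]
      have := J.mul_mem_left (↑u⁻¹ : ResidueRing A q) h1
      rwa [← mul_assoc, Units.inv_mul, one_mul] at this
    | zero => rw [zero_mul]; exact J.zero_mem
    | add x y _ _ hx hy => rw [add_mul]; exact J.add_mem hx hy
    | smul c x _ hx => rw [smul_eq_mul, mul_assoc]; exact J.mul_mem_left _ hx⟩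
  refine ((isSimpleRing_iff_isTwoSided_imp.mp ‹IsSimpleRing (ResidueRing A q)›).2 J
    hJ).resolve_left fun h => hI fun a ha => ?_
  have h1 : residueAddHom A q a ∈ J := Submodule.subset_span ⟨a, ha, rfl⟩
  rw [h] at h1
  exact (mem_residueKer q).mpr h1

end TwistedAction

/-! ### Vanishing of relations at a prime of maximal rank -/

section Core

variable {k H A : Type*} [Field k] [Ring H] [HopfAlgebra k H]
  [Ring A] [Algebra k A] [Module H A] [IsScalarTower k H A]

/-- If `K` contains no nonzero stable ideals, it contains no orbits of nonzero elements. -/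
lemma eq_zero_of_smul_mem (hA : IsModuleAlgebra k H A) {K : TwoSidedIdeal A}
    (hK : ∀ I : TwoSidedIdeal A, IsStableIdeal H I → I ≤ K → I = ⊥) {a : A}
    (ha : ∀ g : H, g • a ∈ K) : a = 0 := by
  have hmul : ∀ x y : A, ((∀ g : H, g • x ∈ K) ∨ ∀ g : H, g • y ∈ K) → ∀ g : H, g • (x * y) ∈ K := by
    intro x y hxy g
    obtain ⟨n, h, hh, c, rfl⟩ := exists_isComultiplicative (k := k) g
    simp only [Finset.sum_smul]
    refine sum_mem fun i _ => sum_mem fun j _ => ?_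
    rw [smul_assoc, hh.smul_mul hA, Algebra.smul_def]
    refine K.mul_mem_left _ _ (sum_mem fun m _ => ?_)
    rcases hxy with hx | hy
    · exact K.mul_mem_right _ _ (hx _)
    · exact K.mul_mem_left _ _ (hy _)
  -- This is the largest `H`-stable ideal contained in `K`.
  let I : TwoSidedIdeal A := TwoSidedIdeal.mk' {x | ∀ g : H, g • x ∈ K}
    (fun g => by rw [smul_zero]; exact K.zero_mem)
    (fun {x y} hx hy g => by rw [smul_add]; exact K.add_mem (hx g) (hy g))
    (fun {x} hx g => by rw [smul_neg]; exact K.neg_mem (hx g))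
    (fun {x y} hy => hmul x y (Or.inr hy))
    (fun {x y} hx => hmul x y (Or.inl hx))
  have hI : ∀ x, x ∈ I ↔ ∀ g : H, g • x ∈ K := fun x => TwoSidedIdeal.mem_mk' _ _ _ _ _ _ x
  have h1 := hK I (fun g x hx => (hI _).mpr fun g' => by
      rw [smul_smul]; exact (hI _).mp hx _)
    fun x hx => by simpa using (hI x).mp hx 1
  have h2 : a ∈ I := (hI a).mpr ha
  rw [h1] at h2
  exact h2

end Core

section Relations

variable {k H A Z N W : Type*} [Field k] [Ring H] [HopfAlgebra k H]
  [Ring A] [Algebra k A] [Module H A] [IsScalarTower k H A]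
  [CommRing Z] [Algebra Z A] [Module.Finite Z A]
  [AddCommGroup N] [Module k N] [Module H N] [IsScalarTower k H N]
  [Module Aᵐᵒᵖ N] [IsScalarTower k Aᵐᵒᵖ N] [Module Z N] [IsScalarTower Z Aᵐᵒᵖ N]
  {q : Ideal Z} [q.IsPrime] [AddCommGroup W] [Module (ResidueRing A q) W]

/-- If the residue module at `q` of a Hopf module attains the largest possible length then the
relations between generators of its localizations are trivial. -/
theorem pow_mul_eq_zero_of_length_eq (hA : IsModuleAlgebra k H A) (hN : IsHopfModule k H A N)
    [IsSimpleRing (ResidueRing A q)]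
    (hq : ∀ I : TwoSidedIdeal A, IsStableIdeal H I → I ≤ residueKer q → I = ⊥)
    {π : N →+ W} (hπ : IsResidueMap (A := A) q π) {a d : ℕ}
    (hlen : Module.length (ResidueRing A q) W =
      a * Module.length (ResidueRing A q) (ResidueRing A q))
    (hgen : ∀ q : Ideal Z, q.IsPrime →
      (∀ I : TwoSidedIdeal A, IsStableIdeal H I → NilpotentAt (I : Set A) q → I = ⊥) →
        ∃ w : Fin a → N, LocallyGenerated A q w)
    (hd : ∀ m : Matrix (Fin a) (Fin a) A, ∃ c : ℕ → Z,
      m ^ d + ∑ i ∈ Finset.range d, algebraMap Z _ (c i) * m ^ i = 0)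
    {v : Fin a → N} {s : Z} (hs : ∀ y : N, ∃ c : Fin a → A, s • y = ∑ i, op (c i) • v i)
    {x : Fin a → A} (hx : ∑ i, op (x i) • v i = 0) (i : Fin a) :
    algebraMap Z A (s ^ d) * x i = 0 := by
  -- The whole orbit of `s ^ d * x i` must die in the residue ring. This needs an exponent `d` that
  -- does not depend on `g`, hence not on the matrix `h`.
  refine eq_zero_of_smul_mem hA hq fun g => ?_
  obtain ⟨n, h, hh, c, rfl⟩ := exists_isComultiplicative (k := k) g
  simp only [Finset.sum_smul]
  refine sum_mem fun m _ => sum_mem fun j _ => ?_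
  rw [smul_assoc, Algebra.smul_def]
  refine TwoSidedIdeal.mul_mem_left _ _ _ ?_
  have htop : ⨆ u, LinearMap.range (twist (D := ResidueRing A q) h π u) = ⊤ := by
    have := hh.iSup_range_twist (D := ResidueRing A q) π (U := Set.univ) (fun _ _ _ => trivial)
      (by rw [Set.image_univ]; exact hπ.span_range)
    simpa using this
  have key := (length_le_and_map_pow_mul_eq_zero hd hs hx
    (𝓘 := {s | ∃ I : TwoSidedIdeal A, IsStableIdeal H I ∧ I ≠ ⊥ ∧ s = (I : Set A)})
    (fun q' hq' hI => hgen q' hq' fun I hIs hIq => by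
      by_contra hne
      exact hI _ ⟨I, hIs, hne, rfl⟩ hIq)
    (Fin n → ResidueRing A q) (twistedAction q hh hA) (twist h π)
    (fun v a => twist_op_smul hπ hh hA hN v a)
    (by
      rintro _ ⟨I, hIs, hne, rfl⟩
      exact hh.iSup_range_twist (residueAddHom A q) hIs
        (span_residue_eq_top fun hle => hne (hq I hIs hle)))).2
    (by
      rw [htop, Module.length_top, Module.length_pi, hlen, Module.length_pi]
      simp [mul_left_comm]) i
  -- The matrix entry at `(m, j)` of the vanishing endomorphism is the residue of `h m j • (s ^ d *
  -- x i)`.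
  have h1 := congrFun (LinearMap.congr_fun key (Pi.single j 1)) m
  rw [twistedAction_apply, twist_single] at h1
  exact (mem_residueKer q).mpr h1

end Relations

/-! ### Quotients, submodules and powers of Hopf modules -/

section HopfModules

variable {k H A M : Type*} [Field k] [Ring H] [HopfAlgebra k H]
  [Ring A] [Algebra k A] [Module H A] [IsScalarTower k H A]
  [AddCommGroup M] [Module k M] [Module H M] [IsScalarTower k H M]
  [Module Aᵐᵒᵖ M] [IsScalarTower k Aᵐᵒᵖ M]

/-- An additive map compatible with the actions carries one side of the Hopf module identity to
the other module. -/
lemma map_lift_rightAction {M' : Type*} [AddCommGroup M'] [Module k M'] [Module H M']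
    [IsScalarTower k H M'] [Module Aᵐᵒᵖ M'] [IsScalarTower k Aᵐᵒᵖ M'] (f : M →+ M')
    (hf : ∀ (h : H) (v : M), f (h • v) = h • f v) (hf' : ∀ (c : Aᵐᵒᵖ) (v : M), f (c • v) = c • f v)
    (v : M) (a : A) (y : H ⊗[k] H) :
    f (TensorProduct.lift ((rightAction k A M).compl₁₂ (orbitMap k H v) (orbitMap k H a)) y) =
      TensorProduct.lift ((rightAction k A M').compl₁₂ (orbitMap k H (f v)) (orbitMap k H a)) y := by
  induction y with
  | zero => simp
  | add x y hx hy => simp only [map_add, hx, hy]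
  | tmul g h => simp [rightAction, orbitMap, hf, hf']

lemma IsHopfModule.of_surjective {M' : Type*} [AddCommGroup M'] [Module k M'] [Module H M']
    [IsScalarTower k H M'] [Module Aᵐᵒᵖ M'] [IsScalarTower k Aᵐᵒᵖ M'] (hM : IsHopfModule k H A M)
    (f : M →+ M') (hf : ∀ (h : H) (v : M), f (h • v) = h • f v)
    (hf' : ∀ (c : Aᵐᵒᵖ) (v : M), f (c • v) = c • f v) (hsurj : Function.Surjective f) :
    IsHopfModule k H A M' := by
  intro h w a
  obtain ⟨v, rfl⟩ := hsurj w
  rw [← hf', ← hf, hM, map_lift_rightAction f hf hf']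

lemma IsHopfModule.of_injective {M' : Type*} [AddCommGroup M'] [Module k M'] [Module H M']
    [IsScalarTower k H M'] [Module Aᵐᵒᵖ M'] [IsScalarTower k Aᵐᵒᵖ M'] (hM : IsHopfModule k H A M)
    (f : M' →+ M) (hf : ∀ (h : H) (v : M'), f (h • v) = h • f v)
    (hf' : ∀ (c : Aᵐᵒᵖ) (v : M'), f (c • v) = c • f v) (hinj : Function.Injective f) :
    IsHopfModule k H A M' := by
  intro h w a
  apply hinj
  rw [hf, hf', hM, map_lift_rightAction f hf hf']

lemma IsHopfModule.pi (hM : IsHopfModule k H A M) {ι : Type*} : IsHopfModule k H A (ι → M) := by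
  intro h v a
  ext i
  have := map_lift_rightAction (k := k) (H := H) (A := A) (Pi.evalAddMonoidHom (fun _ : ι => M) i)
    (fun _ _ => rfl) (fun _ _ => rfl) v a (Coalgebra.comul h)
  exact (hM h (v i) a).trans this.symm

end HopfModules

/-! ### Finitely generated Hopf modules -/

section FinitelyGenerated

variable {k H A Z M : Type*} [Field k] [Ring H] [HopfAlgebra k H]
  [Ring A] [Algebra k A] [Module H A] [IsScalarTower k H A]
  [CommRing Z] [Algebra Z A]
  [AddCommGroup M] [Module k M] [Module H M] [IsScalarTower k H M]
  [Module Aᵐᵒᵖ M] [IsScalarTower k Aᵐᵒᵖ M] [Module Z M] [IsScalarTower Z Aᵐᵒᵖ M]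

lemma exists_smul_eq_of_locallyGenerated {q : Ideal Z} [q.IsPrime] [Module.Finite Aᵐᵒᵖ M] {n : ℕ}
    {w : Fin n → M} (hw : LocallyGenerated A q w) :
    ∃ s ∉ q, ∀ y : M, s • y ∈ Submodule.span Aᵐᵒᵖ (Set.range w) := by
  obtain ⟨g, m, hm⟩ := Module.Finite.exists_fin (R := Aᵐᵒᵖ) (M := M)
  obtain ⟨s, hs, h⟩ := exists_common_denominator (q := q)
    (fun i t => t • m i ∈ Submodule.span Aᵐᵒᵖ (Set.range w))
    (fun i t u h => by
      rw [mul_smul, ← op_algebraMap_smul (A := A)]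
      exact Submodule.smul_mem _ _ h)
    fun i => by
      obtain ⟨t, ht, c, hc⟩ := hw (m i)
      exact ⟨t, ht, hc ▸ Submodule.sum_mem _ fun j _ =>
        Submodule.smul_mem _ _ (Submodule.subset_span ⟨j, rfl⟩)⟩
  refine ⟨s, hs, fun y => ?_⟩
  have hy : y ∈ Submodule.span Aᵐᵒᵖ (Set.range m) := hm ▸ Submodule.mem_top
  induction hy using Submodule.span_induction with
  | mem x hx => obtain ⟨i, rfl⟩ := hx; exact h i
  | zero => rw [smul_zero]; exact Submodule.zero_mem _
  | add x y _ _ hx hy => rw [smul_add]; exact Submodule.add_mem _ hx hy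
  | smul c x _ hx =>
    have : s • c • x = c • s • x := (op_smul_zsmul s (unop c) x).symm
    rw [this]; exact Submodule.smul_mem _ _ hx

lemma length_residueModule_le {q : Ideal Z} [q.IsPrime] {g : ℕ} {m : Fin g → M}
    (hm : Submodule.span Aᵐᵒᵖ (Set.range m) = ⊤) :
    Module.length (ResidueRing A q) (ResidueModule A M q) ≤
      g * Module.length (ResidueRing A q) (ResidueRing A q) := by
  have hπ := isResidueMap_toResidueModule (A := A) (N := M) q
  have h1 : Submodule.span (ResidueRing A q) (Set.range (toResidueModule A M q ∘ m)) = ⊤ := by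
    rw [eq_top_iff, ← hπ.span_range, Submodule.span_le]
    rintro _ ⟨v, rfl⟩
    have hv : v ∈ Submodule.span Aᵐᵒᵖ (Set.range m) := hm ▸ Submodule.mem_top
    induction hv using Submodule.span_induction with
    | mem x hx => obtain ⟨i, rfl⟩ := hx; exact Submodule.subset_span ⟨i, rfl⟩
    | zero => rw [map_zero]; exact Submodule.zero_mem _
    | add x y _ _ hx hy => rw [map_add]; exact Submodule.add_mem _ hx hy
    | smul c x _ hx => rw [hπ.map_smul]; exact Submodule.smul_mem _ _ hx
  have h2 := Module.length_le_of_surjective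
    (Fintype.linearCombination (ResidueRing A q) (toResidueModule A M q ∘ m))
    (by rw [← LinearMap.range_eq_top, Fintype.range_linearCombination, h1])
  rwa [Module.length_pi, ENat.card_eq_coe_fintype_card, Fintype.card_fin] at h2

/-- For a finitely generated Hopf module `M`, generators of a suitable power of `M` at `p` without
nontrivial relations. -/
theorem exists_locallyGenerated_of_finite (hA : IsModuleAlgebra k H A) (hM : IsHopfModule k H A M)
    [Module.Finite Z A] [Module.Finite Aᵐᵒᵖ M]
    (hsimple : ∀ (q : Ideal Z) [q.IsPrime], IsSimpleRing (ResidueRing A q))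
    {p : Ideal Z} [hpp : p.IsPrime]
    (hp : ∀ I : TwoSidedIdeal A, IsStableIdeal H I → NilpotentAt (I : Set A) p → I = ⊥) {l : ℕ}
    (hl : Module.length (ResidueRing A p) (ResidueRing A p) = l) :
    ∃ (n : ℕ) (u : Fin n → (Fin l → M)), LocallyGenerated A p u ∧
      ∀ x : Fin n → A, ∑ i, op (x i) • u i = 0 → ∀ i, ∃ s ∉ p, s • x i = 0 := by
  classical
  obtain ⟨g, e, he⟩ := Module.Finite.exists_fin (R := Z) (M := A)
  obtain ⟨g', e', he'⟩ := Module.Finite.exists_fin (R := Aᵐᵒᵖ) (M := M)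
  let Ω := {q : Ideal Z // q.IsPrime ∧
    ∀ I : TwoSidedIdeal A, IsStableIdeal H I → NilpotentAt (I : Set A) q → I = ⊥}
  -- Each length `L q` is at most the number `g` of generators of `A` over `Z`, so `g!` is a common
  -- denominator of all ranks `n q / L q`, which are bounded by `g'`.
  have hΩ : ∀ q : Ω, ∃ L n : ℕ, ∃ _ : q.1.IsPrime,
      Module.length (ResidueRing A q.1) (ResidueRing A q.1) = L ∧
      Module.length (ResidueRing A q.1) (ResidueModule A M q.1) = n ∧
      L ∣ g.factorial ∧ 0 < L ∧ n ≤ g' * L := by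
    rintro ⟨q, hq, _⟩
    have := hsimple q
    have h1 := length_residueRing_le q he
    have h2 := length_residueModule_le (A := A) (q := q) he'
    obtain ⟨L, hL⟩ := ENat.ne_top_iff_exists.mp (ne_top_of_le_ne_top (ENat.natCast_ne_top _) h1)
    rw [← hL] at h1 h2
    obtain ⟨n, hn⟩ := ENat.ne_top_iff_exists.mp
      (ne_top_of_le_ne_top (WithTop.mul_ne_top (ENat.natCast_ne_top _) (ENat.natCast_ne_top _)) h2)
    rw [← hn] at h2
    have h3 : 0 < Module.length (ResidueRing A q) (ResidueRing A q) := Module.length_pos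
    rw [← hL] at h3
    norm_cast at h1 h2 h3
    exact ⟨L, n, hq, hL.symm, hn.symm, Nat.dvd_factorial h3 h1, h3, h2⟩
  choose L n hprime hL hn hdvd hpos hle using hΩ
  set b := g.factorial with hb
  have hfL : ∀ q, b / L q * n q * L q = b * n q := fun q => by
    rw [mul_right_comm, Nat.div_mul_cancel (hdvd q)]
  -- `b / L q * n q` is `b` times the rank at `q`: an integer at most `b * g'`, so the maximum is
  -- attained.
  obtain ⟨q₁, hq₁⟩ : ∃ q₁ : Ω, ∀ q, b / L q * n q ≤ b / L q₁ * n q₁ := by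
    have hne : Nonempty Ω := ⟨⟨p, hpp, hp⟩⟩
    obtain ⟨_, ⟨q₁, rfl⟩, h⟩ := Set.exists_max_image (Set.range fun q => b / L q * n q) id
      (Set.Finite.subset (Set.finite_Iic (b * g')) (by
        rintro _ ⟨q, rfl⟩
        refine (Nat.mul_le_mul_left _ (hle q)).trans ?_
        rw [mul_comm g', ← mul_assoc, Nat.div_mul_cancel (hdvd q)])) (Set.range_nonempty _)
    exact ⟨q₁, fun q => h _ ⟨q, rfl⟩⟩
  set a := b / L q₁ * n q₁
  let p₀ : Ω := ⟨p, hpp, hp⟩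
  obtain rfl : L p₀ = l := by
    have := hL p₀
    rw [hl] at this
    exact_mod_cast this.symm
  set c := b / L p₀
  have hc : 0 < c := Nat.div_pos (Nat.le_of_dvd (Nat.factorial_pos g) (hdvd p₀)) (hpos p₀)
  -- As `c * L p₀ = b`, the module in play is the `b`-th power of `M`, arranged in `c` blocks of `L
  -- p₀ = l` copies. Its rank at `q` is the integer `b / L q * n q`.
  have hlen : ∀ q : Ω, ∀ _ : q.1.IsPrime,
      Module.length (ResidueRing A q.1) (Fin c → Fin (L p₀) → ResidueModule A M q.1) =
      ((b / L q * n q : ℕ) : ℕ∞) * Module.length (ResidueRing A q.1) (ResidueRing A q.1) := by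
    intro q _
    rw [Module.length_pi, Module.length_pi, hn, hL]
    simp only [ENat.card_eq_coe_fintype_card, Fintype.card_fin]
    norm_cast
    rw [hfL, ← mul_assoc, Nat.div_mul_cancel (hdvd p₀)]
  have hπ : ∀ q : Ω, ∀ _ : q.1.IsPrime, IsResidueMap (A := A) q.1
      (N := Fin c → Fin (L p₀) → M) (W := Fin c → Fin (L p₀) → ResidueModule A M q.1) _ := fun q _ =>
    (isResidueMap_toResidueModule (A := A) (N := M) q.1).pi.pi
  have hgen : ∀ q : Ω, ∃ w : Fin a → (Fin c → Fin (L p₀) → M), LocallyGenerated A q.1 w := by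
    intro q
    have := hprime q
    have := hsimple q.1
    refine (hπ q (hprime q)).exists_locallyGenerated ?_
    rw [hlen q]
    gcongr
    exact hq₁ q
  have hmat : Module.Finite Z (Matrix (Fin a) (Fin a) A) :=
    inferInstanceAs (Module.Finite Z (Fin a → Fin a → A))
  obtain ⟨d, hd⟩ := exists_uniform_integral Z (Matrix (Fin a) (Fin a) A)
  obtain ⟨u, hu⟩ : ∃ u : Fin (n p₀) → (Fin (L p₀) → M), LocallyGenerated A p u := by
    have := hsimple p
    refine (isResidueMap_toResidueModule (A := A) (N := M) p).pi.exists_locallyGenerated ?_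
    rw [Module.length_pi, hn p₀, hL p₀, mul_comm]
    simp
  refine ⟨n p₀, u, hu, fun x hx i => ?_⟩
  obtain ⟨s, hs, hsu⟩ := exists_smul_eq_of_locallyGenerated hu
  refine ⟨s ^ d, fun h => hs (hpp.mem_of_pow_mem d h), ?_⟩
  -- A copy of `u` in each of the `c` blocks gives `c * n p₀ ≤ a` elements generating up to `s`;
  -- they are padded with zeros to a family of length `a`.
  let ι : Fin c × Fin (n p₀) → Fin a := Fin.castLE (hq₁ p₀) ∘ finProdFinEquiv
  have hι : Function.Injective ι := (Fin.castLE_injective _).comp finProdFinEquiv.injective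
  let v : Fin a → (Fin c → Fin (L p₀) → M) :=
    Function.extend ι (fun r => Pi.single r.1 (u r.2)) 0
  have hv : ∀ r, v (ι r) = Pi.single r.1 (u r.2) := fun r => hι.extend_apply _ _ r
  have hsv : ∀ y, ∃ C : Fin a → A, s • y = ∑ i, op (C i) • v i := by
    intro y
    have h1 : s • y ∈ Submodule.span Aᵐᵒᵖ (Set.range v) := by
      rw [← Finset.univ_sum_single y, Finset.smul_sum]
      refine Submodule.sum_mem _ fun j _ => ?_
      have h2 := Submodule.mem_map_of_mem
        (f := LinearMap.single Aᵐᵒᵖ (fun _ : Fin c => Fin (L p₀) → M) j) (hsu (y j))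
      rw [Submodule.map_span] at h2
      rw [← Pi.single_smul]
      refine Submodule.span_mono ?_ h2
      rintro _ ⟨_, ⟨r, rfl⟩, rfl⟩
      exact ⟨ι (j, r), hv _⟩
    obtain ⟨C, hC⟩ := (Submodule.mem_span_range_iff_exists_fun _).mp h1
    exact ⟨fun i => unop (C i), hC.symm⟩
  let j₀ : Fin c := ⟨0, hc⟩
  have hι' : Function.Injective fun r => ι (j₀, r) := fun r r' h => by
    simpa using hι h
  -- The relation among the `u i` is placed in a single block and extended by zero.
  let x' : Fin a → A := Function.extend (fun r => ι (j₀, r)) x 0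
  have hx' : ∑ i, op (x' i) • v i = 0 := by
    rw [← Fintype.sum_of_injective (fun r => ι (j₀, r)) hι'
      (fun r => Pi.single j₀ (op (x r) • u r)) (fun i => op (x' i) • v i)
      (fun i hi => by
        have : x' i = 0 := Function.extend_apply' _ _ _ fun ⟨r, hr⟩ => hi ⟨r, hr⟩
        rw [this, MulOpposite.op_zero, zero_smul])
      (fun r => by
        have : x' (ι (j₀, r)) = x r := hι'.extend_apply _ _ r
        rw [this, hv, Pi.single_smul])]
    have := map_sum (LinearMap.single Aᵐᵒᵖ (fun _ : Fin c => Fin (L p₀) → M) j₀)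
      (fun r => op (x r) • u r) Finset.univ
    rw [hx, map_zero] at this
    exact this.symm
  have := hprime q₁
  have := hsimple q₁.1
  have h1 := pow_mul_eq_zero_of_length_eq hA hM.pi.pi
    (fun I hI hIq => q₁.2.2 I hI (by
      obtain ⟨m, hm⟩ := nilpotentAt_residueKer (A := A) q₁.1
      exact ⟨m, fun t ht hmem => hm t ht fun y hy => hIq (hmem y hy)⟩))
    (hπ q₁ (hprime q₁)) (hlen q₁ (hprime q₁))
    (fun q hq hqI => hgen ⟨q, hq, hqI⟩) hd hsv hx' (ι (j₀, i))
  have h2 : x' (ι (j₀, i)) = x i := hι'.extend_apply _ _ i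
  rw [h2, ← Algebra.smul_def] at h1
  exact h1

end FinitelyGenerated

/-! ### From finitely generated to locally finite modules -/

/-- A module filtered by submodules whose successive quotients are free is free. -/
lemma free_of_forall_extension {R X ι : Type*} [Ring R] [AddCommGroup X] [Module R X]
    [CompleteLattice ι] (L : ι → Submodule R X) (𝒩 : Set ι)
    (hsSup : ∀ s ⊆ 𝒩, sSup s ∈ 𝒩) (hL : ∀ s ⊆ 𝒩, L (sSup s) = ⨆ i ∈ s, L i) (htop : L ⊤ = ⊤)
    (hext : ∀ i ∈ 𝒩, i ≠ ⊤ → ∃ j ∈ 𝒩, i < j ∧ ∃ (n : ℕ) (b : Fin n → X),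
      LinearIndependent R ((L i).mkQ ∘ b) ∧ L j = L i ⊔ Submodule.span R (Set.range b)) :
    Module.Free R X := by
  obtain ⟨⟨i, B⟩, ⟨hi, hB, hspan⟩, hmax⟩ := zorn_le₀
    {x : ι × Set X | x.1 ∈ 𝒩 ∧ LinearIndepOn R id x.2 ∧ Submodule.span R x.2 = L x.1} (by
      intro c hc hchain
      refine ⟨(sSup (Prod.fst '' c), ⋃₀ (Prod.snd '' c)), ⟨?_, ?_, ?_⟩, ?_⟩
      · refine hsSup _ ?_
        rintro _ ⟨x, hx, rfl⟩
        exact (hc hx).1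
      · refine linearIndepOn_sUnion_of_directed ?_ ?_
        · rintro _ ⟨x, hx, rfl⟩ _ ⟨y, hy, rfl⟩
          rcases hchain.total hx hy with h | h
          · exact ⟨_, ⟨y, hy, rfl⟩, h.2, le_rfl⟩
          · exact ⟨_, ⟨x, hx, rfl⟩, le_rfl, h.2⟩
        · rintro _ ⟨x, hx, rfl⟩
          exact (hc hx).2.1
      · rw [hL _ (by rintro _ ⟨x, hx, rfl⟩; exact (hc hx).1), iSup_image, Set.sUnion_image,
          Submodule.span_iUnion₂]
        exact iSup_congr fun x => iSup_congr fun hx => (hc hx).2.2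
      · intro x hx
        exact ⟨le_sSup ⟨x, hx, rfl⟩, Set.subset_sUnion_of_mem ⟨x, hx, rfl⟩⟩)
  simp only at hi hB hspan
  by_cases h : i = ⊤
  · rw [h, htop] at hspan
    exact Module.Free.of_basis (Module.Basis.mk (v := ((↑) : B → X)) hB (by simp [hspan]))
  · obtain ⟨j, hj, hij, n, b, hb, hLj⟩ := hext i hi h
    have h1 : LinearIndependent R (Sum.elim ((↑) : B → X) b) := by
      have hsub : ∀ x : B, (x : X) ∈ L i := fun x => hspan ▸ Submodule.subset_span x.2
      exact LinearIndependent.sumElim_of_quotient (M' := L i) (f := fun x : B => ⟨x, hsub x⟩)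
        (LinearIndependent.of_comp (L i).subtype hB) b hb
    have h2 := h1.linearIndepOn_id
    rw [Set.Sum.elim_range, Subtype.range_coe] at h2
    have := hmax (y := (j, B ∪ Set.range b)) ⟨hj, h2, by
      rw [Submodule.span_union, hspan, hLj]⟩ ⟨hij.le, Set.subset_union_left⟩
    exact absurd this.1 hij.not_ge

section Elements

variable {Z A N : Type*} [CommRing Z] [Ring A] [Algebra Z A]
  [AddCommGroup N] [Module Z N] [Module Aᵐᵒᵖ N] [IsScalarTower Z Aᵐᵒᵖ N]
  (q : Ideal Z) [q.IsPrime]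

/-- A relation over the localized ring becomes one over `A` after clearing the denominators of its
coefficients and multiplying by an element of `Z` that makes its value vanish; both multipliers are
units in the localization. -/
lemma linearIndependent_mk_one {n l : ℕ} {u : Fin n → (Fin l → N)}
    (hu : ∀ x : Fin n → A, ∑ i, op (x i) • u i = 0 → ∀ i, ∃ s ∉ q, s • x i = 0) :
    LinearIndependent (LocalizedModule q.primeCompl A)ᵐᵒᵖ
      fun i j => (LocalizedModule.mk (u i j) 1 : LocalizedModule q.primeCompl N) := by
  let S := q.primeCompl
  rw [Fintype.linearIndependent_iff]
  intro d hd i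
  obtain ⟨t, ht, h2⟩ := exists_common_denominator (q := q)
    (fun i t => ∃ b : A, toLocOp S (op (algebraMap Z A t)) * d i = toLocOp S (op b))
    (fun i t u ⟨b, hb⟩ => ⟨b * algebraMap Z A u, by
      rw [mul_comm, map_mul, MulOpposite.op_mul, map_mul, mul_assoc, hb, ← map_mul,
        ← MulOpposite.op_mul]⟩)
    fun i => by
      obtain ⟨b, t, h⟩ := exists_toLocOp_mul_eq S (d i)
      exact ⟨t, t.2, b, h⟩
  choose x hx using h2
  have h3 : ∀ j, (LocalizedModule.mk ((∑ i, op (x i) • u i) j) 1 : LocalizedModule S N) = 0 := by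
    intro j
    have := congrArg (toLocOp S (op (algebraMap Z A t)) • ·) (congrFun hd j)
    simp only [Finset.sum_apply, Pi.smul_apply, Pi.zero_apply, smul_zero, Finset.smul_sum,
      smul_smul, hx, toLocOp_smul_mk_one] at this
    rw [Finset.sum_apply, mk_one_sum]
    exact this
  obtain ⟨s, hs, h4⟩ := exists_common_denominator (q := q)
    (fun j s => s • (∑ i, op (x i) • u i) j = 0)
    (fun j t u h => by rw [mul_smul, h, smul_zero])
    fun j => by
      obtain ⟨s, hs⟩ := LocalizedModule.mk_eq.mp ((h3 j).trans (LocalizedModule.zero_mk 1).symm)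
      exact ⟨s, s.2, by simpa [Submonoid.smul_def] using hs⟩
  obtain ⟨s', hs', h5⟩ := hu (fun i => s • x i) (by
    ext j
    have := h4 j
    rw [Finset.sum_apply, Finset.smul_sum] at this
    rw [Finset.sum_apply, Pi.zero_apply]
    simpa only [Pi.smul_apply, op_zsmul_smul] using this) i
  have h6 : toLocOp S (op (x i)) = 0 := by
    have h7 : toLocOp S (op (algebraMap Z A (s' * s))) * toLocOp S (op (x i)) = 0 := by
      rw [← map_mul, ← MulOpposite.op_mul, ← Algebra.commutes, ← Algebra.smul_def, mul_smul, h5,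
        MulOpposite.op_zero, map_zero]
    exact (isUnit_toLocOp (A := A) S ⟨s' * s, S.mul_mem hs' hs⟩).mul_right_eq_zero.mp h7
  rw [← hx i] at h6
  exact (isUnit_toLocOp (A := A) S ⟨t, ht⟩).mul_right_eq_zero.mp h6

end Elements

section Hopf

variable {H A M : Type*} [Ring H] [Ring A] [AddCommGroup M] [Module H M] [Module Aᵐᵒᵖ M]

/-- A subobject of a Hopf module, as an `H`-submodule. -/
def IsSubobject.toSubmodule {N : Submodule Aᵐᵒᵖ M} (hN : IsSubobject H N) : Submodule H M where
  __ := N.toAddSubmonoid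
  smul_mem' h v hv := hN h v hv

/-- The `H`-module structure of a subobject. -/
abbrev IsSubobject.module {N : Submodule Aᵐᵒᵖ M} (hN : IsSubobject H N) : Module H N :=
  inferInstanceAs (Module H hN.toSubmodule)

/-- The `H`-module structure of the quotient by a subobject. -/
abbrev IsSubobject.quotientModule {N : Submodule Aᵐᵒᵖ M} (hN : IsSubobject H N) :
    Module H (M ⧸ N) :=
  inferInstanceAs (Module H (M ⧸ hN.toSubmodule))

lemma isSubobject_sSup {s : Set (Submodule Aᵐᵒᵖ M)} (hs : ∀ N ∈ s, IsSubobject H N) :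
    IsSubobject H (sSup s) := by
  intro h v hv
  rw [sSup_eq_iSup'] at hv ⊢
  refine Submodule.iSup_induction _ (motive := fun v => h • v ∈ ⨆ N : s, N.1) hv
    (fun N x hx => Submodule.mem_iSup_of_mem N (hs _ N.2 h x hx))
    (by rw [smul_zero]; exact Submodule.zero_mem _)
    fun x y hx hy => by rw [smul_add]; exact Submodule.add_mem _ hx hy

end Hopf

section LocalizedSubmodule

variable {Z A M : Type*} [CommRing Z] [Ring A] [Algebra Z A]
  [AddCommGroup M] [Module Z M] [Module Aᵐᵒᵖ M] [IsScalarTower Z Aᵐᵒᵖ M]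
  (S : Submonoid Z) (l : ℕ)

/-- The submodule of `(S⁻¹M)ˡ` generated by the submodule `N` of `M`. -/
noncomputable def locPow (N : Submodule Aᵐᵒᵖ M) :
    Submodule (LocalizedModule S A)ᵐᵒᵖ (Fin l → LocalizedModule S M) :=
  Submodule.span _ {y | ∃ j, ∃ v ∈ N, 
    y = Pi.single j (LocalizedModule.mk v 1 : LocalizedModule S M)}

variable {S l}

/-- The elements of `M` whose image in the `j`-th summand of `(S⁻¹M)ˡ` lies in `U`. -/
noncomputable def singleComap
    (U : Submodule (LocalizedModule S A)ᵐᵒᵖ (Fin l → LocalizedModule S M)) (j : Fin l) :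
    Submodule Aᵐᵒᵖ M where
  carrier := {v | Pi.single j (LocalizedModule.mk v 1 : LocalizedModule S M) ∈ U}
  add_mem' {v w} hv hw := by
    have := U.add_mem hv hw
    rwa [← Pi.single_add, LocalizedModule.mk_add_mk, one_smul, one_smul, one_mul] at this
  zero_mem' := by
    rw [Set.mem_ofPred_eq, LocalizedModule.zero_mk, Pi.single_zero]
    exact U.zero_mem
  smul_mem' c v hv := by
    have := U.smul_mem (toLocOp S c) hv
    rwa [← Pi.single_smul, toLocOp_smul_mk_one] at this

/-- An adjunction between `locPow` and the intersection of the `singleComap U j`; monotonicity and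
compatibility with suprema follow from it. -/
lemma locPow_le_iff {N : Submodule Aᵐᵒᵖ M}
    {U : Submodule (LocalizedModule S A)ᵐᵒᵖ (Fin l → LocalizedModule S M)} :
    locPow S l N ≤ U ↔ ∀ j, N ≤ singleComap U j := by
  rw [locPow, Submodule.span_le]
  exact ⟨fun h j v hv => h ⟨j, v, hv, rfl⟩, by rintro h _ ⟨j, v, hv, rfl⟩; exact h j hv⟩

lemma locPow_mono : Monotone (locPow (A := A) (M := M) S l) := fun _ _ h =>
  locPow_le_iff.mpr fun j => h.trans (locPow_le_iff.mp le_rfl j)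

lemma mk_one_mem_locPow {N : Submodule Aᵐᵒᵖ M} {u : Fin l → M} (hu : ∀ j, u j ∈ N) :
    (fun j => LocalizedModule.mk (u j) 1) ∈ locPow S l N := by
  rw [← Finset.univ_sum_single (fun j => (LocalizedModule.mk (u j) 1 : LocalizedModule S M))]
  exact Submodule.sum_mem _ fun j _ => Submodule.subset_span ⟨j, u j, hu j, rfl⟩

lemma locPow_sSup (s : Set (Submodule Aᵐᵒᵖ M)) : locPow S l (sSup s) = ⨆ N ∈ s, locPow S l N := by
  refine le_antisymm (locPow_le_iff.mpr fun j => sSup_le fun N hN => ?_)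
    (iSup₂_le fun N hN => locPow_mono (le_sSup hN))
  exact locPow_le_iff.mp (le_iSup₂_of_le (f := fun N _ => locPow S l N) N hN le_rfl) j

lemma locPow_top : locPow S l (⊤ : Submodule Aᵐᵒᵖ M) = ⊤ := by
  refine eq_top_iff.mpr fun y hy => ?_
  clear hy
  rw [← Finset.univ_sum_single y]
  refine Submodule.sum_mem _ fun j _ => ?_
  induction y j using LocalizedModule.induction_on with | _ v t => _
  have := mk_mem_of_mk_one_mem (A := A) S (v := v)
    (U := (locPow S l (⊤ : Submodule Aᵐᵒᵖ M)).comap (LinearMap.single _ (fun _ => _) j))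
    (Submodule.subset_span ⟨j, v, trivial, rfl⟩) t
  exact this

end LocalizedSubmodule

section LocallyFinite

variable {k H A Z M : Type*} [Field k] [Ring H] [HopfAlgebra k H]
  [Ring A] [Algebra k A] [Module H A] [IsScalarTower k H A]
  [CommRing Z] [Algebra Z A] [Module.Finite Z A]
  [AddCommGroup M] [Module k M] [Module H M] [IsScalarTower k H M]
  [Module Aᵐᵒᵖ M] [IsScalarTower k Aᵐᵒᵖ M] [Module Z M] [IsScalarTower Z Aᵐᵒᵖ M]

/-- For a finitely generated subobject `F` of a Hopf module, elements of a suitable power of `F`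
that generate it modulo a subobject `N`, without nontrivial relations modulo `N`. -/
lemma exists_locallyGenerated_mod (hA : IsModuleAlgebra k H A) (hM : IsHopfModule k H A M)
    (hsimple : ∀ (q : Ideal Z) [q.IsPrime], IsSimpleRing (ResidueRing A q))
    {p : Ideal Z} [p.IsPrime]
    (hp : ∀ I : TwoSidedIdeal A, IsStableIdeal H I → NilpotentAt (I : Set A) p → I = ⊥) {l : ℕ}
    (hl : Module.length (ResidueRing A p) (ResidueRing A p) = l) {N F : Submodule Aᵐᵒᵖ M}
    (hN : IsSubobject H N) (hF : IsSubobject H F) (hFG : F.FG) :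
    ∃ (n : ℕ) (f : Fin n → (Fin l → M)), (∀ i j, f i j ∈ F) ∧
      (∀ y : Fin l → M, (∀ j, y j ∈ F) → ∃ t ∉ p, ∃ c : Fin n → A,
        ∀ j, t • y j - ∑ i, op (c i) • f i j ∈ N) ∧
      ∀ x : Fin n → A, (∑ i, op (x i) • fun j => N.mkQ (f i j)) = 0 → ∀ i, ∃ s ∉ p, s • x i = 0 := by
  let _ := hN.quotientModule
  have hsmul : ∀ (h : H) (v : M), h • N.mkQ v = N.mkQ (h • v) := fun _ _ => rfl
  have : IsScalarTower k H (M ⧸ N) := ⟨fun c h w => by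
    obtain ⟨v, rfl⟩ := N.mkQ_surjective w
    rw [hsmul, hsmul, smul_assoc]
    rfl⟩
  have hQ : IsHopfModule k H A (M ⧸ N) := hM.of_surjective N.mkQ.toAddMonoidHom
    (fun _ _ => rfl) (fun _ _ => rfl) N.mkQ_surjective
  have hF' : IsSubobject H (F.map N.mkQ) := by
    rintro h _ ⟨v, hv, rfl⟩
    exact ⟨h • v, hF h v hv, rfl⟩
  let _ := hF'.module
  have : IsScalarTower k H (F.map N.mkQ) := ⟨fun c h w => Subtype.ext (smul_assoc c h w.1)⟩
  have hFH : IsHopfModule k H A (F.map N.mkQ) := hQ.of_injective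
    (F.map N.mkQ).subtype.toAddMonoidHom (fun _ _ => rfl) (fun _ _ => rfl) Subtype.val_injective
  have : Module.Finite Aᵐᵒᵖ (F.map N.mkQ) := Module.Finite.iff_fg.mpr (hFG.map _)
  -- The finitely generated case is applied to the image of `F` in `M ⧸ N`, and the components of
  -- the resulting elements are lifted to `F`.
  obtain ⟨n, u, hu, hrel⟩ := exists_locallyGenerated_of_finite hA hFH hsimple hp hl
  choose f hf hfu using fun i j => (u i j).2
  refine ⟨n, f, hf, fun y hy => ?_, fun x hx => hrel x ?_⟩
  · obtain ⟨t, ht, c, hc⟩ := hu fun j => ⟨N.mkQ (y j), y j, hy j, rfl⟩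
    refine ⟨t, ht, c, fun j => ?_⟩
    have h1 := congrArg Subtype.val (congrFun hc j)
    rw [← Submodule.Quotient.mk_eq_zero, ← Submodule.mkQ_apply, map_sub, sub_eq_zero, map_sum]
    simp only [map_smul, hfu]
    rw [Finset.sum_apply] at h1
    refine Eq.trans ?_ (h1.trans ?_)
    · rfl
    · simp
  · ext j
    have h1 := congrFun hx j
    rw [Finset.sum_apply] at h1 ⊢
    simp only [Pi.smul_apply, hfu] at h1
    simpa using h1

/-- If `N ≠ M` is a subobject, some finitely generated subobject `F` is not contained in `N`. Lifted
generators of the image of `F` in `M ⧸ N` have no relations modulo `N`, so they extend any basis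
obtained for `N` to one for `N + F`. -/
theorem free_of_isLocallyFinite (hA : IsModuleAlgebra k H A) (hM : IsHopfModule k H A M)
    (hMfin : IsLocallyFinite H A M)
    (hsimple : ∀ (q : Ideal Z) [q.IsPrime], IsSimpleRing (ResidueRing A q))
    {p : Ideal Z} [p.IsPrime]
    (hp : ∀ I : TwoSidedIdeal A, IsStableIdeal H I → NilpotentAt (I : Set A) p → I = ⊥) {l : ℕ}
    (hl : Module.length (ResidueRing A p) (ResidueRing A p) = l) :
    Module.Free (LocalizedModule p.primeCompl A)ᵐᵒᵖ (Fin l → LocalizedModule p.primeCompl M) := by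
  set S := p.primeCompl
  refine free_of_forall_extension (ι := Submodule Aᵐᵒᵖ M) (locPow S l) {N | IsSubobject H N}
    (fun s hs => isSubobject_sSup hs) (fun s _ => locPow_sSup s) locPow_top fun N hN hne => ?_
  obtain ⟨v, hv⟩ : ∃ v, v ∉ N := by
    by_contra! h
    exact hne (eq_top_iff.mpr fun v _ => h v)
  obtain ⟨𝓕, -, h𝓕, hcover⟩ := hMfin
  obtain ⟨F, hF, hvF⟩ := hcover v
  obtain ⟨hFs, hFG⟩ := h𝓕 F hF
  have hsup : N ⊔ F = sSup {N, F} := sSup_pair.symm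
  obtain ⟨n, f, hfF, hgen, hrel⟩ := exists_locallyGenerated_mod hA hM hsimple hp hl hN hFs hFG
  refine ⟨N ⊔ F, ?_, lt_of_le_of_ne le_sup_left fun h => hv (h ▸ Submodule.mem_sup_right hvF), n,
    fun i j => LocalizedModule.mk (f i j) 1, ?_, le_antisymm ?_ ?_⟩
  · rw [hsup]
    refine isSubobject_sSup ?_
    rintro _ (rfl | rfl)
    exacts [hN, hFs]
  · let φ : (Fin l → LocalizedModule S M) →ₗ[(LocalizedModule S A)ᵐᵒᵖ]
        (Fin l → LocalizedModule S (M ⧸ N)) :=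
      LinearMap.pi fun j => locMap S N.mkQ ∘ₗ LinearMap.proj j
    have hφ : locPow S l N ≤ LinearMap.ker φ := by
      rw [locPow_le_iff]
      intro j w hw
      change φ _ = 0
      ext i
      change locMap S N.mkQ (Pi.single (M := fun _ => LocalizedModule S M) j _ i) = 0
      rcases eq_or_ne i j with rfl | hij
      · rw [Pi.single_eq_same, locMap_mk, Submodule.mkQ_apply,
          (Submodule.Quotient.mk_eq_zero N).mpr hw, LocalizedModule.zero_mk]
      · rw [Pi.single_eq_of_ne hij, map_zero]
    refine LinearIndependent.of_comp ((locPow S l N).liftQ φ hφ) ?_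
    have h1 : (locPow S l N).liftQ φ hφ ∘ ((locPow S l N).mkQ ∘ fun i j =>
        (LocalizedModule.mk (f i j) 1 : LocalizedModule S M)) =
        fun i j => (LocalizedModule.mk (N.mkQ (f i j)) 1 : LocalizedModule S (M ⧸ N)) := by
      funext i j
      rw [Function.comp_apply, Function.comp_apply, Submodule.mkQ_apply, Submodule.liftQ_apply]
      exact locMap_mk S N.mkQ _ _
    rw [h1]
    exact linearIndependent_mk_one p hrel
  · set U := locPow S l N ⊔ Submodule.span _ (Set.range fun i j => LocalizedModule.mk (f i j) 1)
    rw [locPow_le_iff]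
    intro j
    refine sup_le (locPow_le_iff.mp le_sup_left j) fun w hw => ?_
    obtain ⟨t, ht, c, hc⟩ := hgen (Pi.single j w) fun i => by
      rcases eq_or_ne i j with rfl | hij
      · rwa [Pi.single_eq_same]
      · rw [Pi.single_eq_of_ne hij]; exact F.zero_mem
    have h1 : toLocOp S (op (algebraMap Z A t)) •
        (Pi.single j (LocalizedModule.mk w 1) : Fin l → LocalizedModule S M) =
        (fun i => LocalizedModule.mk
          (t • (Pi.single j w : Fin l → M) i - ∑ m, op (c m) • f m i) 1) +
        ∑ m, toLocOp S (op (c m)) • fun i => LocalizedModule.mk (f m i) 1 := by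
      ext i
      simp only [Pi.add_apply, Finset.sum_apply, Pi.smul_apply, toLocOp_smul_mk_one, ← mk_one_sum]
      rw [LocalizedModule.mk_add_mk, one_smul, one_smul, one_mul, sub_add_cancel,
        ← op_algebraMap_smul (A := A), ← toLocOp_smul_mk_one]
      congr 1
      rcases eq_or_ne i j with rfl | hij
      · rw [Pi.single_eq_same, Pi.single_eq_same]
      · rw [Pi.single_eq_of_ne hij, Pi.single_eq_of_ne hij, LocalizedModule.zero_mk]
    have h2 : toLocOp S (op (algebraMap Z A t)) •
        (Pi.single j (LocalizedModule.mk w 1) : Fin l → LocalizedModule S M) ∈ U := by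
      rw [h1]
      exact Submodule.add_mem_sup (mk_one_mem_locPow hc) (Submodule.sum_mem _ fun m _ =>
        Submodule.smul_mem _ _ (Submodule.subset_span ⟨m, rfl⟩))
    obtain ⟨u, hu⟩ := isUnit_toLocOp (A := A) S ⟨t, ht⟩
    rw [← hu] at h2
    have := U.smul_mem (↑u⁻¹ : (LocalizedModule S A)ᵐᵒᵖ) h2
    rwa [smul_smul, Units.inv_mul, one_smul] at this
  · refine sup_le (locPow_mono le_sup_left) (Submodule.span_le.mpr ?_)
    rintro _ ⟨i, rfl⟩
    exact mk_one_mem_locPow fun j => Submodule.mem_sup_right (hfF i j)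

end LocallyFinite

/-! ### Identification of l with the length of the residue ring -/

lemma length_quotient_eq {E : Type*} [Ring E] (I : Ideal E) [I.IsTwoSided] :
    Module.length E (E ⧸ I) = Module.length (E ⧸ I) (E ⧸ I) := by
  refine le_antisymm ?_ ?_
  · have := Order.krullDim_le_of_strictMono
      (fun N : Submodule E (E ⧸ I) => ({ N.toAddSubmonoid with
        smul_mem' := fun c x hx => by
          obtain ⟨c, rfl⟩ := Ideal.Quotient.mk_surjective c
          exact N.smul_mem c hx } : Submodule (E ⧸ I) (E ⧸ I)))
      (fun N N' h => lt_of_le_of_ne h.le fun heq => h.ne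
        (SetLike.coe_injective (congrArg SetLike.coe heq : _)))
    rwa [← Module.coe_length, ← Module.coe_length, WithBot.coe_le_coe] at this
  · have := Submodule.length_le_length_restrictScalars E (⊤ : Submodule (E ⧸ I) (E ⧸ I))
    rwa [Module.length_top, Submodule.restrictScalars_top, Module.length_top] at this

section MaximalIdeals

variable {R : Type*} [Ring R] [IsSimpleRing (Rᵐᵒᵖ ⧸ Ring.jacobson Rᵐᵒᵖ)]

/-- If the quotient by the Jacobson radical is simple, the Jacobson radical is the only maximal
ideal. -/
lemma asIdealOpposite_eq_jacobson {Q : TwoSidedIdeal R} (hQ : IsCoatom Q) :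
    Q.asIdealOpposite = Ring.jacobson Rᵐᵒᵖ := by
  let φ : Rᵐᵒᵖ →+* Rᵐᵒᵖ ⧸ Ring.jacobson Rᵐᵒᵖ := Ideal.Quotient.mk _
  have hφ : Function.Surjective φ := Ideal.Quotient.mk_surjective
  let I : Ideal (Rᵐᵒᵖ ⧸ Ring.jacobson Rᵐᵒᵖ) := Q.asIdealOpposite.map φ
  have hmem : ∀ d, d ∈ I ↔ ∃ x ∈ Q, φ (op x) = d := by
    intro d
    rw [Ideal.mem_map_iff_of_surjective φ hφ]
    exact ⟨fun ⟨c, hc, h⟩ => ⟨unop c, TwoSidedIdeal.mem_asIdealOpposite.mp hc, h⟩,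
      fun ⟨x, hx, h⟩ => ⟨op x, TwoSidedIdeal.mem_asIdealOpposite.mpr hx, h⟩⟩
  have hI : I.IsTwoSided := ⟨by
    intro d e hd
    obtain ⟨x, hx, rfl⟩ := (hmem d).mp hd
    obtain ⟨c, rfl⟩ := hφ e
    exact (hmem _).mpr ⟨unop c * x, Q.mul_mem_left _ _ hx, by
      rw [MulOpposite.op_mul, map_mul, MulOpposite.op_unop]⟩⟩
  let K : TwoSidedIdeal R := (TwoSidedIdeal.ker φ).unop
  have hK : ∀ x, x ∈ K ↔ op x ∈ Ring.jacobson Rᵐᵒᵖ := fun x => by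
    rw [TwoSidedIdeal.mem_unop_iff, TwoSidedIdeal.mem_ker]
    exact Ideal.Quotient.eq_zero_iff_mem
  have hKtop : K ≠ ⊤ := by
    intro h
    have : op (1 : R) ∈ Ring.jacobson Rᵐᵒᵖ := (hK 1).mp (h ▸ trivial)
    have h1 : (1 : Rᵐᵒᵖ ⧸ Ring.jacobson Rᵐᵒᵖ) = 0 := Ideal.Quotient.eq_zero_iff_mem.mpr this
    exact one_ne_zero h1
  -- The image of `Q` in the simple quotient is zero or everything. In the latter case 1 is an
  -- element of `Q` plus one of the radical, and any maximal left ideal of the opposite ring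
  -- containing `Q` would contain 1.
  have hle : Q ≤ K := by
    rcases (isSimpleRing_iff_isTwoSided_imp.mp
      ‹IsSimpleRing (Rᵐᵒᵖ ⧸ Ring.jacobson Rᵐᵒᵖ)›).2 I hI with h | h
    · intro x hx
      rw [hK]
      have : φ (op x) ∈ I := (hmem _).mpr ⟨x, hx, rfl⟩
      rw [h] at this
      exact Ideal.Quotient.eq_zero_iff_mem.mp this
    · obtain ⟨x, hx, h1⟩ := (hmem 1).mp (h ▸ Submodule.mem_top)
      have h2 : op x - 1 ∈ Ring.jacobson Rᵐᵒᵖ := Ideal.Quotient.eq.mp h1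
      have h3 : Q.asIdealOpposite = ⊤ := by
        by_contra hne
        obtain ⟨m, hm, hQm⟩ := Ideal.exists_le_maximal _ hne
        rw [Ring.jacobson_eq_sInf_isMaximal, Submodule.mem_sInf] at h2
        have h4 : op x ∈ m := hQm (TwoSidedIdeal.mem_asIdealOpposite.mpr hx)
        refine hm.ne_top ((Ideal.eq_top_iff_one m).mpr ?_)
        have := m.sub_mem h4 (h2 m hm)
        rwa [sub_sub_cancel] at this
      have h4 : (1 : Rᵐᵒᵖ) ∈ Q.asIdealOpposite := h3 ▸ Submodule.mem_top
      exact absurd (eq_top_of_one_mem (TwoSidedIdeal.mem_asIdealOpposite.mp h4)) hQ.1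
  have hQK : Q = K := by
    by_contra hne
    exact hKtop (hQ.2 K (lt_of_le_of_ne hle hne))
  ext c
  rw [TwoSidedIdeal.mem_asIdealOpposite, hQK, hK, MulOpposite.op_unop]

lemma quotLength_eq {Q : TwoSidedIdeal R} (hQ : IsCoatom Q) :
    quotLength Q = Module.length (Rᵐᵒᵖ ⧸ Ring.jacobson Rᵐᵒᵖ) (Rᵐᵒᵖ ⧸ Ring.jacobson Rᵐᵒᵖ) := by
  rw [quotLength, asIdealOpposite_eq_jacobson hQ, length_quotient_eq]

/-- All maximal ideals give the length `l`, and at least one exists because the ring is nonzero. So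
the set in `lengthGcd` is that of the divisors of `l`, bounded by `l` as `l > 0`. -/
lemma lengthGcd_eq {l : ℕ} (hl : Module.length (Rᵐᵒᵖ ⧸ Ring.jacobson Rᵐᵒᵖ)
    (Rᵐᵒᵖ ⧸ Ring.jacobson Rᵐᵒᵖ) = l) (hpos : 0 < l) : lengthGcd R = l := by
  have hnt : (1 : R) ∉ (⊥ : TwoSidedIdeal R) := by
    intro h
    have h0 : (1 : R) = 0 := h
    have : Nontrivial (Rᵐᵒᵖ ⧸ Ring.jacobson Rᵐᵒᵖ) := inferInstance
    have h1 : (1 : Rᵐᵒᵖ ⧸ Ring.jacobson Rᵐᵒᵖ) = Ideal.Quotient.mk _ (op (1 : R)) := rfl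
    rw [h0, MulOpposite.op_zero, map_zero] at h1
    exact one_ne_zero h1
  obtain ⟨Q₀, hQ₀, -⟩ := exists_isCoatom_ge hnt
  have hset : {d : ℕ | ∀ Q : TwoSidedIdeal R, IsCoatom Q → d ∣ (quotLength Q).toNat} =
      {d | d ∣ l} := by
    ext d
    refine ⟨fun h => ?_, fun h Q hQ => ?_⟩
    · have := h Q₀ hQ₀
      rwa [quotLength_eq hQ₀, hl] at this
    · rw [quotLength_eq hQ, hl]
      exact h
  rw [lengthGcd, hset]
  exact IsGreatest.csSup_eq ⟨dvd_refl l, fun d hd => Nat.le_of_dvd hpos hd⟩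

end MaximalIdeals

end HopfMod

open HopfMod in
theorem theorem6p3
    {k H A Z M : Type*} [Field k] [Ring H] [HopfAlgebra k H]
    -- the module algebra `A`
    [Ring A] [Algebra k A] [Module H A] [IsScalarTower k H A]
    (hA : IsModuleAlgebra k H A)
    -- the central subring `Z`
    [CommRing Z] [Algebra Z A] (hZinj : Function.Injective (algebraMap Z A))
    [Module.Finite Z A] [IsJacobsonRing Z]
    [TopologicalSpace.NoetherianSpace (MaximalSpectrum Z)]
    (hmax : ∀ m : Ideal Z, m.IsMaximal →
      ∃! Q : TwoSidedIdeal A, IsCoatom Q ∧ ∀ z ∈ m, algebraMap Z A z ∈ Q)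
    -- the prime ideal `P`
    (P : Spec A)
    (hP : ∀ I : TwoSidedIdeal A, IsStableIdeal H I → I ≤ P.ideal → I = ⊥)
    -- the Hopf module `M`, with its `Z`-module structure induced by that over `A`
    [AddCommGroup M] [Module k M] [Module H M] [IsScalarTower k H M]
    [Module Aᵐᵒᵖ M] [IsScalarTower k Aᵐᵒᵖ M] [Module Z M] [IsScalarTower Z Aᵐᵒᵖ M]
    (hM : IsHopfModule k H A M) (hMfin : IsLocallyFinite H A M) :
    let S : Submonoid Z := (P.contract Z).asIdeal.primeCompl
    let l : ℕ := lengthGcd (LocalizedModule S A)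
    -- the lengths that define `l` are finite, and `l` is positive
    (∀ Q : TwoSidedIdeal (LocalizedModule S A), IsCoatom Q → quotLength Q ≠ ⊤) ∧ 0 < l ∧
      Module.Free (LocalizedModule S A)ᵐᵒᵖ (Fin l → LocalizedModule S M) := by
  have hsimple : ∀ (q : Ideal Z) [q.IsPrime], IsSimpleRing (ResidueRing A q) := fun q _ =>
    isSimpleRing_residueRing hZinj hmax q
  have := hsimple (P.contract Z).asIdeal
  obtain ⟨l, hl⟩ : ∃ l : ℕ, Module.length (ResidueRing A (P.contract Z).asIdeal)
      (ResidueRing A (P.contract Z).asIdeal) = l :=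
    (ENat.ne_top_iff_exists.mp Module.length_ne_top).imp fun _ h => h.symm
  have hpos : 0 < l := by
    have h : 0 < Module.length (ResidueRing A (P.contract Z).asIdeal)
      (ResidueRing A (P.contract Z).asIdeal) := Module.length_pos
    rw [hl] at h
    exact_mod_cast h
  intro S l'
  have hl' : l' = l := lengthGcd_eq hl hpos
  refine ⟨fun Q hQ => ?_, hl' ▸ hpos, ?_⟩
  · rw [quotLength_eq hQ]
    exact Module.length_ne_top
  · rw [hl']
    -- A stable ideal nilpotent at `P ∩ Z` lies in `P`, hence is zero.
    exact free_of_isLocallyFinite hA hM hMfin hsimple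
      (fun I hI hIP => hP I hI (Spec.le_of_nilpotentAt hIP)) hl
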